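/- Let $d\ge 1$. A point of the moduli space $[SO(d)\times SO(d)]\backslash SO(d,d,\mathbb R)$ is a pair $(g,B)$ of a real positive definite symmetric $d\times d$ matrix $g$ and a real antisymmetric matrix $B$; $V_d=\sqrt{\det g}$. Let $\partial/\partial g_{ij}$ be the derivative normalised by $\partial g_{kl}/\partial g_{ij}=\delta_{ik}\delta_{jl}+\delta_{il}\delta_{jk}$ (that is, with respect to $(1-\frac12\delta_{ij})g_{ij}$), let $\partial B_{kl}/\partial B_{ij}=\delta_{ik}\delta_{jl}-\delta_{il}\delta_{jk}$, and, summing over all repeated indices, put $$\Delta_{SO(d,d)}=\tfrac14 g_{ik}g_{jl}\Big[\frac{\partial}{\partial g_{ij}}\frac{\partial}{\partial g_{kl}}+\frac{\partial}{\partial B_{ij}}\frac{\partial}{\partial B_{kl}}\Big]+\tfrac12 g_{ij}\frac{\partial}{\partial g_{ij}},$$ $$\square_d=\tfrac14 g_{ik}g_{jl}\frac{\partial}{\partial g_{ij}}\frac{\partial}{\partial g_{kl}}+\tfrac{d+1}4 g_{ij}\frac{\partial}{\partial g_{ij}}-\tfrac18\Big(g_{ij}\frac{\partial}{\partial g_{ij}}\Big)^2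 .$$ For $\mathcal R=V,S,C$ consider the constrained Eisenstein series $$\mathcal E_{\mathcal R;s}(g,B)=\sum_{m}[\mathcal M^2_{\mathcal R}(m)]^{-s},$$ summed over the nonzero integer charges $m$ that satisfy the half-BPS constraint $m\wedge m=0$, where: * $V$ (vector): $m=(m_i,m^i)\in\mathbb Z^{2d}$, $\mathcal M^2=\tilde m_i g^{ij}\tilde m_j+m^ig_{ij}m^j$ with $\tilde m_i=m_i+B_{ij}m^j$, and the constraint is $m_im^i=0$. * $S$ (spinor) and $C$ (conjugate spinor): $m=(m^{[p]})_p$ is a family of integer antisymmetric tensors $m^{i_1\dots i_p}$ of all odd, respectively all even, degrees $0\le p\le d$; $\mathcal M^2=\frac1{V_d}\sum_p\frac1{p!}(\tilde m^{[p]})^2$, the squares being taken with $g$, with $\tilde m=e^{\beta}m$, $(\beta m)^{i_1\dots i_p}=\frac12B_{jk}m^{jki_1\dots i_p}$. The constraint is that $m\otimes m$ lies in the highest irreducible component (the one generated by the square of a highest weight vector) of the symmetric square of the spinor representation of $\mathfrak{so}(d,d)$. Let $N=2d$ for $V$ and $N=2^{d-1}$ for $S,C$. The series converges absolutely for $\operatorname{Re}s>N/2$.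 Below, "$\mathcal E_{\mathcal R;s}$ is an eigenmode of $D$ with eigenvalue $\lambda$" means: (i) every term of the series satisfies $D[\mathcal M^2(m)]^{-s}=\lambda[\mathcal M^2(m)]^{-s}$ on the moduli space (the eigenvalue equation for the formal series); (ii) if the series of order $s$ converges absolutely on the moduli space, its sum is $C^2$ and satisfies $D\mathcal E=\lambda\mathcal E$; (iii) if $U\ni s$ is a connected open subset of $\mathbb C$ containing $\{\operatorname{Re}s>N/2\}$ and the series has a continuation to $U$ that is holomorphic in $s$ and jointly $C^2$ in $s$ and the moduli, then the continued function satisfies $D\mathcal E_s=\lambda\mathcal E_s$ at $s$. 1. For every $s\in\mathbb C$, $\mathcal E_{V;s}$ is an eigenmode of $\Delta_{SO(d,d)}$ with eigenvalue $s(s-d+1)$ and of $\square_d$ with eigenvalue $s(s-d+1)/2$. 2. For every $s\in\mathbb C$, $\mathcal E_{S;s}$ and $\mathcal E_{C;s}$ are eigenmodes of $\Delta_{SO(d,d)}$ with eigenvalue $sd(s-d+1)/4$. 3. At $s=1$, $\mathcal E_{S;s}$ and $\mathcal E_{C;s}$ are eigenmodes of $\square_d$ with eigenvalue $d(2-d)/8$;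 here in (iii) it is understood that, at each point of the moduli space, the lattice sums $\sum_mP(m)[\mathcal M^2(m)]^{-s-2}$ over the same charges, with $P$ a homogeneous quartic polynomial, also continue holomorphically to $U$. 4. There is no other such order, apart from the trivial order $s=0$ and low dimensions: for $s\neq0$, the terms of $\mathcal E_{S;s}$ are eigenfunctions of $\square_d$ with one common eigenvalue if and only if $s=1$ or $d\in\{1,2,4\}$, and those of $\mathcal E_{C;s}$ if and only if $s=1$ or $d\in\{1,2\}$. Moreover, if $s\ne1$ and the series converges absolutely, then the sum $\mathcal E_{S;s}$ for $d=3$ or $d\ge5$, and the sum $\mathcal E_{C;s}$ for $d\ge3$, is not an eigenfunction of $\square_d$ for any eigenvalue. 5. For $d=4$ and every $s\in\mathbb C$, $\mathcal E_{S;s}$ is an eigenmode of $\square_4$ with eigenvalue $s(s-3)/2$. -/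

import Mathlib

open scoped TensorProduct BigOperators

noncomputable section

namespace TDuality

/-! ## The moduli space `[SO(d) × SO(d)] \ SO(d,d,ℝ)` in the coordinates `(g, B)` -/

/-- A background `x = g + B` of the torus `T^d`: the symmetric part of the matrix `x` is the metric
`g` and its antisymmetric part is the two-form `B`. This packs the `d²` moduli `(g_{ij}, B_{ij})`
into a single real vector space. -/
abbrev Background (d : ℕ) : Type := Fin d → Fin d → ℝ

/-- The metric `g_{ij}`. -/
def metric {d : ℕ} (x : Background d) : Matrix (Fin d) (Fin d) ℝ :=
  Matrix.of fun i j => (x i j + x j i) / 2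

/-- The antisymmetric tensor `B_{ij}`. -/
def bField {d : ℕ} (x : Background d) : Matrix (Fin d) (Fin d) ℝ :=
  Matrix.of fun i j => (x i j - x j i) / 2

/-- The moduli space: `g` is positive definite, `B` is arbitrary. It is open in `ℝ^{d²}`. -/
def moduli (d : ℕ) : Set (Background d) := {x | (metric x).PosDef}

/-! ## The differential operators -/

/-- The elementary matrix `E_{ij}`. -/
def unitDir {d : ℕ} (i j : Fin d) : Background d := Pi.single i (Pi.single j 1)

/-- `∂/∂g_{ij}` with respect to the diagonally rescaled metric `g̃_{ij} = (1 - δ_{ij}/2) g_{ij}`: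
`∂g_{kl}/∂g̃_{ij} = δ_{ik} δ_{jl} + δ_{il} δ_{jk}`. -/
def dG {d : ℕ} (i j : Fin d) (F : Background d → ℂ) : Background d → ℂ :=
  fun x => lineDeriv ℝ F x (unitDir i j + unitDir j i)

/-- `∂/∂B_{ij}`, with `∂B_{kl}/∂B_{ij} = δ_{ik} δ_{jl} - δ_{il} δ_{jk}`. -/
def dB {d : ℕ} (i j : Fin d) (F : Background d → ℂ) : Background d → ℂ :=
  fun x => lineDeriv ℝ F x (unitDir i j - unitDir j i)

/-- The first order operator `g_{ij} ∂/∂g_{ij}`. -/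
def scaleOp {d : ℕ} (F : Background d → ℂ) : Background d → ℂ :=
  fun x => ∑ i, ∑ j, (metric x i j : ℂ) * dG i j F x

/-- `Δ_{SO(d,d)} = ¼ g_{ik} g_{jl} [∂/∂g_{ij} ∂/∂g_{kl} + ∂/∂B_{ij} ∂/∂B_{kl}]
  + ½ g_{ij} ∂/∂g_{ij}`. -/
def laplaceSO {d : ℕ} (F : Background d → ℂ) : Background d → ℂ := fun x =>
  (1 / 4) * (∑ i, ∑ j, ∑ k, ∑ l, (metric x i k : ℂ) * (metric x j l : ℂ) *
      (dG i j (dG k l F) x + dB i j (dB k l F) x))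
    + (1 / 2) * scaleOp F x

/-- `Δ_{Gl(d)} = ¼ g_{ik} g_{jl} ∂/∂g_{ij} ∂/∂g_{kl} + ((d+1)/4) g_{ij} ∂/∂g_{ij}`. -/
def laplaceGL {d : ℕ} (F : Background d → ℂ) : Background d → ℂ := fun x =>
  (1 / 4) * (∑ i, ∑ j, ∑ k, ∑ l, (metric x i k : ℂ) * (metric x j l : ℂ) * dG i j (dG k l F) x)
    + (((d : ℂ) + 1) / 4) * scaleOp F x

/-- `□_d = Δ_{Gl(d)} - ⅛ (g_{ij} ∂/∂g_{ij})²`. -/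
def box {d : ℕ} (F : Background d → ℂ) : Background d → ℂ := fun x =>
  laplaceGL F x - (1 / 8) * scaleOp (scaleOp F) x

/-- `D f = lam f` on the moduli space. -/
def EigenEq {d : ℕ} (D : (Background d → ℂ) → Background d → ℂ) (lam : ℂ)
    (f : Background d → ℂ) : Prop :=
  ∀ x ∈ moduli d, D f x = lam * f x

/-! ## Constrained lattice sums -/

/-- A lattice `ℤ^Index` of charges, the set of charges that are summed over (nonzero and half-BPS)
and the mass formula `𝓜²(m)` as a function of the moduli. -/
structure ChargeSystem (d : ℕ) where
  Index : Type
  fintypeIndex : Fintype Index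
  charges : Set (Index → ℤ)
  massSq : Background d → (Index → ℝ) → ℝ

attribute [instance] ChargeSystem.fintypeIndex

namespace ChargeSystem

variable {d : ℕ} (R : ChargeSystem d)

/-- `𝓜²` of an integer charge. -/
def mass (x : Background d) (m : R.Index → ℤ) : ℝ := R.massSq x fun a => (m a : ℝ)

/-- The summand `[𝓜²(m)]^{-s}`. -/
def term (s : ℂ) (m : R.Index → ℤ) (x : Background d) : ℂ := (R.mass x m : ℂ) ^ (-s)

/-- The Eisenstein series `∑ δ(m ∧ m) [𝓜²(m)]^{-s}` over nonzero charges. -/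
def series (s : ℂ) (x : Background d) : ℂ := ∑' m : R.charges, R.term s m x

/-- The series of order `s` converges absolutely on the whole moduli space. -/
def ConvergesAt (s : ℂ) : Prop :=
  ∀ x ∈ moduli d, Summable fun m : R.charges => ‖R.term s m x‖

/-- The half-plane `Re s > N/2`, where `N` is the rank of the charge lattice. -/
def halfPlane : Set ℂ := {s | (Fintype.card R.Index : ℝ) / 2 < s.re}

/-- `E` is an analytic continuation in `s` of the Eisenstein series to the domain `U`: it is
holomorphic in `s`, jointly twice continuously differentiable in `s` and the moduli, and it is the
Eisenstein series on the half-plane `Re s > N/2`. -/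
structure IsContinuation (U : Set ℂ) (E : ℂ → Background d → ℂ) : Prop where
  isOpen : IsOpen U
  isPreconnected : IsPreconnected U
  halfPlane_subset : R.halfPlane ⊆ U
  holomorphic : ∀ x ∈ moduli d, DifferentiableOn ℂ (fun s => E s x) U
  contDiffOn : ContDiffOn ℝ 2 (fun p : ℂ × Background d => E p.1 p.2) (U ×ˢ moduli d)
  eq_series : ∀ s ∈ R.halfPlane, ∀ x ∈ moduli d, E s x = R.series s x

/-- The lattice sums `∑ δ(m ∧ m) P(m) [𝓜²(m)]^{-s-2}` with quartic polynomial insertions `P`, of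
which the termwise second derivatives of the series are combinations, continue analytically to
`U` as well. -/
def InsertionsContinue (U : Set ℂ) : Prop :=
  ∀ x ∈ moduli d, ∀ P : MvPolynomial R.Index ℝ, P.IsHomogeneous 4 →
    ∃ F : ℂ → ℂ, DifferentiableOn ℂ F U ∧ ∀ s ∈ R.halfPlane,
      F s = ∑' m : R.charges,
        ((MvPolynomial.eval (fun a => ((m : R.Index → ℤ) a : ℝ)) P : ℝ) : ℂ) * R.term (s + 2) m x

/-- The formal Eisenstein series of order `s` is an eigenmode of `D` with eigenvalue `lam`: acting
with `D` term by term multiplies every term by `lam`. -/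
def TermwiseEigenmode (D : (Background d → ℂ) → Background d → ℂ) (s lam : ℂ) : Prop :=
  ∀ m ∈ R.charges, EigenEq D lam (R.term s m)

/-- If the Eisenstein series of order `s` converges, its sum is twice continuously differentiable
and is an eigenmode of `D` with eigenvalue `lam`. -/
def SumEigenmode (D : (Background d → ℂ) → Background d → ℂ) (s lam : ℂ) : Prop :=
  R.ConvergesAt s → ContDiffOn ℝ 2 (R.series s) (moduli d) ∧ EigenEq D lam (R.series s)

/-- The eigenvalue equation at order `s` for the formal series, for its sum where it converges, and
for all its analytic continuations. -/
structure IsEigenmode (D : (Background d → ℂ) → Background d → ℂ) (s lam : ℂ) : Prop where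
  termwise : R.TermwiseEigenmode D s lam
  sum : R.SumEigenmode D s lam
  continued : ∀ U E, R.IsContinuation U E → s ∈ U → EigenEq D lam (E s)

/-- The same for an eigenvalue equation that holds at an isolated order `s` only; the continuation
is taken on a domain to which the sums with quartic insertions continue too. -/
structure IsIsolatedEigenmode (D : (Background d → ℂ) → Background d → ℂ) (s lam : ℂ) : Prop where
  termwise : R.TermwiseEigenmode D s lam
  sum : R.SumEigenmode D s lam
  continued : ∀ U E, R.IsContinuation U E → R.InsertionsContinue U → s ∈ U → EigenEq D lam (E s)

end ChargeSystem

/-! ## The vector representation -/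

/-- The dressed momenta `m̃_i = m_i + B_{ij} m^j`. The charge `m` has the momenta
`m_i = m (Sum.inl i)` and the windings `m^i = m (Sum.inr i)`. -/
def dressedMomentum {d : ℕ} (x : Background d) (m : Fin d ⊕ Fin d → ℝ) (i : Fin d) : ℝ :=
  m (Sum.inl i) + ∑ j, bField x i j * m (Sum.inr j)

/-- The vector representation: `𝓜² = m̃_i g^{ij} m̃_j + m^i g_{ij} m^j`, with the half-BPS
condition `m_i m^i = 0`. -/
def vectorSystem (d : ℕ) : ChargeSystem d where
  Index := Fin d ⊕ Fin d
  fintypeIndex := inferInstance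
  charges := {m | m ≠ 0 ∧ ∑ i, m (Sum.inl i) * m (Sum.inr i) = 0}
  massSq x m :=
    (∑ i, ∑ j, dressedMomentum x m i * (metric x)⁻¹ i j * dressedMomentum x m j)
      + ∑ i, ∑ j, m (Sum.inr i) * metric x i j * m (Sum.inr j)

/-! ## The spinor representations -/

/-- Antisymmetric tensors `m = (m^{[0]}, m^{[1]}, …, m^{[d]})` on `ℝ^d`; the component
`m^{i₁ … i_p}` with `i₁ < … < i_p` is the value at `{i₁, …, i_p}`. -/
abbrev Fock (d : ℕ) : Type := Finset (Fin d) → ℝ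

/-- The sign that moves the index `i` in front of `I` to its ordered place. -/
def orderSign {d : ℕ} (i : Fin d) (I : Finset (Fin d)) : ℝ :=
  (-1) ^ (I.filter fun k => k < i).card

/-- The contraction `(ι_i m)^{i₂ … i_p} = m^{i i₂ … i_p}`. -/
def contract {d : ℕ} (i : Fin d) : Fock d →ₗ[ℝ] Fock d where
  toFun m I := if i ∈ I then 0 else orderSign i I * m (insert i I)
  map_add' m n := by
    funext I
    by_cases h : i ∈ I <;> simp [h, mul_add]
  map_smul' c m := by
    funext I
    by_cases h : i ∈ I <;> simp [h, mul_left_comm]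

/-- The exterior product `m ↦ e_i ∧ m`. -/
def wedge {d : ℕ} (i : Fin d) : Fock d →ₗ[ℝ] Fock d where
  toFun m I := if i ∈ I then orderSign i (I.erase i) * m (I.erase i) else 0
  map_add' m n := by
    funext I
    by_cases h : i ∈ I <;> simp [h, mul_add]
  map_smul' c m := by
    funext I
    by_cases h : i ∈ I <;> simp [h, mul_left_comm]

/-- The generators `ι_i ι_j`, `e_i ∧ e_j ∧` and `e_i ∧ ι_j - ½ δ_{ij}` of `so(d,d)` in the spinor
representation on `Fock d`. -/
def soGenerators (d : ℕ) : Set (Fock d →ₗ[ℝ] Fock d) :=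
  {X | ∃ i j : Fin d, X = contract i ∘ₗ contract j ∨ X = wedge i ∘ₗ wedge j ∨
    X = wedge i ∘ₗ contract j - (if i = j then (1 / 2 : ℝ) else 0) • LinearMap.id}

/-- The highest irreducible component of the symmetric square of the spinor representation formed
by the tensors whose degrees have the given parity: the smallest `so(d,d)`-invariant subspace
that contains the squares of the basis tensors `e_I`. (These are the extremal weight vectors: they
are permuted, up to signs, by the Weyl group, and each is a highest weight vector for some choice
of positive roots.) -/
def highestComponent (d parity : ℕ) : Submodule ℝ (Fock d ⊗[ℝ] Fock d) :=
  sInf {W : Submodule ℝ (Fock d ⊗[ℝ] Fock d) | (∀ I : Finset (Fin d), I.card % 2 = parity →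
        (Pi.single I 1 : Fock d) ⊗ₜ[ℝ] (Pi.single I 1 : Fock d) ∈ W) ∧
      ∀ X ∈ soGenerators d, ∀ T ∈ W,
        TensorProduct.map X LinearMap.id T + TensorProduct.map LinearMap.id X T ∈ W}

/-- `β m = ½ B_{jk} m^{jk …}`. -/
def bContract {d : ℕ} (x : Background d) : Fock d →ₗ[ℝ] Fock d :=
  ∑ j, ∑ k, (bField x j k / 2) • (contract k ∘ₗ contract j)

/-- The dressed charge `m̃ = exp(β) m = m + ½ B_{jk} m^{jk …} + ⅛ B_{jk} B_{lm} m^{jklm …} + …`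
(`β` lowers the degree by two, so that the exponential series is finite). -/
def dressedSpinor {d : ℕ} (x : Background d) (m : Fock d) : Fock d :=
  ∑ n ∈ Finset.range (d + 1), ((n.factorial : ℝ)⁻¹) • ((bContract x) ^ n) m

/-- The minor of `g` with rows `I` and columns `J`: the metric induced on antisymmetric tensors. -/
def minor {d : ℕ} (g : Matrix (Fin d) (Fin d) ℝ) (I J : Finset (Fin d)) : ℝ :=
  if h : I.card = J.card then
    (g.submatrix (I.orderEmbOfFin rfl) (J.orderEmbOfFin h.symm)).det
  else 0

/-- The indices of the tensors whose degrees have the given parity. -/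
abbrev SpinorIndex (d parity : ℕ) : Type := {I : Finset (Fin d) // I.card % 2 = parity}

/-- A spinor as an element of `Fock d`. -/
def toFock {d parity : ℕ} (m : SpinorIndex d parity → ℝ) : Fock d :=
  fun I => if h : I.card % 2 = parity then m ⟨I, h⟩ else 0

/-- The spinor representation of the given parity:
`𝓜² = (1/V_d) ∑_p (1/p!) (m̃^{[p]})²`, where `V_d = √(det g)` and the squares are taken with the
metric `g`. The half-BPS condition `m ∧ m = 0` says that `m ⊗ m` lies in the highest irreducible
component of the symmetric square. -/
def spinSystem (d parity : ℕ) : ChargeSystem d where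
  Index := SpinorIndex d parity
  fintypeIndex := inferInstance
  charges := {m | m ≠ 0 ∧
    toFock (fun a => (m a : ℝ)) ⊗ₜ[ℝ] toFock (fun a => (m a : ℝ)) ∈ highestComponent d parity}
  massSq x m := (1 / √((metric x).det)) *
    ∑ I, ∑ J, dressedSpinor x (toFock m) I * minor (metric x) I J * dressedSpinor x (toFock m) J

/-- The spinor representation `S`, with charges `(m^{[1]}, m^{[3]}, …)`. -/
def spinorSystem (d : ℕ) : ChargeSystem d := spinSystem d 1

/-- The conjugate spinor representation `C`, with charges `(m^{[0]}, m^{[2]}, …)`. -/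
def conjSpinorSystem (d : ℕ) : ChargeSystem d := spinSystem d 0

end TDuality

end

open scoped TensorProduct BigOperators
noncomputable section
namespace TDuality
variable {d : ℕ}

/-! ## Clifford relations on antisymmetric tensors -/

/-! For a positive function f of the moduli and D one of the two operators, D f^{-s} = f^{-s-2} (-s
f Df + s(s+1) Γ), where Γ is the principal symbol of D evaluated on the gradient of f
(`Jet.laplaceSO_cpow`, `Jet.box_cpow`). It therefore suffices to compute D𝓜² and Γ for a single
charge.

Vector: 𝓜² is the sum of a momentum part and a winding part, whose vectors are orthogonal for g
because m_i m^i = 0 (`metricPair_momentum_winding`). This makes Γ equal to 𝓜⁴ for Δ and to 𝓜⁴/2 for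
□.

Spinor: let ψ = e^β m, let ⟨,⟩ be the metric on tensors divided by V_d, and N the degree. A
derivative in g puts one contraction ι on each side of ⟨ψ,ψ⟩, a derivative in B puts two on one
side, and contracting indices with g turns ι into its adjoint e∧. So D𝓜² involves only ⟨ψ,ψ⟩, ⟨ψ,Nψ⟩
and ⟨ψ,N²ψ⟩, while Γ involves products of bilinear currents of ψ. The constraint enters through the
quadratic equation Σ (e_i∧ψ ⊗ ι_iψ + ι_iψ ⊗ e_i∧ψ) = 0: the left side is so(d,d)-equivariant in ψ ⊗
ψ and vanishes on the squares of the e_I, hence on the highest component (`isPure_of_mem`). It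
implies two Fierz identities, `IsPure.trace_currentMatrix_sq` and `IsPure.two_mul_pairCurrent`. The
first gives the eigenvalue of Δ. Both together give (`box_spinMass_cpow`) that □ acts on 𝓜^{-2s} as
s²d(2-d)/8 plus a source s(1-s)/2 · 𝓜²⟨ψ,N(N-d)ψ⟩ · 𝓜^{-2(s+2)}. The source disappears at s = 1. It
is a multiple of the original term if p(p-d) is constant on the degrees p of the given parity, as
for d = 1, 2, 4 (S) and d = 1, 2 (C).

Sums: 𝓜² is homogeneous in the charge, so a term is a constant coefficient times a smooth function
of the moduli and of a direction in a compact sphere. Convergent series can thus be differentiated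
termwise (`ChargeSystem.Regular.local_series`). For a continuation E, D E_s is holomorphic in s
(`IsContinuation.differentiableOn_operator`), and the identity theorem carries the equation from the
half-plane to U.

Converse: the charge e_I with |I| = p forces an equation containing p(p-d). Two degrees p ≠ q with p
+ q ≠ d then leave only s = 0 and s = 1. For the sum, the charges n e_I are isolated by shrinking
the directions in I and growing the others: after rescaling, all other charges drop out in the limit
and the same equation appears multiplied by 2ζ(2s) ≠ 0 (`eigenvalue_of_sum`). -/

lemma contract_apply (i : Fin d) (m : Fock d) (I : Finset (Fin d)) :
    contract i m I = if i ∈ I then 0 else orderSign i I * m (insert i I) := rfl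

lemma wedge_apply (i : Fin d) (m : Fock d) (I : Finset (Fin d)) :
    wedge i m I = if i ∈ I then orderSign i (I.erase i) * m (I.erase i) else 0 := rfl

lemma orderSign_mul_self (i : Fin d) (I : Finset (Fin d)) :
    orderSign i I * orderSign i I = 1 := by
  unfold orderSign
  rw [← mul_pow]; norm_num

lemma orderSign_insert {i j : Fin d} {I : Finset (Fin d)} (hj : j ∉ I) :
    orderSign i (insert j I) = (if j < i then -1 else 1) * orderSign i I := by
  unfold orderSign
  rw [Finset.filter_insert]
  split_ifs with h
  · rw [Finset.card_insert_of_notMem (by simp [hj]), pow_succ]; ring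
  · ring

/-- Exactly one of the two orders of insertion makes i and j cross. The Clifford relations for two
distinct indices all reduce to this sign. -/
lemma orderSign_swap {i j : Fin d} (hij : i ≠ j) {I : Finset (Fin d)} (hi : i ∉ I) (hj : j ∉ I) :
    orderSign i I * orderSign j (insert i I) = -(orderSign j I * orderSign i (insert j I)) := by
  rw [orderSign_insert hi, orderSign_insert hj]
  rcases lt_or_gt_of_ne hij with h | h
  · simp [h, h.not_gt]; ring
  · simp [h, h.not_gt]; ring

lemma contract_contract (i j : Fin d) (m : Fock d) :
    contract i (contract j m) = -contract j (contract i m) := by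
  funext I
  simp only [contract_apply, Pi.neg_apply, Finset.mem_insert]
  by_cases hij : i = j
  · subst hij; simp
  by_cases hi : i ∈ I
  · simp [hi]
  by_cases hj : j ∈ I
  · simp [hj]
  simp only [hi, hj, hij, Ne.symm hij, if_false, or_self]
  rw [Finset.insert_comm j i, ← mul_assoc, ← mul_assoc, orderSign_swap hij hi hj]
  ring

lemma wedge_wedge (i j : Fin d) (m : Fock d) :
    wedge i (wedge j m) = -wedge j (wedge i m) := by
  funext I
  simp only [wedge_apply, Pi.neg_apply, Finset.mem_erase]
  by_cases hij : i = j
  · subst hij; simp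
  by_cases hi : i ∈ I
  · by_cases hj : j ∈ I
    · simp only [hi, hj, hij, Ne.symm hij, if_true, not_false_eq_true, and_self, ne_eq]
      obtain ⟨K, hK, hjK⟩ : ∃ K, I = insert i (insert j K) ∧ i ∉ insert j K ∧ j ∉ K := by
        refine ⟨(I.erase i).erase j, ?_, ?_, ?_⟩
        · rw [Finset.insert_erase, Finset.insert_erase hi]; simp [hj, Ne.symm hij]
        · simp [hij]
        · simp
      obtain ⟨h1, h2⟩ := hjK
      have h3 : i ∉ K := fun h => h1 (Finset.mem_insert_of_mem h)
      have h4 : j ∉ insert i K := by simp [h2, Ne.symm hij]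
      have e1 : I.erase i = insert j K := by rw [hK, Finset.erase_insert h1]
      have e2 : I.erase j = insert i K := by
        rw [hK, Finset.insert_comm, Finset.erase_insert h4]
      rw [e1, e2, Finset.erase_insert h2, Finset.erase_insert h3, ← mul_assoc, ← mul_assoc]
      have := orderSign_swap hij h3 h2
      linear_combination this * m K
    · simp [hj]
  · simp [hi]

lemma contract_wedge (i j : Fin d) (m : Fock d) :
    contract i (wedge j m) = (if i = j then m else 0) - wedge j (contract i m) := by
  funext I
  simp only [wedge_apply, contract_apply, Pi.sub_apply, Finset.mem_erase, Finset.mem_insert]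
  by_cases hij : i = j
  · subst hij
    by_cases hi : i ∈ I
    · simp only [hi, if_true, ne_eq, not_true_eq_false, false_and, if_false, Finset.insert_erase]
      rw [← mul_assoc, orderSign_mul_self]; simp
    · simp only [hi, if_false, true_or, if_true, Finset.erase_insert hi]
      rw [← mul_assoc, orderSign_mul_self]; simp
  simp only [hij, Ne.symm hij, if_false, false_or, Pi.zero_apply, zero_sub]
  by_cases hi : i ∈ I
  · simp [hi, hij]
  by_cases hj : j ∈ I
  · simp only [hi, hj, hij, if_true, if_false, not_false_eq_true, ne_eq, and_false]
    obtain ⟨K, hK, hjK⟩ : ∃ K, I = insert j K ∧ j ∉ K :=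
      ⟨I.erase j, (Finset.insert_erase hj).symm, by simp⟩
    have h3 : i ∉ K := fun h => hi (hK ▸ Finset.mem_insert_of_mem h)
    have h4 : j ∉ insert i K := by simp [hjK, Ne.symm hij]
    have e1 : I.erase j = K := by rw [hK, Finset.erase_insert hjK]
    rw [e1, hK, Finset.insert_comm, Finset.erase_insert h4, ← mul_assoc, ← mul_assoc]
    -- The swap relation is multiplied by `orderSign i K * orderSign i (insert j K)`; the repeated
    -- signs then cancel through the squares `h6` and `h7`.
    have h5 := orderSign_swap hij h3 hjK
    have h6 := orderSign_mul_self i K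
    have h7 := orderSign_mul_self i (insert j K)
    linear_combination (orderSign i K * orderSign i (insert j K) * m (insert i K)) * h5
      - (orderSign j (insert i K) * orderSign i (insert j K) * m (insert i K)) * h6
      - (orderSign i K * orderSign j K * m (insert i K)) * h7
  · simp [hj]

/-- The number operator multiplies a tensor by its degree. -/
def number : Fock d →ₗ[ℝ] Fock d := ∑ i, wedge i ∘ₗ contract i

lemma number_eq_sum (m : Fock d) : number m = ∑ i, wedge i (contract i m) := by
  simp [number]

lemma number_apply (m : Fock d) (I : Finset (Fin d)) : number m I = I.card * m I := by
  rw [number_eq_sum, Finset.sum_apply]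
  have : ∀ i, wedge i (contract i m) I = if i ∈ I then m I else 0 := by
    intro i
    simp only [wedge_apply, contract_apply]
    split_ifs with h1
    · simp at *
    · simp only [Finset.insert_erase h1]
      rw [← mul_assoc, orderSign_mul_self]; simp
    · rfl
  simp [this]

lemma contract_number (i : Fin d) (m : Fock d) :
    contract i (number m) = number (contract i m) + contract i m := by
  funext I
  simp only [Pi.add_apply, contract_apply, number_apply]
  split_ifs with h
  · simp
  · rw [Finset.card_insert_of_notMem h]; push_cast; ring

lemma wedge_number (i : Fin d) (m : Fock d) :
    wedge i (number m) = number (wedge i m) - wedge i m := by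
  funext I
  simp only [Pi.sub_apply, wedge_apply, number_apply]
  split_ifs with h
  · rw [Finset.card_erase_of_mem h, Nat.cast_sub (Finset.card_pos.2 ⟨i, h⟩)]; push_cast; ring
  · simp

/-- The wedge product is the transpose of the contraction. -/
lemma sum_mul_contract (i : Fin d) (φ ψ : Fock d) :
    ∑ I, φ I * contract i ψ I = ∑ I, wedge i φ I * ψ I := by
  simp only [contract_apply, wedge_apply, mul_ite, ite_mul, mul_zero, zero_mul]
  have h1 : ∑ I, (if i ∈ I then (0 : ℝ) else φ I * (orderSign i I * ψ (insert i I))) =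
      ∑ I with i ∉ I, φ I * (orderSign i I * ψ (insert i I)) := by
    rw [Finset.sum_filter]; simp only [ite_not]
  rw [h1, ← Finset.sum_filter]
  refine Finset.sum_bij' (fun I _ => insert i I) (fun I _ => I.erase i) ?_ ?_ ?_ ?_ ?_
  · simp
  · simp
  · intro I hI; exact Finset.erase_insert (by simpa using hI)
  · intro I hI; exact Finset.insert_erase (by simpa using hI)
  · intro I hI
    rw [Finset.erase_insert (by simpa using hI)]; ring

/-! ## Minors -/

lemma minor_eq {A : Matrix (Fin d) (Fin d) ℝ} {I J : Finset (Fin d)} {p : ℕ} (hI : I.card = p)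
    (hJ : J.card = p) :
    minor A I J = (A.submatrix (I.orderEmbOfFin hI) (J.orderEmbOfFin hJ)).det := by
  subst hI
  rw [minor, dif_pos hJ.symm]

lemma minor_of_card_ne {A : Matrix (Fin d) (Fin d) ℝ} {I J : Finset (Fin d)}
    (h : I.card ≠ J.card) : minor A I J = 0 := by
  rw [minor, dif_neg h]

lemma minor_transpose (A : Matrix (Fin d) (Fin d) ℝ) (I J : Finset (Fin d)) :
    minor A.transpose I J = minor A J I := by
  by_cases h : I.card = J.card
  · rw [minor_eq h rfl, minor_eq rfl h, ← Matrix.det_transpose]; rfl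
  · rw [minor_of_card_ne h, minor_of_card_ne (Ne.symm h)]

lemma card_erase_orderEmb {K : Finset (Fin d)} {p : ℕ} (hK : K.card = p + 1) (r : Fin (p + 1)) :
    (K.erase (K.orderEmbOfFin hK r)).card = p := by
  rw [Finset.card_erase_of_mem (Finset.orderEmbOfFin_mem _ _ _), hK]; rfl

lemma orderEmbOfFin_erase {K : Finset (Fin d)} {p : ℕ} (hK : K.card = p + 1) (r : Fin (p + 1))
    (k : Fin p) :
    (K.erase (K.orderEmbOfFin hK r)).orderEmbOfFin (card_erase_orderEmb hK r) k =
      K.orderEmbOfFin hK (r.succAbove k) := by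
  have := Finset.orderEmbOfFin_unique (card_erase_orderEmb hK r)
    (f := fun k => K.orderEmbOfFin hK (r.succAbove k)) (fun x => by simp [Fin.succAbove_ne])
    ((K.orderEmbOfFin hK).strictMono.comp (Fin.strictMono_succAbove r))
  exact (congrFun this k).symm

/-- Identifies the sign of the tensor basis with the cofactor sign of a determinant: the elements of
K below its r-th element are the first r ones. -/
lemma orderSign_erase_orderEmb {K : Finset (Fin d)} {p : ℕ} (hK : K.card = p + 1)
    (r : Fin (p + 1)) :
    orderSign (K.orderEmbOfFin hK r) (K.erase (K.orderEmbOfFin hK r)) = (-1) ^ (r : ℕ) := by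
  unfold orderSign
  congr 1
  have : (K.erase (K.orderEmbOfFin hK r)).filter (fun k => k < K.orderEmbOfFin hK r) =
      (Finset.Iio r).map (K.orderEmbOfFin hK).toEmbedding := by
    ext k
    simp only [Finset.mem_filter, Finset.mem_erase, Finset.mem_map, Finset.mem_Iio]
    constructor
    · rintro ⟨⟨_, h2⟩, h3⟩
      obtain ⟨q, rfl⟩ : ∃ q, K.orderEmbOfFin hK q = k := by
        have : k ∈ Set.range (K.orderEmbOfFin hK) := by simpa using h2
        exact this
      exact ⟨q, by simpa using h3, rfl⟩
    · rintro ⟨q, hq, rfl⟩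
      refine ⟨⟨?_, ?_⟩, ?_⟩
      · simp [hq.ne]
      · simp
      · simpa using hq
  rw [this, Finset.card_map, Fin.card_Iio]

/-- The Laplace expansion of a minor along the row `i`. -/
lemma sum_mul_minor_erase (A : Matrix (Fin d) (Fin d) ℝ) (i : Fin d) (I J : Finset (Fin d)) :
    ∑ j ∈ J, A i j * (orderSign j (J.erase j) * minor A I (J.erase j)) =
      if i ∈ I then 0 else orderSign i I * minor A (insert i I) J := by
  by_cases hc : J.card = I.card + 1
  · have hsum : ∑ j ∈ J, A i j * (orderSign j (J.erase j) * minor A I (J.erase j)) =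
        ∑ k : Fin (I.card + 1), A i (J.orderEmbOfFin hc k) * ((-1) ^ (k : ℕ) *
          (A.submatrix (I.orderEmbOfFin rfl)
            (J.orderEmbOfFin hc ∘ k.succAbove)).det) := by
      conv_lhs => rw [← Finset.map_orderEmbOfFin_univ J hc, Finset.sum_map]
      refine Finset.sum_congr rfl fun k _ => ?_
      have e : (J.orderEmbOfFin hc).toEmbedding k = J.orderEmbOfFin hc k := rfl
      rw [Finset.map_orderEmbOfFin_univ J hc, e, orderSign_erase_orderEmb hc k,
        minor_eq rfl (card_erase_orderEmb hc k)]
      congr 4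
      funext q
      exact orderEmbOfFin_erase hc k q
    rw [hsum]
    split_ifs with hi
    · obtain ⟨q, hq⟩ : ∃ q, I.orderEmbOfFin rfl q = i := by
        have : i ∈ Set.range (I.orderEmbOfFin rfl) := by simpa using hi
        exact this
      -- The left side is the expansion, along its top row, of the matrix obtained by putting row i
      -- above the rows of I. Here row i occurs twice.
      have h0 : (A.submatrix (Fin.cons i (I.orderEmbOfFin rfl) : Fin (I.card + 1) → Fin d)
          (J.orderEmbOfFin hc)).det = 0 := by
        refine Matrix.det_zero_of_row_eq (i := 0) (j := q.succ) (Fin.succ_ne_zero q).symm ?_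
        funext k
        simp [hq]
      rw [Matrix.det_succ_row_zero] at h0
      rw [← h0]
      refine Finset.sum_congr rfl fun k _ => ?_
      simp only [Matrix.submatrix_apply, Fin.cons_zero, Matrix.submatrix_submatrix]
      have : (Fin.cons i (I.orderEmbOfFin rfl) : Fin (I.card + 1) → Fin d) ∘ Fin.succ =
        I.orderEmbOfFin rfl := by funext q; simp
      rw [this]; ring
    · have hK : (insert i I).card = I.card + 1 := Finset.card_insert_of_notMem hi
      -- Row i sits at position r of `insert i I`, and deleting it leaves the rows of I.
      obtain ⟨r, hr⟩ : ∃ r, (insert i I).orderEmbOfFin hK r = i := by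
        have : i ∈ Set.range ((insert i I).orderEmbOfFin hK) := by simp
        exact this
      have hsgn := orderSign_erase_orderEmb hK r
      have hcomp := orderEmbOfFin_erase hK r
      have hcard := card_erase_orderEmb hK r
      have he : (insert i I).erase ((insert i I).orderEmbOfFin hK r) = I := by
        rw [hr, Finset.erase_insert hi]
      have hcomp' : (insert i I).orderEmbOfFin hK ∘ r.succAbove = I.orderEmbOfFin rfl := by
        funext q
        rw [Function.comp_apply, ← hcomp]
        congr 1
        · simp only [he]
      rw [he, hr] at hsgn
      rw [minor_eq hK hc, Matrix.det_succ_row _ r, hsgn, Finset.mul_sum]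
      refine Finset.sum_congr rfl fun k _ => ?_
      rw [Matrix.submatrix_submatrix, hcomp', Matrix.submatrix_apply, hr, pow_add]
      have h1 : ((-1 : ℝ) ^ (r : ℕ)) * (-1) ^ (r : ℕ) = 1 := by rw [← mul_pow]; norm_num
      linear_combination (-(-1 : ℝ) ^ (k : ℕ) * A i (J.orderEmbOfFin hc k) *
        (A.submatrix (I.orderEmbOfFin rfl) (J.orderEmbOfFin hc ∘ k.succAbove)).det) * h1
  · have h1 : ∀ j ∈ J, A i j * (orderSign j (J.erase j) * minor A I (J.erase j)) = 0 := by
      intro j hj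
      rw [minor_of_card_ne, mul_zero, mul_zero]
      rw [Finset.card_erase_of_mem hj]
      have := Finset.card_pos.2 ⟨j, hj⟩
      omega
    rw [Finset.sum_eq_zero h1]
    split_ifs with hi
    · rfl
    · rw [minor_of_card_ne, mul_zero]
      rw [Finset.card_insert_of_notMem hi]; omega

/-- The operator on antisymmetric tensors induced by a matrix. -/
def compound (A : Matrix (Fin d) (Fin d) ℝ) : Fock d →ₗ[ℝ] Fock d :=
  Matrix.mulVecLin (Matrix.of (minor A))

lemma compound_apply (A : Matrix (Fin d) (Fin d) ℝ) (ψ : Fock d) (I : Finset (Fin d)) :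
    compound A ψ I = ∑ J, minor A I J * ψ J := rfl

/-- The Laplace expansion read as an intertwining relation. Together with the value at ∅ it
characterises `compound A`, so that multiplicativity and the diagonal case need no determinants. -/
lemma contract_compound (A : Matrix (Fin d) (Fin d) ℝ) (i : Fin d) (ψ : Fock d) :
    contract i (compound A ψ) = ∑ j, A i j • compound A (contract j ψ) := by
  funext I
  simp only [Finset.sum_apply, Pi.smul_apply, smul_eq_mul, compound_apply]
  have h1 : ∀ j, ∑ K, minor A I K * contract j ψ K =
      ∑ J, (if j ∈ J then orderSign j (J.erase j) * minor A I (J.erase j) else 0) * ψ J := by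
    intro j
    rw [sum_mul_contract j (fun K => minor A I K) ψ]
    rfl
  simp only [h1, Finset.mul_sum]
  rw [Finset.sum_comm]
  have h2 : ∀ J, ∑ j, A i j * ((if j ∈ J then orderSign j (J.erase j) * minor A I (J.erase j)
      else 0) * ψ J) = (if i ∈ I then 0 else orderSign i I * minor A (insert i I) J) * ψ J := by
    intro J
    rw [← sum_mul_minor_erase, Finset.sum_mul, ← Finset.sum_filter_add_sum_filter_not
      Finset.univ (fun j => j ∈ J)]
    rw [Finset.sum_eq_zero (s := Finset.univ.filter fun j => j ∉ J), add_zero]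
    · rw [Finset.filter_univ_mem]
      refine Finset.sum_congr rfl fun j hj => ?_
      rw [if_pos hj]; ring
    · intro j hj
      rw [if_neg (by simpa using hj)]; ring
  simp only [h2, contract_apply, compound_apply]
  split_ifs with h
  · simp
  · rw [Finset.mul_sum]
    exact Finset.sum_congr rfl fun J _ => by ring

lemma compound_apply_empty (A : Matrix (Fin d) (Fin d) ℝ) (ψ : Fock d) :
    compound A ψ ∅ = ψ ∅ := by
  rw [compound_apply, Finset.sum_eq_single ∅]
  · rw [minor_eq Finset.card_empty Finset.card_empty, Matrix.det_fin_zero, one_mul]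
  · intro J _ hJ
    rw [minor_of_card_ne, zero_mul]
    simpa using Finset.card_ne_zero.2 (Finset.nonempty_iff_ne_empty.2 hJ) |>.symm
  · simp

/-- An operator that intertwines the contractions as `compound A` does is `compound A`. -/
lemma eq_compound {A : Matrix (Fin d) (Fin d) ℝ} {L : Fock d →ₗ[ℝ] Fock d}
    (h0 : ∀ ψ, L ψ ∅ = ψ ∅) (hL : ∀ i ψ, contract i (L ψ) = ∑ j, A i j • L (contract j ψ)) :
    L = compound A := by
  -- Up to sign, the component of a tensor at `insert i I` is the component at I of its contraction
  -- with i, so all components are determined recursively by the one at ∅.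
  have key : ∀ (I : Finset (Fin d)) (ψ : Fock d), L ψ I = compound A ψ I := by
    intro I
    induction I using Finset.induction_on with
    | empty => intro ψ; rw [h0, compound_apply_empty]
    | insert i I hi ih =>
      intro ψ
      have h1 := congrFun (hL i ψ) I
      have h2 := congrFun (contract_compound A i ψ) I
      simp only [contract_apply, hi, if_false, Finset.sum_apply, Pi.smul_apply, ih] at h1 h2
      have h3 := orderSign_mul_self i I
      have h4 : orderSign i I * L ψ (insert i I) = orderSign i I * compound A ψ (insert i I) :=
        h1.trans h2.symm
      linear_combination orderSign i I * h4 - (L ψ (insert i I) - compound A ψ (insert i I)) * h3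
  exact LinearMap.ext fun ψ => funext fun I => key I ψ

lemma compound_one : compound (1 : Matrix (Fin d) (Fin d) ℝ) = LinearMap.id :=
  (eq_compound (fun _ => rfl) fun i ψ => by simp [Matrix.one_apply]).symm

/-- The Cauchy-Binet formula. -/
lemma compound_mul (A B : Matrix (Fin d) (Fin d) ℝ) :
    compound (A * B) = compound A ∘ₗ compound B := by
  refine (eq_compound (fun ψ => ?_) fun i ψ => ?_).symm
  · simp [compound_apply_empty]
  · simp only [LinearMap.comp_apply, contract_compound, map_sum, map_smul, Matrix.mul_apply,
      Finset.sum_smul, Finset.smul_sum, smul_smul]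
    exact Finset.sum_comm

/-- A diagonal matrix acts on antisymmetric tensors diagonally. -/
lemma compound_diagonal (t : Fin d → ℝ) (ψ : Fock d) (I : Finset (Fin d)) :
    compound (Matrix.diagonal t) ψ I = (∏ i ∈ I, t i) * ψ I := by
  let L : Fock d →ₗ[ℝ] Fock d :=
    { toFun := fun ψ I => (∏ i ∈ I, t i) * ψ I
      map_add' := fun a b => by funext I; simp [mul_add]
      map_smul' := fun c a => by funext I; simp [mul_left_comm] }
  have h : L = compound (Matrix.diagonal t) := by
    refine eq_compound (fun ψ => ?_) fun i ψ => ?_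
    · simp [L]
    · funext I
      simp only [Matrix.diagonal_apply, ite_smul, zero_smul, Finset.sum_ite_eq, Finset.mem_univ,
        if_true, Pi.smul_apply, smul_eq_mul, L, LinearMap.coe_mk, AddHom.coe_mk, contract_apply]
      split_ifs with hi
      · simp
      · rw [Finset.prod_insert hi]; ring
  rw [← h]; rfl

end TDuality

end

open scoped TensorProduct BigOperators
noncomputable section
namespace TDuality
variable {d : ℕ}

/-! ## The induced metric on antisymmetric tensors -/

/-- The bilinear form induced by a matrix on antisymmetric tensors. -/
def gram (A : Matrix (Fin d) (Fin d) ℝ) : LinearMap.BilinForm ℝ (Fock d) :=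
  Matrix.toBilin' (Matrix.of (minor A))

lemma gram_apply (A : Matrix (Fin d) (Fin d) ℝ) (φ ψ : Fock d) :
    gram A φ ψ = ∑ I, ∑ J, φ I * minor A I J * ψ J := by
  rw [gram, Matrix.toBilin'_apply]; rfl

lemma gram_eq_sum_compound (A : Matrix (Fin d) (Fin d) ℝ) (φ ψ : Fock d) :
    gram A φ ψ = ∑ I, φ I * compound A ψ I := by
  rw [gram_apply]
  refine Finset.sum_congr rfl fun I _ => ?_
  rw [compound_apply, Finset.mul_sum]
  exact Finset.sum_congr rfl fun J _ => by ring

/-- Transposing e_i∧ gives ι_i, which `contract_compound` carries through the matrix. This is the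
recursion by which `gram` is computed from here on. -/
lemma gram_wedge_left (A : Matrix (Fin d) (Fin d) ℝ) (i : Fin d) (φ ψ : Fock d) :
    gram A (wedge i φ) ψ = ∑ j, A i j * gram A φ (contract j ψ) := by
  rw [gram_eq_sum_compound, ← sum_mul_contract, contract_compound]
  simp only [gram_eq_sum_compound, Finset.sum_apply, Pi.smul_apply, smul_eq_mul, Finset.mul_sum]
  rw [Finset.sum_comm]
  exact Finset.sum_congr rfl fun _ _ => Finset.sum_congr rfl fun _ _ => by ring

lemma gram_symm {A : Matrix (Fin d) (Fin d) ℝ} (hA : A.transpose = A) (φ ψ : Fock d) :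
    gram A φ ψ = gram A ψ φ := by
  rw [gram_apply, gram_apply, Finset.sum_comm]
  refine Finset.sum_congr rfl fun I _ => Finset.sum_congr rfl fun J _ => ?_
  rw [← minor_transpose A J I, hA]; ring

lemma gram_wedge_right {A : Matrix (Fin d) (Fin d) ℝ} (hA : A.transpose = A) (i : Fin d)
    (φ ψ : Fock d) : gram A φ (wedge i ψ) = ∑ j, A i j * gram A (contract j φ) ψ := by
  rw [gram_symm hA, gram_wedge_left]
  exact Finset.sum_congr rfl fun j _ => by rw [gram_symm hA]

lemma gram_transpose_mul_self (A : Matrix (Fin d) (Fin d) ℝ) (ψ : Fock d) :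
    gram (A.transpose * A) ψ ψ = ∑ I, compound A ψ I ^ 2 := by
  rw [gram_eq_sum_compound, compound_mul]
  simp only [LinearMap.comp_apply]
  generalize hχ : compound A ψ = χ
  simp only [compound_apply A.transpose, minor_transpose, Finset.mul_sum]
  rw [Finset.sum_comm]
  refine Finset.sum_congr rfl fun I _ => ?_
  rw [sq]
  nth_rewrite 2 [← hχ]
  rw [compound_apply, Finset.sum_mul]
  exact Finset.sum_congr rfl fun J _ => by ring

open scoped MatrixOrder Matrix.Norms.L2Operator in
-- For g = AᵀA the form is the sum of the squares of the components of `compound A ψ`, and `compound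
-- A` is injective because `compound A⁻¹` inverts it.
lemma gram_pos {g : Matrix (Fin d) (Fin d) ℝ} (hg : g.PosDef) {ψ : Fock d} (hψ : ψ ≠ 0) :
    0 < gram g ψ ψ := by
  obtain ⟨A, hA, rfl⟩ : ∃ A : Matrix (Fin d) (Fin d) ℝ, IsUnit A ∧ g = A.transpose * A := by
    obtain ⟨A, hA, h⟩ := CStarAlgebra.isStrictlyPositive_iff_eq_star_mul_self.1
      hg.isStrictlyPositive
    exact ⟨A, hA, by simpa [Matrix.star_eq_conjTranspose] using h⟩
  rw [gram_transpose_mul_self]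
  have hne : compound A ψ ≠ 0 := by
    intro h
    apply hψ
    have h1 : compound (A⁻¹ * A) ψ = 0 := by
      rw [compound_mul, LinearMap.comp_apply, h, map_zero]
    rwa [Matrix.nonsing_inv_mul _ ((Matrix.isUnit_iff_isUnit_det _).1 hA), compound_one] at h1
  obtain ⟨I, hI⟩ := Function.ne_iff.1 hne
  exact Finset.sum_pos' (fun _ _ => sq_nonneg _) ⟨I, Finset.mem_univ _, by
    have : compound A ψ I ≠ 0 := hI
    positivity⟩

/-- The tensor `1` of degree zero. -/
def vacuum : Fock d := Pi.single ∅ 1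

lemma contract_vacuum (i : Fin d) : contract i (vacuum : Fock d) = 0 := by
  funext I
  simp [contract_apply, vacuum]

lemma wedge_single {i : Fin d} {I : Finset (Fin d)} (hi : i ∉ I) :
    wedge i (Pi.single I 1 : Fock d) = orderSign i I • Pi.single (insert i I) 1 := by
  funext J
  simp only [wedge_apply, Pi.single_apply, Pi.smul_apply, smul_eq_mul, mul_ite, mul_one, mul_zero]
  by_cases hJ : J = insert i I
  · subst hJ; simp [Finset.erase_insert hi]
  · rw [if_neg hJ]
    split_ifs with h1 h2
    · exact absurd (by rw [← h2, Finset.insert_erase h1]) hJ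
    · rfl
    · rfl

lemma wedge_single_mem {i : Fin d} {I : Finset (Fin d)} (hi : i ∈ I) :
    wedge i (Pi.single I 1 : Fock d) = 0 := by
  funext J
  simp only [wedge_apply, Pi.single_apply, Pi.zero_apply]
  split_ifs with h1 h2
  · exact absurd (h2 ▸ hi) (Finset.notMem_erase _ _)
  · simp
  · rfl

lemma contract_single_notMem {i : Fin d} {I : Finset (Fin d)} (hi : i ∉ I) :
    contract i (Pi.single I 1 : Fock d) = 0 := by
  funext J
  simp only [contract_apply, Pi.single_apply, Pi.zero_apply]
  split_ifs with h1 h2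
  · rfl
  · exact absurd (h2 ▸ Finset.mem_insert_self i J) hi
  · simp

/-- Antisymmetric tensors are generated from the vacuum by exterior products. -/
lemma fock_induction {p : Fock d → Prop} (h0 : p vacuum) (hadd : ∀ a b, p a → p b → p (a + b))
    (hsmul : ∀ (c : ℝ) a, p a → p (c • a)) (hw : ∀ i a, p a → p (wedge i a)) (ψ : Fock d) :
    p ψ := by
  have hz : p 0 := by simpa using hsmul 0 _ h0
  have hs : ∀ I : Finset (Fin d), p (Pi.single I 1) := by
    intro I
    induction I using Finset.induction_on with
    | empty => exact h0
    | insert i I hi ih =>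
      have := hsmul (orderSign i I) _ (hw i _ ih)
      rwa [wedge_single hi, smul_smul, orderSign_mul_self, one_smul] at this
  have : ψ = ∑ I, ψ I • (Pi.single I 1 : Fock d) := by
    funext J
    simp [Finset.sum_apply, Pi.single_apply]
  rw [this]
  exact Finset.sum_induction _ p hadd hz fun I _ => hsmul _ _ (hs I)

lemma gram_vacuum_left (A : Matrix (Fin d) (Fin d) ℝ) (ψ : Fock d) :
    gram A vacuum ψ = ψ ∅ := by
  rw [gram_eq_sum_compound, Finset.sum_eq_single ∅]
  · simp [vacuum, compound_apply_empty]
  · intro I _ hI; simp [vacuum, hI]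
  · simp

lemma sum_rotate {α β γ : Type*} [Fintype α] [Fintype β] [Fintype γ] {M : Type*} [AddCommMonoid M]
    (F : α → β → γ → M) : ∑ c, ∑ a, ∑ b, F a b c = ∑ a, ∑ b, ∑ c, F a b c := by
  rw [Finset.sum_comm]
  exact Finset.sum_congr rfl fun _ _ => Finset.sum_comm

/-- The minors have different degrees in A, but by the Leibniz rule one factor A_kl is always
replaced by h_kl, at the cost of one contraction on each side. Building φ from the vacuum reduces
this to `gram_wedge_left`. -/
lemma hasDerivAt_gram (A h : Matrix (Fin d) (Fin d) ℝ) (φ ψ : Fock d) (t : ℝ) :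
    HasDerivAt (fun t : ℝ => gram (A + t • h) φ ψ)
      (∑ k, ∑ l, h k l * gram (A + t • h) (contract k φ) (contract l ψ)) t := by
  induction φ using fock_induction generalizing ψ with
  | h0 =>
    simp only [gram_vacuum_left, contract_vacuum, map_zero, LinearMap.zero_apply, mul_zero,
      Finset.sum_const_zero]
    exact hasDerivAt_const _ _
  | hadd a b ha hb =>
    simp only [map_add, LinearMap.add_apply, mul_add, Finset.sum_add_distrib]
    exact (ha ψ).add (hb ψ)
  | hsmul c a ha =>
    simp only [map_smul, LinearMap.smul_apply, smul_eq_mul]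
    refine ((ha ψ).const_mul c).congr_deriv ?_
    simp only [Finset.mul_sum]
    exact Finset.sum_congr rfl fun _ _ => Finset.sum_congr rfl fun _ _ => by ring
  | hw i a ha =>
    simp only [gram_wedge_left]
    have h1 : ∀ j, HasDerivAt (fun t : ℝ => (A + t • h) i j) (h i j) t := by
      intro j
      simpa using ((hasDerivAt_id t).mul_const (h i j)).const_add (A i j)
    refine (HasDerivAt.fun_sum (u := Finset.univ)
      fun j _ => (h1 j).mul (ha (contract j ψ))).congr_deriv ?_
    -- The anticommutator of ι_k and e_i∧ accounts for the variation of the row A_i; the remainder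
    -- is the inductive derivative, with one sign from exchanging two contractions compensated by
    -- the Clifford sign.
    have h3 : ∀ k l, gram (A + t • h) (contract k (wedge i a)) (contract l ψ) =
        (if k = i then gram (A + t • h) a (contract l ψ) else 0) +
        ∑ j, (A + t • h) i j * gram (A + t • h) (contract k a) (contract l (contract j ψ)) := by
      intro k l
      rw [contract_wedge, map_sub, LinearMap.sub_apply, gram_wedge_left]
      simp only [contract_contract _ l, map_neg, mul_neg, Finset.sum_neg_distrib, sub_neg_eq_add]
      split_ifs <;> simp
    simp only [h3, mul_add, Finset.sum_add_distrib]
    congr 1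
    · simp
    · simp only [Finset.mul_sum]
      rw [sum_rotate]
      refine Finset.sum_congr rfl fun _ _ => Finset.sum_congr rfl fun _ _ =>
        Finset.sum_congr rfl fun _ _ => by ring

/-- As the square of the top degree tensor, the determinant is differentiated by `hasDerivAt_gram`.
-/
lemma det_eq_gram (A : Matrix (Fin d) (Fin d) ℝ) :
    A.det = gram A (Pi.single Finset.univ 1) (Pi.single Finset.univ 1) := by
  have h : minor A Finset.univ Finset.univ = A.det := by
    have hc : (Finset.univ : Finset (Fin d)).card = d := by simp
    have hid : (id : Fin d → Fin d) = Finset.univ.orderEmbOfFin hc :=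
      Finset.orderEmbOfFin_unique hc (by simp) strictMono_id
    rw [minor_eq hc hc, ← hid, Matrix.submatrix_id_id]
  rw [gram_apply, Finset.sum_eq_single Finset.univ, Finset.sum_eq_single Finset.univ]
  · simp [h]
  · intro I _ hI; simp [hI]
  · simp
  · intro I _ hI; simp [hI]
  · simp

lemma gram_contract_left {g : Matrix (Fin d) (Fin d) ℝ} (hs : g.transpose = g)
    (hd : IsUnit g.det) (i : Fin d) (φ ψ : Fock d) :
    gram g (contract i φ) ψ = ∑ j, g⁻¹ i j * gram g φ (wedge j ψ) := by
  simp only [gram_wedge_right hs, Finset.mul_sum]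
  rw [Finset.sum_comm]
  have h1 : ∀ k, ∑ j, g⁻¹ i j * (g j k * gram g (contract k φ) ψ) =
      (if i = k then 1 else 0) * gram g (contract k φ) ψ := by
    intro k
    rw [← Matrix.one_apply, ← Matrix.nonsing_inv_mul g hd, Matrix.mul_apply, Finset.sum_mul]
    exact Finset.sum_congr rfl fun _ _ => by ring
  simp [h1]

/-- Jacobi's formula. -/
lemma hasDerivAt_det {g : Matrix (Fin d) (Fin d) ℝ} (hs : g.transpose = g) (hd : IsUnit g.det)
    (h : Matrix (Fin d) (Fin d) ℝ) :
    HasDerivAt (fun t : ℝ => (g + t • h).det) ((∑ k, ∑ l, h k l * g⁻¹ k l) * g.det) 0 := by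
  have h1 := hasDerivAt_gram g h (Pi.single Finset.univ 1) (Pi.single Finset.univ 1) 0
  simp only [← det_eq_gram, zero_smul, add_zero] at h1
  convert h1 using 1
  rw [Finset.sum_mul]
  refine Finset.sum_congr rfl fun k _ => ?_
  rw [Finset.sum_mul]
  refine Finset.sum_congr rfl fun l _ => ?_
  rw [gram_contract_left hs hd]
  -- Since e_j∧ annihilates the top degree tensor, only the anticommutator δ_lj survives.
  have h2 : ∀ j, wedge j (contract l (Pi.single Finset.univ 1 : Fock d)) =
      if l = j then Pi.single Finset.univ 1 else 0 := by
    intro j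
    have := contract_wedge l j (Pi.single Finset.univ 1 : Fock d)
    rw [wedge_single_mem (Finset.mem_univ j), map_zero] at this
    exact (sub_eq_zero.1 this.symm).symm
  simp only [h2]
  simp only [apply_ite, map_zero, ← det_eq_gram]
  simp
  ring

end TDuality

end

open scoped TensorProduct BigOperators
noncomputable section
namespace TDuality
variable {d : ℕ}

/-! ## Directions in the moduli space -/

/-- The direction in which `∂/∂g_{ij}` differentiates. -/
abbrev dirG (i j : Fin d) : Background d := unitDir i j + unitDir j i

/-- The direction in which `∂/∂B_{ij}` differentiates. -/
abbrev dirB (i j : Fin d) : Background d := unitDir i j - unitDir j i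

lemma unitDir_apply (i j k l : Fin d) :
    unitDir i j k l = (if k = i then 1 else 0) * (if l = j then 1 else 0) := by
  unfold unitDir
  by_cases h : k = i
  · subst h; simp [Pi.single_apply]
  · simp [h]

/-- The variation of the metric under `∂/∂g_{ij}`. -/
def symUnit (i j : Fin d) : Matrix (Fin d) (Fin d) ℝ :=
  Matrix.of fun k l => unitDir i j k l + unitDir j i k l

lemma metric_add_dirG (x : Background d) (i j : Fin d) (t : ℝ) :
    metric (x + t • dirG i j) = metric x + t • symUnit i j := by
  ext k l
  simp only [metric, symUnit, Matrix.of_apply, Pi.add_apply, Pi.smul_apply, smul_eq_mul,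
    Matrix.add_apply, Matrix.smul_apply, unitDir_apply]
  ring

lemma bField_add_dirG (x : Background d) (i j : Fin d) (t : ℝ) :
    bField (x + t • dirG i j) = bField x := by
  ext k l
  simp only [bField, Matrix.of_apply, Pi.add_apply, Pi.smul_apply, smul_eq_mul, unitDir_apply]
  ring

lemma metric_add_dirB (x : Background d) (i j : Fin d) (t : ℝ) :
    metric (x + t • dirB i j) = metric x := by
  ext k l
  simp only [metric, Matrix.of_apply, Pi.add_apply, Pi.sub_apply, Pi.smul_apply, smul_eq_mul,
    unitDir_apply]
  ring

lemma bField_add_dirB (x : Background d) (i j k l : Fin d) (t : ℝ) :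
    bField (x + t • dirB i j) k l = bField x k l + t * (unitDir i j k l - unitDir j i k l) := by
  simp only [bField, Matrix.of_apply, Pi.add_apply, Pi.sub_apply, Pi.smul_apply, smul_eq_mul,
    unitDir_apply]
  ring

lemma sum_symUnit_mul (i j : Fin d) (F : Fin d → Fin d → ℝ) :
    ∑ k, ∑ l, symUnit i j k l * F k l = F i j + F j i := by
  simp only [symUnit, Matrix.of_apply, unitDir_apply, add_mul, Finset.sum_add_distrib,
    ite_mul, one_mul, zero_mul, Finset.sum_ite_irrel, Finset.sum_const_zero, Finset.sum_ite_eq',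
    Finset.mem_univ, if_true]

lemma metric_transpose (x : Background d) : (metric x).transpose = metric x := by
  ext k l
  simp only [metric, Matrix.transpose_apply, Matrix.of_apply]; ring

lemma metric_symm (x : Background d) (i j : Fin d) : metric x i j = metric x j i := by
  simp only [metric, Matrix.of_apply]; ring

lemma bField_antisymm (x : Background d) (i j : Fin d) : bField x i j = -bField x j i := by
  simp only [bField, Matrix.of_apply]; ring

lemma isUnit_det_metric {x : Background d} (hx : x ∈ moduli d) : IsUnit (metric x).det :=
  isUnit_iff_ne_zero.2 (Matrix.PosDef.det_pos hx).ne'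

lemma inv_metric_symm (x : Background d) (i j : Fin d) : (metric x)⁻¹ i j = (metric x)⁻¹ j i := by
  conv_lhs => rw [← metric_transpose x, ← Matrix.transpose_nonsing_inv]
  rfl

open scoped Matrix.Norms.Operator in
lemma hasDerivAt_inv_entry {g : Matrix (Fin d) (Fin d) ℝ} (hd : IsUnit g.det)
    (h : Matrix (Fin d) (Fin d) ℝ) (k l : Fin d) :
    HasDerivAt (fun t : ℝ => (g + t • h)⁻¹ k l) (-(g⁻¹ * h * g⁻¹) k l) 0 := by
  have hu := (Matrix.isUnit_iff_isUnit_det g).2 hd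
  obtain ⟨u, rfl⟩ := hu
  have h1 : HasDerivAt (fun t : ℝ => (u : Matrix (Fin d) (Fin d) ℝ) + t • h) h 0 :=
    (((hasDerivAt_id (0 : ℝ)).smul_const h).const_add
      (u : Matrix (Fin d) (Fin d) ℝ)).congr_deriv (one_smul _ _)
  have h2 := hasFDerivAt_ringInverse (𝕜 := ℝ) u
  have h0 : (u : Matrix (Fin d) (Fin d) ℝ) = u + (0 : ℝ) • h := by rw [zero_smul, add_zero]
  have h3 : HasDerivAt (fun t : ℝ => Ring.inverse ((u : Matrix (Fin d) (Fin d) ℝ) + t • h))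
      (-(((u⁻¹ : (Matrix (Fin d) (Fin d) ℝ)ˣ) : Matrix (Fin d) (Fin d) ℝ) * h *
        ((u⁻¹ : (Matrix (Fin d) (Fin d) ℝ)ˣ) : Matrix (Fin d) (Fin d) ℝ))) 0 := by
    have h2' : HasFDerivAt (Ring.inverse : Matrix (Fin d) (Fin d) ℝ → Matrix (Fin d) (Fin d) ℝ)
        (-ContinuousLinearMap.mulLeftRight ℝ (Matrix (Fin d) (Fin d) ℝ) ↑u⁻¹ ↑u⁻¹)
        ((u : Matrix (Fin d) (Fin d) ℝ) + (0 : ℝ) • h) := by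
      rw [← h0]; exact h2
    exact h2'.comp_hasDerivAt (0 : ℝ) h1
  have h4 : HasDerivAt (fun t : ℝ => ((u : Matrix (Fin d) (Fin d) ℝ) + t • h)⁻¹)
      (-((u : Matrix (Fin d) (Fin d) ℝ)⁻¹ * h * (u : Matrix (Fin d) (Fin d) ℝ)⁻¹)) 0 := by
    simpa only [Matrix.nonsing_inv_eq_ringInverse, Ring.inverse_unit] using h3
  let L : Matrix (Fin d) (Fin d) ℝ →L[ℝ] ℝ := LinearMap.toContinuousLinearMap
    { toFun := fun M => M k l, map_add' := fun _ _ => rfl, map_smul' := fun _ _ => rfl }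
  exact L.hasFDerivAt.comp_hasDerivAt (0 : ℝ) h4

lemma mul_symUnit_mul (A : Matrix (Fin d) (Fin d) ℝ) (i j k l : Fin d) :
    (A * symUnit i j * A) k l = A k i * A j l + A k j * A i l := by
  have : (A * symUnit i j * A) k l = ∑ a, ∑ b, symUnit i j a b * (A k a * A b l) := by
    simp only [Matrix.mul_apply, Finset.sum_mul]
    rw [Finset.sum_comm]
    exact Finset.sum_congr rfl fun _ _ => Finset.sum_congr rfl fun _ _ => by ring
  rw [this, sum_symUnit_mul]

lemma hasLineDerivAt_inv_metric {x : Background d} (hx : x ∈ moduli d) (i j k l : Fin d) :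
    HasLineDerivAt ℝ (fun y => (metric y)⁻¹ k l)
      (-((metric x)⁻¹ k i * (metric x)⁻¹ j l + (metric x)⁻¹ k j * (metric x)⁻¹ i l)) x
      (dirG i j) := by
  rw [HasLineDerivAt, ← mul_symUnit_mul]
  simp only [metric_add_dirG]
  exact hasDerivAt_inv_entry (isUnit_det_metric hx) _ _ _

/-! ## The dressed spinor -/

/-- A tensor without components of degree at least `k`. -/
def VanishFrom (k : ℕ) (m : Fock d) : Prop := ∀ I : Finset (Fin d), k ≤ I.card → m I = 0

lemma VanishFrom.contract {k : ℕ} {m : Fock d} (h : VanishFrom (k + 1) m) (i : Fin d) :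
    VanishFrom k (contract i m) := by
  intro I hI
  rw [contract_apply]
  split_ifs with hi
  · rfl
  · rw [h _ (by rw [Finset.card_insert_of_notMem hi]; omega), mul_zero]

lemma VanishFrom.mono {k l : ℕ} {m : Fock d} (h : VanishFrom k m) (hkl : k ≤ l) :
    VanishFrom l m := fun I hI => h I (hkl.trans hI)

lemma vanishFrom_succ (m : Fock d) : VanishFrom (d + 1) m := fun I hI => by
  have := Finset.card_le_univ I
  simp at this
  omega

lemma VanishFrom.zero {m : Fock d} (h : VanishFrom 0 m) : m = 0 := funext fun I => h I (Nat.zero_le _)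

lemma VanishFrom.add {k : ℕ} {m n : Fock d} (hm : VanishFrom k m) (hn : VanishFrom k n) :
    VanishFrom k (m + n) := fun I hI => by rw [Pi.add_apply, hm I hI, hn I hI, add_zero]

lemma VanishFrom.smul {k : ℕ} {m : Fock d} (hm : VanishFrom k m) (c : ℝ) :
    VanishFrom k (c • m) := fun I hI => by rw [Pi.smul_apply, hm I hI, smul_zero]

lemma VanishFrom.sum {k : ℕ} {ι : Type*} {s : Finset ι} {m : ι → Fock d}
    (hm : ∀ a, VanishFrom k (m a)) : VanishFrom k (∑ a ∈ s, m a) :=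
  Finset.sum_induction _ (VanishFrom k) (fun _ _ => VanishFrom.add) (fun _ _ => rfl)
    fun a _ => hm a

lemma bContract_apply (x : Background d) (m : Fock d) :
    bContract x m = ∑ j, ∑ k, (bField x j k / 2) • contract k (contract j m) := by
  simp [bContract]

lemma VanishFrom.bContract {k : ℕ} {m : Fock d} (h : VanishFrom (k + 1) m) (x : Background d) :
    VanishFrom k (bContract x m) := by
  rw [bContract_apply]
  exact VanishFrom.sum fun j => VanishFrom.sum fun k =>
    (VanishFrom.contract ((h.contract j).mono (Nat.le_succ _)) k).smul _

lemma VanishFrom.bContract_pow {k n : ℕ} {m : Fock d} (h : VanishFrom (k + n) m)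
    (x : Background d) : VanishFrom k ((TDuality.bContract x ^ n) m) := by
  induction n generalizing m with
  | zero => exact h
  | succ n ih =>
    rw [pow_succ, Module.End.mul_apply]
    exact ih (VanishFrom.bContract (by rwa [add_assoc]) x)

/-- Counting one lost degree per factor of β is enough, and matches the range `d + 1` in
`dressedSpinor`. Dressing thus becomes a true exponential of a nilpotent operator, to which the
addition law for commuting exponents applies. -/
lemma bContract_pow_eq_zero (x : Background d) : bContract x ^ (d + 1) = 0 :=
  LinearMap.ext fun m => (VanishFrom.bContract_pow (by simpa using vanishFrom_succ m) x).zero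

lemma dressedSpinor_eq_exp (x : Background d) (m : Fock d) :
    dressedSpinor x m = IsNilpotent.exp (bContract x : Module.End ℝ (Fock d)) m := by
  rw [IsNilpotent.exp_eq_sum (bContract_pow_eq_zero x), dressedSpinor, LinearMap.sum_apply]
  refine Finset.sum_congr rfl fun n _ => ?_
  rw [← Rat.cast_smul_eq_qsmul ℝ, LinearMap.smul_apply]
  norm_num

lemma dressedSpinor_add_dirG (x : Background d) (i j : Fin d) (t : ℝ) (m : Fock d) :
    dressedSpinor (x + t • dirG i j) m = dressedSpinor x m := by
  unfold dressedSpinor bContract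
  rw [bField_add_dirG]

lemma bContract_add_dirB (x : Background d) (i j : Fin d) (t : ℝ) :
    bContract (x + t • dirB i j) = bContract x + t • (contract j ∘ₗ contract i) := by
  refine LinearMap.ext fun m => ?_
  simp only [bContract_apply, bField_add_dirB, add_div, add_smul, Finset.sum_add_distrib,
    LinearMap.add_apply, LinearMap.smul_apply, LinearMap.comp_apply]
  congr 1
  simp only [unitDir_apply, mul_sub, sub_div, sub_smul, Finset.sum_sub_distrib, mul_ite, mul_one,
    mul_zero, ite_div, zero_div, ite_smul, zero_smul, Finset.sum_ite_eq', Finset.mem_univ, if_true]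
  rw [contract_contract i j, smul_neg, sub_neg_eq_add, ← add_smul, add_halves]

lemma contract_comm_contract_contract (i j k : Fin d) (m : Fock d) :
    contract i (contract j (contract k m)) = contract j (contract k (contract i m)) := by
  rw [contract_contract i j, contract_contract i k, map_neg, neg_neg]

lemma commute_bContract (x : Background d) (i j : Fin d) :
    Commute (bContract x : Module.End ℝ (Fock d)) (contract j ∘ₗ contract i) := by
  refine LinearMap.ext fun m => ?_
  rw [Module.End.mul_apply, Module.End.mul_apply]
  simp only [bContract_apply, LinearMap.comp_apply, map_sum, map_smul]
  refine Finset.sum_congr rfl fun a _ => Finset.sum_congr rfl fun b _ => ?_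
  rw [contract_comm_contract_contract i b a, contract_comm_contract_contract j b a]

/-- The variation t ι_j ι_i of β commutes with β and squares to zero, so its exponential is exactly
1 + t ι_j ι_i. -/
lemma dressedSpinor_add_dirB (x : Background d) (i j : Fin d) (t : ℝ) (m : Fock d) :
    dressedSpinor (x + t • dirB i j) m =
      dressedSpinor x m + t • contract j (contract i (dressedSpinor x m)) := by
  have hC2 : (t • (contract j ∘ₗ contract i) : Module.End ℝ (Fock d)) ^ 2 = 0 := by
    refine LinearMap.ext fun n => ?_
    rw [sq, Module.End.mul_apply]
    simp only [LinearMap.smul_apply, LinearMap.comp_apply, map_smul, LinearMap.zero_apply]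
    rw [contract_comm_contract_contract i j i]
    have : contract i (contract i n) = 0 := by
      have := contract_contract i i n
      exact self_eq_neg.1 this
    simp [this]
  have hcomm : Commute (t • (contract j ∘ₗ contract i) : Module.End ℝ (Fock d))
      (bContract x : Module.End ℝ (Fock d)) := ((commute_bContract x i j).smul_right t).symm
  rw [dressedSpinor_eq_exp, dressedSpinor_eq_exp, bContract_add_dirB, add_comm,
    IsNilpotent.exp_add_of_commute hcomm ⟨2, hC2⟩ ⟨_, bContract_pow_eq_zero x⟩,
    Module.End.mul_apply, IsNilpotent.exp_eq_sum hC2, Finset.sum_range_succ, Finset.sum_range_one]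
  simp

lemma dressedSpinor_injective (x : Background d) {m : Fock d} (hm : m ≠ 0) :
    dressedSpinor x m ≠ 0 := by
  rw [dressedSpinor_eq_exp]
  intro h
  have hn : IsNilpotent (bContract x : Module.End ℝ (Fock d)) := ⟨_, bContract_pow_eq_zero x⟩
  have h1 := IsNilpotent.exp_add_of_commute (Commute.neg_left (Commute.refl _)) hn.neg hn
  rw [neg_add_cancel, IsNilpotent.exp_zero] at h1
  apply hm
  have h2 := LinearMap.congr_fun h1 m
  rw [Module.End.mul_apply, h, map_zero] at h2
  exact h2

end TDuality

end

open scoped TensorProduct BigOperators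
noncomputable section
namespace TDuality
variable {d : ℕ}

/-! ## Pure spinors -/

/-- The invariant pairing of the two spinor factors with the vector representation. -/
def vectorPairing : Fock d ⊗[ℝ] Fock d →ₗ[ℝ] Fock d ⊗[ℝ] Fock d :=
  ∑ i, (TensorProduct.map (wedge i) (contract i) + TensorProduct.map (contract i) (wedge i))

lemma vectorPairing_tmul (φ χ : Fock d) : vectorPairing (φ ⊗ₜ[ℝ] χ) =
    ∑ i, (wedge i φ ⊗ₜ[ℝ] contract i χ + contract i φ ⊗ₜ[ℝ] wedge i χ) := by
  simp [vectorPairing]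

/-- The quadratic equations of a pure spinor. -/
def IsPure (φ : Fock d) : Prop := vectorPairing (φ ⊗ₜ[ℝ] φ) = 0

lemma sum_antisymm_smul {M : Type*} [AddCommGroup M] [Module ℝ M] (c e : Fin d → Fin d → ℝ)
    (h : ∀ i k, c i k = -e k i) (F : Fin d → Fin d → M) :
    ∑ i, ∑ k, c i k • F k i = -∑ i, ∑ k, e i k • F i k := by
  rw [Finset.sum_comm, ← Finset.sum_neg_distrib]
  refine Finset.sum_congr rfl fun i _ => ?_
  rw [← Finset.sum_neg_distrib]
  exact Finset.sum_congr rfl fun k _ => by rw [h k i, neg_smul]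

/-- Commutation with X acts on the 2d operators e_i∧ and ι_i by the block matrix (a, b; p, q). The
last three hypotheses say that this matrix belongs to so(d,d), so it annihilates the invariant
tensor that defines `vectorPairing`. -/
lemma vectorPairing_comm_of_apply {X : Fock d →ₗ[ℝ] Fock d}
    (a b : Fin d → Fin d → ℝ) (p q : Fin d → Fin d → ℝ)
    (hw : ∀ i φ, wedge i (X φ) = X (wedge i φ) - ∑ k, (a i k • wedge k φ + b i k • contract k φ))
    (hc : ∀ i φ, contract i (X φ) = X (contract i φ) -
      ∑ k, (p i k • wedge k φ + q i k • contract k φ))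
    (hb : ∀ i k, b i k = -b k i) (hp : ∀ i k, p i k = -p k i) (haq : ∀ i k, a i k = -q k i)
    (T : Fock d ⊗[ℝ] Fock d) :
    vectorPairing (TensorProduct.map X LinearMap.id T + TensorProduct.map LinearMap.id X T) =
      TensorProduct.map X LinearMap.id (vectorPairing T) +
        TensorProduct.map LinearMap.id X (vectorPairing T) := by
  induction T using TensorProduct.induction_on with
  | zero => simp
  | add S T hS hT =>
    simp only [map_add] at hS hT ⊢
    linear_combination (exp := 1) hS + hT
  | tmul φ χ =>
    simp only [TensorProduct.map_tmul, LinearMap.id_apply, map_add, vectorPairing_tmul, map_sum,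
      hw, hc, TensorProduct.sub_tmul, TensorProduct.tmul_sub, TensorProduct.sum_tmul,
      TensorProduct.tmul_sum, TensorProduct.add_tmul, TensorProduct.tmul_add,
      ← TensorProduct.smul_tmul', TensorProduct.tmul_smul, Finset.sum_add_distrib,
      Finset.sum_sub_distrib]
    rw [← sub_eq_zero]
    have e1 := sum_antisymm_smul b b hb fun k i => contract k φ ⊗ₜ[ℝ] contract i χ
    have e2 := sum_antisymm_smul p p hp fun k i => wedge k φ ⊗ₜ[ℝ] wedge i χ
    have e3 := sum_antisymm_smul a q haq fun k i => wedge k φ ⊗ₜ[ℝ] contract i χ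
    have e4 := sum_antisymm_smul a q haq fun k i => contract i φ ⊗ₜ[ℝ] wedge k χ
    simp only [e1, e2, e3, e4]
    abel

/-- Only the commutators of a generator with e_i∧ and ι_i matter, so the scalar shift in the third
family does not affect the coefficients. -/
lemma soGenerators_comm {X : Fock d →ₗ[ℝ] Fock d} (hX : X ∈ soGenerators d)
    (T : Fock d ⊗[ℝ] Fock d) :
    vectorPairing (TensorProduct.map X LinearMap.id T + TensorProduct.map LinearMap.id X T) =
      TensorProduct.map X LinearMap.id (vectorPairing T) +
        TensorProduct.map LinearMap.id X (vectorPairing T) := by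
  obtain ⟨m, n, rfl | rfl | rfl⟩ := hX
  · refine vectorPairing_comm_of_apply 0
      (fun i k => (if n = i then (if k = m then 1 else 0) else 0) -
        (if m = i then (if k = n then 1 else 0) else 0)) 0 0 ?_ ?_ ?_ ?_ ?_ T
    · intro i φ
      simp only [LinearMap.comp_apply, contract_wedge, map_sub, Pi.zero_apply, zero_smul, zero_add,
        sub_smul, ite_smul, one_smul, Finset.sum_sub_distrib, Finset.sum_ite_irrel,
        Finset.sum_ite_eq', Finset.mem_univ, if_true, Finset.sum_const_zero]
      split_ifs <;> simp
    · intro i φ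
      simp only [LinearMap.comp_apply, Pi.zero_apply, zero_smul, add_zero, Finset.sum_const_zero,
        sub_zero]
      rw [contract_comm_contract_contract]
    · intro i k; grind
    · simp
    · simp
  · refine vectorPairing_comm_of_apply 0 0
      (fun i k => -(if m = i then (if k = n then 1 else 0) else 0) +
        (if n = i then (if k = m then 1 else 0) else 0)) 0 ?_ ?_ ?_ ?_ ?_ T
    · intro i φ
      simp only [LinearMap.comp_apply, Pi.zero_apply, zero_smul, add_zero, Finset.sum_const_zero,
        sub_zero]
      rw [wedge_wedge i m, wedge_wedge i n, map_neg, neg_neg]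
    · intro i φ
      simp only [LinearMap.comp_apply, contract_wedge, map_sub, Pi.zero_apply, zero_smul, add_zero,
        add_smul, neg_smul, ite_smul, one_smul, Finset.sum_add_distrib, Finset.sum_neg_distrib,
        Finset.sum_ite_irrel, Finset.sum_ite_eq', Finset.mem_univ, if_true, Finset.sum_const_zero,
        @eq_comm _ i]
      split_ifs <;> (try rw [map_zero]) <;> abel
    · simp
    · intro i k; grind
    · simp
  · refine vectorPairing_comm_of_apply
      (fun i k => if n = i then (if k = m then 1 else 0) else 0) 0 0
      (fun i k => -(if m = i then (if k = n then 1 else 0) else 0)) ?_ ?_ ?_ ?_ ?_ T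
    · intro i φ
      simp only [LinearMap.sub_apply, LinearMap.comp_apply, contract_wedge, map_sub, Pi.zero_apply, zero_smul, add_zero,
        ite_smul, one_smul, 
        Finset.sum_ite_irrel, Finset.sum_ite_eq', Finset.mem_univ, if_true, Finset.sum_const_zero]
      rw [wedge_wedge i m]
      split_ifs <;> simp <;> abel
    · intro i φ
      simp only [LinearMap.sub_apply, LinearMap.comp_apply, contract_wedge, map_sub, Pi.zero_apply, zero_smul, zero_add,
        neg_smul, ite_smul, one_smul, Finset.sum_neg_distrib,
        Finset.sum_ite_irrel, Finset.sum_ite_eq', Finset.mem_univ, if_true, Finset.sum_const_zero,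
        @eq_comm _ i]
      rw [contract_contract i n]
      split_ifs <;> simp <;> abel
    · simp
    · simp
    · intro i k; grind

lemma vectorPairing_single (I : Finset (Fin d)) :
    vectorPairing ((Pi.single I 1 : Fock d) ⊗ₜ[ℝ] (Pi.single I 1 : Fock d)) = 0 := by
  rw [vectorPairing_tmul]
  refine Finset.sum_eq_zero fun i _ => ?_
  by_cases hi : i ∈ I
  · simp [wedge_single_mem hi]
  · simp [contract_single_notMem hi]

/-- The kernel of the equivariant map `vectorPairing` is an invariant subspace containing the
squares of the e_I, hence it contains the smallest one. All consequences of the half-BPS constraint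
are drawn from these quadratic equations. -/
lemma isPure_of_mem {parity : ℕ} {φ : Fock d} (h : φ ⊗ₜ[ℝ] φ ∈ highestComponent d parity) :
    IsPure φ := by
  have hle : highestComponent d parity ≤ LinearMap.ker (vectorPairing (d := d)) := by
    refine sInf_le ⟨fun I _ => vectorPairing_single I, fun X hX T hT => ?_⟩
    rw [LinearMap.mem_ker] at hT ⊢
    rw [soGenerators_comm hX, hT, map_zero, map_zero, add_zero]
  exact hle h

lemma single_mem_highestComponent {parity : ℕ} {I : Finset (Fin d)} (hI : I.card % 2 = parity)
    (c : ℝ) : (Pi.single I c : Fock d) ⊗ₜ[ℝ] (Pi.single I c : Fock d) ∈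
      highestComponent d parity := by
  have h : (Pi.single I c : Fock d) = c • Pi.single I 1 := by
    rw [← Pi.single_smul, smul_eq_mul, mul_one]
  rw [h, TensorProduct.tmul_smul, ← TensorProduct.smul_tmul']
  refine Submodule.smul_mem _ _ (Submodule.smul_mem _ _ ?_)
  exact (Submodule.mem_sInf).2 fun W hW => hW.1 I hI

/-! ### Invariance under shifts of `B` -/

lemma wedge_bContract (x : Background d) (i : Fin d) (m : Fock d) :
    wedge i (bContract x m) = bContract x (wedge i m) - ∑ k, bField x i k • contract k m := by
  simp only [bContract_apply, map_sum, map_smul, contract_wedge, map_sub, smul_sub,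
    Finset.sum_sub_distrib]
  have h1 : ∑ j, ∑ k, (bField x j k / 2) • contract k (if j = i then m else 0) =
      ∑ k, (bField x i k / 2) • contract k m := by
    rw [Finset.sum_eq_single i]
    · simp
    · intro j _ hj; simp [hj]
    · simp
  have h2 : ∑ j, ∑ k, (bField x j k / 2) • (if k = i then contract j m else 0) =
      -∑ k, (bField x i k / 2) • contract k m := by
    rw [← Finset.sum_neg_distrib]
    refine Finset.sum_congr rfl fun j _ => ?_
    rw [Finset.sum_eq_single i]
    · simp only [if_true]
      rw [bField_antisymm x j i, neg_div, neg_smul]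
    · intro j _ hj; simp [hj]
    · simp
  have h3 : ∑ k, bField x i k • contract k m = ∑ k, (bField x i k / 2) • contract k m +
      ∑ k, (bField x i k / 2) • contract k m := by
    rw [← Finset.sum_add_distrib]
    exact Finset.sum_congr rfl fun k _ => by rw [← add_smul, add_halves]
  rw [h1, h2, h3]
  abel

lemma contract_bContract (x : Background d) (i : Fin d) (m : Fock d) :
    contract i (bContract x m) = bContract x (contract i m) := by
  simp only [bContract_apply, map_sum, map_smul]
  exact Finset.sum_congr rfl fun j _ => Finset.sum_congr rfl fun k _ => by
    rw [contract_comm_contract_contract]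

lemma contract_bContract_pow (x : Background d) (i : Fin d) (n : ℕ) (m : Fock d) :
    contract i ((bContract x ^ n) m) = (bContract x ^ n) (contract i m) := by
  induction n generalizing m with
  | zero => rfl
  | succ n ih => rw [pow_succ, Module.End.mul_apply, ih, contract_bContract, Module.End.mul_apply]

lemma wedge_bContract_pow (x : Background d) (i : Fin d) (n : ℕ) (m : Fock d) :
    wedge i ((bContract x ^ (n + 1)) m) = (bContract x ^ (n + 1)) (wedge i m) -
      ((n : ℝ) + 1) • (bContract x ^ n) (∑ k, bField x i k • contract k m) := by
  induction n generalizing m with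
  | zero => simp [wedge_bContract]
  | succ n ih =>
    have hpow : ∀ n v, (bContract x ^ n) (bContract x v) = (bContract x ^ (n + 1)) v :=
      fun n v => by rw [pow_succ, Module.End.mul_apply]
    rw [← hpow, ih, wedge_bContract, map_sub, hpow]
    have h1 : ∑ k, bField x i k • contract k (bContract x m) =
        bContract x (∑ k, bField x i k • contract k m) := by
      simp only [contract_bContract, map_sum, map_smul]
    rw [h1, hpow]
    push_cast
    module

lemma contract_dressedSpinor (x : Background d) (i : Fin d) (m : Fock d) :
    contract i (dressedSpinor x m) = dressedSpinor x (contract i m) := by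
  simp only [dressedSpinor, map_sum, map_smul, contract_bContract_pow]

/-- The commutator of e_i∧ with β is -B_ik ι_k, which commutes with β; conjugation by e^β therefore
shifts e_i∧ by a first order term only. -/
lemma wedge_dressedSpinor (x : Background d) (i : Fin d) (m : Fock d) :
    wedge i (dressedSpinor x m) =
      dressedSpinor x (wedge i m - ∑ k, bField x i k • contract k m) := by
  set v := ∑ k, bField x i k • contract k m with hv
  -- Being a contraction, v has no component of degree d. The last term of its exponential vanishes,
  -- which aligns the sum with that of the powers β^{n+1}.
  have hvan : (bContract x ^ d) v = 0 := by
    refine (VanishFrom.bContract_pow (k := 0) ?_ x).zero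
    rw [zero_add]
    exact VanishFrom.sum fun k => ((vanishFrom_succ m).contract k).smul _
  have h2 : dressedSpinor x v = ∑ n ∈ Finset.range d, ((n.factorial : ℝ)⁻¹) •
      ((bContract x) ^ n) v := by
    rw [dressedSpinor, Finset.sum_range_succ, hvan, smul_zero, add_zero]
  have h3 : dressedSpinor x (wedge i m - v) = dressedSpinor x (wedge i m) - dressedSpinor x v := by
    rw [dressedSpinor_eq_exp, map_sub, ← dressedSpinor_eq_exp, ← dressedSpinor_eq_exp]
  rw [h3, h2, dressedSpinor, dressedSpinor, Finset.sum_range_succ', Finset.sum_range_succ',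
    map_add, map_sum, add_sub_right_comm, ← Finset.sum_sub_distrib]
  congr 1
  · refine Finset.sum_congr rfl fun n _ => ?_
    rw [map_smul, wedge_bContract_pow, smul_sub, smul_smul]
    congr 2
    rw [Nat.factorial_succ]
    push_cast
    have : (n.factorial : ℝ) ≠ 0 := by positivity
    field_simp
  · simp

/-- The shifts of e_i∧ contribute B_ik ι_k m ⊗ ι_i m and its mirror image; these cancel by
antisymmetry of B. Purity is thus available for ψ = e^β m at every point of the moduli space. -/
lemma IsPure.dressed {m : Fock d} (h : IsPure m) (x : Background d) :
    IsPure (dressedSpinor x m) := by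
  have hlin : ∀ a b : Fock d, dressedSpinor x a ⊗ₜ[ℝ] dressedSpinor x b =
      TensorProduct.map (IsNilpotent.exp (bContract x : Module.End ℝ (Fock d)))
        (IsNilpotent.exp (bContract x : Module.End ℝ (Fock d))) (a ⊗ₜ[ℝ] b) := by
    intro a b
    rw [TensorProduct.map_tmul, dressedSpinor_eq_exp, dressedSpinor_eq_exp]
  unfold IsPure at h ⊢
  rw [vectorPairing_tmul] at h ⊢
  simp only [wedge_dressedSpinor, contract_dressedSpinor, hlin, ← map_add, ← map_sum]
  have key : ∑ i, ((wedge i m - ∑ k, bField x i k • contract k m) ⊗ₜ[ℝ] contract i m +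
      contract i m ⊗ₜ[ℝ] (wedge i m - ∑ k, bField x i k • contract k m)) = 0 := by
    have e := sum_antisymm_smul (bField x) (bField x) (bField_antisymm x)
      fun k i => contract k m ⊗ₜ[ℝ] contract i m
    simp only [TensorProduct.sub_tmul, TensorProduct.tmul_sub, TensorProduct.sum_tmul,
      TensorProduct.tmul_sum, ← TensorProduct.smul_tmul', TensorProduct.tmul_smul,
      Finset.sum_add_distrib, Finset.sum_sub_distrib] at h ⊢
    rw [e]
    rw [← h]; abel
  rw [key, map_zero]

lemma IsPure.sum_eq_zero {φ : Fock d} (h : IsPure φ) (B : Fock d →ₗ[ℝ] Fock d →ₗ[ℝ] ℝ) :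
    ∑ i, (B (wedge i φ) (contract i φ) + B (contract i φ) (wedge i φ)) = 0 := by
  have := congrArg (TensorProduct.lift B) h
  rw [vectorPairing_tmul] at this
  simpa using this

end TDuality

end

open scoped TensorProduct BigOperators
noncomputable section
namespace TDuality
variable {d : ℕ}

/-! ## The spinor mass as a function of the moduli -/

/-- The metric on antisymmetric tensors, normalised by the volume. -/
def normForm (x : Background d) : LinearMap.BilinForm ℝ (Fock d) :=
  (√((metric x).det))⁻¹ • gram (metric x)

lemma normForm_apply (x : Background d) (φ χ : Fock d) :
    normForm x φ χ = (√((metric x).det))⁻¹ * gram (metric x) φ χ := rfl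

lemma normForm_symm (x : Background d) (φ χ : Fock d) : normForm x φ χ = normForm x χ φ := by
  rw [normForm_apply, normForm_apply, gram_symm (metric_transpose x)]

lemma normForm_pos {x : Background d} (hx : x ∈ moduli d) {φ : Fock d} (hφ : φ ≠ 0) :
    0 < normForm x φ φ :=
  mul_pos (inv_pos.2 (Real.sqrt_pos.2 (Matrix.PosDef.det_pos hx))) (gram_pos hx hφ)

/-- Contraction and exterior product are adjoint up to raising an index. The index sums with g below
are performed with this and `sum_mul_normForm_right`. -/
lemma sum_mul_normForm_left (x : Background d) (i : Fin d) (φ χ : Fock d) :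
    ∑ j, metric x i j * normForm x (contract j φ) χ = normForm x φ (wedge i χ) := by
  simp only [normForm_apply, gram_wedge_right (metric_transpose x), Finset.mul_sum]
  exact Finset.sum_congr rfl fun _ _ => by ring

lemma sum_mul_normForm_right (x : Background d) (i : Fin d) (φ χ : Fock d) :
    ∑ j, metric x i j * normForm x φ (contract j χ) = normForm x (wedge i φ) χ := by
  simp only [normForm_apply, gram_wedge_left, Finset.mul_sum]
  exact Finset.sum_congr rfl fun _ _ => by ring

lemma sum_metric_mul_normForm (x : Background d) (φ χ : Fock d) :
    ∑ i, ∑ j, metric x i j * normForm x (contract i φ) (contract j χ) =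
      normForm x φ (number χ) := by
  rw [Finset.sum_comm, number_eq_sum, map_sum]
  refine Finset.sum_congr rfl fun j _ => ?_
  rw [← sum_mul_normForm_left]
  exact Finset.sum_congr rfl fun i _ => by rw [metric_symm]

lemma normForm_number (x : Background d) (φ χ : Fock d) :
    normForm x (number φ) χ = normForm x φ (number χ) := by
  rw [normForm_symm, ← sum_metric_mul_normForm, ← sum_metric_mul_normForm, Finset.sum_comm]
  exact Finset.sum_congr rfl fun i _ => Finset.sum_congr rfl fun j _ => by
    rw [metric_symm, normForm_symm]

lemma sum_metric_mul_inv {x : Background d} (hx : x ∈ moduli d) (i l : Fin d) :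
    ∑ k, metric x i k * (metric x)⁻¹ k l = if i = l then 1 else 0 := by
  rw [← Matrix.one_apply, ← Matrix.mul_nonsing_inv _ (isUnit_det_metric hx), Matrix.mul_apply]

lemma sum_sum_metric_mul_inv {x : Background d} (hx : x ∈ moduli d) :
    ∑ i, ∑ j, metric x i j * (metric x)⁻¹ i j = d := by
  have : ∀ i : Fin d, ∑ j, metric x i j * (metric x)⁻¹ i j = 1 := by
    intro i
    rw [← (sum_metric_mul_inv hx i i).trans (if_pos rfl)]
    exact Finset.sum_congr rfl fun j _ => by rw [inv_metric_symm]
  simp [this]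

lemma hasLineDerivAt_inv_sqrt_det {x : Background d} (hx : x ∈ moduli d) (i j : Fin d) :
    HasLineDerivAt ℝ (fun y => (√((metric y).det))⁻¹)
      (-(metric x)⁻¹ i j * (√((metric x).det))⁻¹) x (dirG i j) := by
  have hpos : 0 < (metric x).det := Matrix.PosDef.det_pos hx
  have h1 := hasDerivAt_det (metric_transpose x) (isUnit_det_metric hx) (symUnit i j)
  rw [sum_symUnit_mul i j fun k l => (metric x)⁻¹ k l, inv_metric_symm x j i] at h1
  rw [HasLineDerivAt]
  simp only [metric_add_dirG]
  have h0 : metric x + (0 : ℝ) • symUnit i j = metric x := by rw [zero_smul, add_zero]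
  have h2 := (h1.sqrt (by rw [h0]; exact hpos.ne')).inv
    (by rw [h0]; exact (Real.sqrt_pos.2 hpos).ne')
  rw [h0] at h2
  refine h2.congr_deriv ?_
  have h3 := Real.sq_sqrt hpos.le
  have h4 := (Real.sqrt_pos.2 hpos).ne'
  field_simp
  rw [h3]; ring

/-- The first term is the variation of 1/V_d; the other two come from the two entries of the
symmetric direction. -/
lemma hasLineDerivAt_normForm {x : Background d} (hx : x ∈ moduli d) (i j : Fin d)
    (φ χ : Fock d) :
    HasLineDerivAt ℝ (fun y => normForm y φ χ)
      (-(metric x)⁻¹ i j * normForm x φ χ + normForm x (contract i φ) (contract j χ) +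
        normForm x (contract j φ) (contract i χ)) x (dirG i j) := by
  have h1 := hasLineDerivAt_inv_sqrt_det hx i j
  have h2 := hasDerivAt_gram (metric x) (symUnit i j) φ χ 0
  rw [HasLineDerivAt] at h1 ⊢
  rw [sum_symUnit_mul] at h2
  have h0 : metric x + (0 : ℝ) • symUnit i j = metric x := by rw [zero_smul, add_zero]
  simp only [metric_add_dirG, normForm_apply] at h1 ⊢
  refine (h1.mul h2).congr_deriv ?_
  rw [h0]
  ring

/-! ### First and second derivatives of the spinor mass -/

variable (m : Fock d)

/-- The derivative of `y ↦ ⟨K ψ(y), L ψ(y)⟩` along `∂/∂g_{ij}`. -/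
lemma hasLineDerivAt_normForm_dressed_dirG {x : Background d} (hx : x ∈ moduli d) (i j : Fin d)
    (K L : Fock d →ₗ[ℝ] Fock d) :
    HasLineDerivAt ℝ (fun y => normForm y (K (dressedSpinor y m)) (L (dressedSpinor y m)))
      (-(metric x)⁻¹ i j * normForm x (K (dressedSpinor x m)) (L (dressedSpinor x m)) +
        normForm x (contract i (K (dressedSpinor x m))) (contract j (L (dressedSpinor x m))) +
        normForm x (contract j (K (dressedSpinor x m))) (contract i (L (dressedSpinor x m))))
      x (dirG i j) := by
  have h := hasLineDerivAt_normForm hx i j (K (dressedSpinor x m)) (L (dressedSpinor x m))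
  rw [HasLineDerivAt] at h ⊢
  simpa only [dressedSpinor_add_dirG] using h

/-- The derivative of `y ↦ ⟨K ψ(y), L ψ(y)⟩` along `∂/∂B_{ij}`. -/
lemma hasLineDerivAt_normForm_dressed_dirB (x : Background d) (i j : Fin d)
    (K L : Fock d →ₗ[ℝ] Fock d) :
    HasLineDerivAt ℝ (fun y => normForm y (K (dressedSpinor y m)) (L (dressedSpinor y m)))
      (normForm x (K (contract j (contract i (dressedSpinor x m)))) (L (dressedSpinor x m)) +
        normForm x (K (dressedSpinor x m)) (L (contract j (contract i (dressedSpinor x m)))))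
      x (dirB i j) := by
  have h0 : ∀ t : ℝ, normForm (x + t • dirB i j) = normForm x := by
    intro t; unfold normForm; rw [metric_add_dirB]
  rw [HasLineDerivAt]
  simp only [dressedSpinor_add_dirB, h0, map_add, map_smul, LinearMap.add_apply,
    LinearMap.smul_apply, smul_eq_mul]
  generalize normForm x (K (dressedSpinor x m)) (L (dressedSpinor x m)) = a
  generalize normForm x (K (dressedSpinor x m))
    (L (contract j (contract i (dressedSpinor x m)))) = b
  generalize normForm x (K (contract j (contract i (dressedSpinor x m))))
    (L (dressedSpinor x m)) = c
  generalize normForm x (K (contract j (contract i (dressedSpinor x m))))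
    (L (contract j (contract i (dressedSpinor x m)))) = e
  -- Both entries of the pairing are affine in t, so it is the polynomial a + tc + t(b + te).
  have h1 := (((hasDerivAt_id (0 : ℝ)).mul_const c).const_add a).add
    (((hasDerivAt_id (0 : ℝ)).mul (((hasDerivAt_id (0 : ℝ)).mul_const e).const_add b)))
  refine (HasDerivAt.congr_of_eventuallyEq h1 (Filter.Eventually.of_forall fun t => ?_)).congr_deriv ?_
  · simp
  · simp

/-- `𝓜²` of a spinor. -/
def spinMass (x : Background d) : ℝ := normForm x (dressedSpinor x m) (dressedSpinor x m)

/-- `∂𝓜²/∂g_{ij}`. -/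
def spinMassG (i j : Fin d) (x : Background d) : ℝ :=
  -(metric x)⁻¹ i j * spinMass m x +
    2 * normForm x (contract i (dressedSpinor x m)) (contract j (dressedSpinor x m))

/-- `∂𝓜²/∂B_{ij}`. -/
def spinMassB (i j : Fin d) (x : Background d) : ℝ :=
  2 * normForm x (dressedSpinor x m) (contract j (contract i (dressedSpinor x m)))

/-- `∂²𝓜²/∂g_{ij}∂g_{kl}`. -/
def spinMassGG (i j k l : Fin d) (x : Background d) : ℝ :=
  ((metric x)⁻¹ k i * (metric x)⁻¹ j l + (metric x)⁻¹ k j * (metric x)⁻¹ i l) * spinMass m x -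
    (metric x)⁻¹ k l * spinMassG m i j x +
    2 * (-(metric x)⁻¹ i j *
        normForm x (contract k (dressedSpinor x m)) (contract l (dressedSpinor x m)) +
      normForm x (contract i (contract k (dressedSpinor x m)))
        (contract j (contract l (dressedSpinor x m))) +
      normForm x (contract j (contract k (dressedSpinor x m)))
        (contract i (contract l (dressedSpinor x m))))

/-- `∂²𝓜²/∂B_{ij}∂B_{kl}`. -/
def spinMassBB (i j k l : Fin d) (x : Background d) : ℝ :=
  2 * (normForm x (contract j (contract i (dressedSpinor x m)))
      (contract l (contract k (dressedSpinor x m))) +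
    normForm x (dressedSpinor x m)
      (contract l (contract k (contract j (contract i (dressedSpinor x m))))))

/-- `⟨ψ, N ψ⟩` for the number operator `N`. -/
def spinDegree (x : Background d) : ℝ := normForm x (dressedSpinor x m) (number (dressedSpinor x m))

/-- `⟨ψ, N² ψ⟩` for the number operator `N`. -/
def spinDegreeSq (x : Background d) : ℝ :=
  normForm x (dressedSpinor x m) (number (number (dressedSpinor x m)))

lemma hasLineDerivAt_spinMass_dirG {x : Background d} (hx : x ∈ moduli d) (i j : Fin d) :
    HasLineDerivAt ℝ (spinMass m) (spinMassG m i j x) x (dirG i j) := by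
  have h := hasLineDerivAt_normForm_dressed_dirG m hx i j LinearMap.id LinearMap.id
  refine HasDerivAt.congr_deriv h ?_
  simp only [LinearMap.id_apply, spinMassG, spinMass]
  rw [normForm_symm x (contract j _)]
  ring

lemma hasLineDerivAt_spinMass_dirB (x : Background d) (i j : Fin d) :
    HasLineDerivAt ℝ (spinMass m) (spinMassB m i j x) x (dirB i j) := by
  have h := hasLineDerivAt_normForm_dressed_dirB m x i j LinearMap.id LinearMap.id
  refine HasDerivAt.congr_deriv h ?_
  simp only [LinearMap.id_apply, spinMassB]
  rw [normForm_symm x (contract j _)]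
  ring

lemma hasLineDerivAt_spinMassG {x : Background d} (hx : x ∈ moduli d) (i j k l : Fin d) :
    HasLineDerivAt ℝ (spinMassG m k l) (spinMassGG m i j k l x) x (dirG i j) := by
  have h1 := hasLineDerivAt_inv_metric hx i j k l
  have h2 := hasLineDerivAt_spinMass_dirG m hx i j
  have h3 := hasLineDerivAt_normForm_dressed_dirG m hx i j (contract k) (contract l)
  rw [HasLineDerivAt] at h1 h2 h3 ⊢
  have h4 := (h1.neg.mul h2).add (h3.const_mul 2)
  refine HasDerivAt.congr_deriv h4 ?_
  simp only [spinMassGG, zero_smul, add_zero]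
  simp
  ring

lemma hasLineDerivAt_spinMassB (x : Background d) (i j k l : Fin d) :
    HasLineDerivAt ℝ (spinMassB m k l) (spinMassBB m i j k l x) x (dirB i j) := by
  have h := hasLineDerivAt_normForm_dressed_dirB m x i j LinearMap.id (contract l ∘ₗ contract k)
  exact HasDerivAt.const_mul 2 h

lemma sum_metric_mul_spinMassG {x : Background d} (hx : x ∈ moduli d) :
    ∑ i, ∑ j, metric x i j * spinMassG m i j x = 2 * spinDegree m x - d * spinMass m x := by
  have h1 := sum_metric_mul_normForm x (dressedSpinor x m) (dressedSpinor x m)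
  have h2 := sum_sum_metric_mul_inv hx
  rw [spinDegree, ← h1, ← h2, Finset.mul_sum, Finset.sum_mul, ← Finset.sum_sub_distrib]
  refine Finset.sum_congr rfl fun i _ => ?_
  rw [Finset.mul_sum, Finset.sum_mul, ← Finset.sum_sub_distrib]
  refine Finset.sum_congr rfl fun j _ => ?_
  rw [spinMassG]; ring

/-- The derivative of `g_{ij} ∂𝓜²/∂g_{ij}` along `∂/∂g_{kl}`, contracted with the metric. -/
lemma exists_hasLineDerivAt_scale {x : Background d} (hx : x ∈ moduli d) :
    ∃ D : Fin d → Fin d → ℝ,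
      (∀ i j, HasLineDerivAt ℝ (fun y => 2 * spinDegree m y - d * spinMass m y) (D i j) x
        (dirG i j)) ∧
      ∑ i, ∑ j, metric x i j * D i j =
        4 * spinDegreeSq m x - 4 * d * spinDegree m x + d ^ 2 * spinMass m x := by
  refine ⟨_, fun i j => HasDerivAt.sub
    ((hasLineDerivAt_normForm_dressed_dirG m hx i j LinearMap.id number).const_mul 2)
    ((hasLineDerivAt_spinMass_dirG m hx i j).const_mul (d : ℝ)), ?_⟩
  have h0 := sum_metric_mul_spinMassG m hx
  have h1 := sum_metric_mul_normForm x (dressedSpinor x m) (number (dressedSpinor x m))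
  have h2 := sum_sum_metric_mul_inv hx
  have h3 : ∑ i, ∑ j, metric x i j * normForm x (contract j (dressedSpinor x m))
      (contract i (number (dressedSpinor x m))) = spinDegreeSq m x := by
    rw [spinDegreeSq, ← h1, Finset.sum_comm]
    exact Finset.sum_congr rfl fun i _ => Finset.sum_congr rfl fun j _ => by rw [metric_symm]
  simp only [LinearMap.id_apply, mul_sub, mul_add, Finset.sum_sub_distrib, Finset.sum_add_distrib]
  have e1 : ∑ i, ∑ j, metric x i j * (2 * (-(metric x)⁻¹ i j *
      normForm x (dressedSpinor x m) (number (dressedSpinor x m)))) =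
      -2 * d * spinDegree m x := by
    rw [← h2, Finset.mul_sum, Finset.sum_mul]
    refine Finset.sum_congr rfl fun i _ => ?_
    rw [Finset.mul_sum, Finset.sum_mul]
    exact Finset.sum_congr rfl fun j _ => by rw [spinDegree]; ring
  have e2 : ∀ X : Fin d → Fin d → ℝ, ∀ c : ℝ, ∑ i, ∑ j, metric x i j * (c * X i j) =
      c * ∑ i, ∑ j, metric x i j * X i j := by
    intro X c
    simp only [Finset.mul_sum]
    exact Finset.sum_congr rfl fun i _ => Finset.sum_congr rfl fun j _ => by ring
  rw [e1, e2, e2, e2, h3, h1, h0, ← spinDegreeSq]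
  ring

end TDuality

end

open scoped TensorProduct BigOperators
noncomputable section
namespace TDuality
variable {d : ℕ}

/-! ### Contractions with the metric -/

lemma sum_metric_metric_eq_trace (x : Background d) (Z W : Matrix (Fin d) (Fin d) ℝ)
    (hW : W.transpose = W) :
    ∑ i, ∑ j, ∑ k, ∑ l, metric x i k * metric x j l * (Z i j * W k l) =
      ((metric x * Z) * (metric x * W)).trace := by
  have h1 : ∀ i j, ∑ k, ∑ l, metric x i k * metric x j l * (Z i j * W k l) =
      ∑ k, metric x k i * Z i j * (metric x * W) j k := by
    intro i j
    refine Finset.sum_congr rfl fun k _ => ?_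
    rw [Matrix.mul_apply, Finset.mul_sum]
    refine Finset.sum_congr rfl fun l _ => ?_
    rw [metric_symm x k i, show W l k = W k l from congrFun (congrFun hW.symm l) k]
    ring
  simp only [h1]
  rw [Matrix.trace]
  simp only [Matrix.diag_apply, Matrix.mul_apply (M := metric x * Z)]
  simp only [Matrix.mul_apply (M := metric x) (N := Z), Finset.sum_mul]
  calc ∑ i, ∑ j, ∑ k, metric x k i * Z i j * (metric x * W) j k
      = ∑ k, ∑ i, ∑ j, metric x k i * Z i j * (metric x * W) j k := (sum_rotate _).symm
    _ = _ := Finset.sum_congr rfl fun k _ => Finset.sum_comm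

variable (m : Fock d)

/-- The matrix `⟨ψ, e_i ∧ ι_j ψ⟩`. -/
def currentMatrix (x : Background d) : Matrix (Fin d) (Fin d) ℝ :=
  Matrix.of fun i j => normForm x (dressedSpinor x m) (wedge i (contract j (dressedSpinor x m)))

lemma trace_currentMatrix (x : Background d) : (currentMatrix m x).trace = spinDegree m x := by
  rw [spinDegree, number_eq_sum, map_sum]; rfl

lemma metric_mul_spinMassG {x : Background d} (hx : x ∈ moduli d) :
    metric x * Matrix.of (fun i j => spinMassG m i j x) =
      -(spinMass m x) • (1 : Matrix (Fin d) (Fin d) ℝ) + (2 : ℝ) • currentMatrix m x := by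
  ext i j
  simp only [Matrix.mul_apply, Matrix.of_apply, spinMassG, Matrix.add_apply, Matrix.smul_apply,
    currentMatrix, Matrix.one_apply, smul_eq_mul, mul_add, Finset.sum_add_distrib]
  rw [← sum_metric_mul_inv hx, ← sum_mul_normForm_left, Finset.mul_sum, Finset.mul_sum]
  congr 1 <;> exact Finset.sum_congr rfl fun k _ => by ring

/-- With one index lowered, the gradient in g is -𝓜²·1 + 2J for the current matrix J, and the
contraction is the trace of its square. -/
lemma sum_spinMassG_mul {x : Background d} (hx : x ∈ moduli d) :
    ∑ i, ∑ j, ∑ k, ∑ l, metric x i k * metric x j l * (spinMassG m i j x * spinMassG m k l x) =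
      d * spinMass m x ^ 2 - 4 * spinMass m x * spinDegree m x +
        4 * (currentMatrix m x * currentMatrix m x).trace := by
  have hW : (Matrix.of (fun i j => spinMassG m i j x)).transpose =
      Matrix.of (fun i j => spinMassG m i j x) := by
    ext i j
    simp only [Matrix.transpose_apply, Matrix.of_apply, spinMassG]
    rw [inv_metric_symm, normForm_symm]
  have h := sum_metric_metric_eq_trace x (Matrix.of (fun i j => spinMassG m i j x)) _ hW
  simp only [Matrix.of_apply] at h
  rw [h, metric_mul_spinMassG m hx, ← trace_currentMatrix m x]
  simp only [add_mul, mul_add, Matrix.trace_add, Matrix.smul_mul, Matrix.mul_smul,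
    Matrix.trace_smul, one_mul, mul_one, smul_eq_mul, Matrix.trace_one, Fintype.card_fin]
  ring

/-- The contraction of the currents `⟨ψ, ι_j ι_i ψ⟩` and `⟨ψ, e_j ∧ e_i ∧ ψ⟩`. -/
def pairCurrent (x : Background d) : ℝ :=
  ∑ i, ∑ j, normForm x (dressedSpinor x m) (contract j (contract i (dressedSpinor x m))) *
    normForm x (dressedSpinor x m) (wedge j (wedge i (dressedSpinor x m)))

lemma sum_metric_metric_contract_contract (x : Background d) (i j : Fin d) (φ χ : Fock d) :
    ∑ k, ∑ l, metric x i k * metric x j l * normForm x φ (contract l (contract k χ)) =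
      normForm x (wedge i (wedge j φ)) χ := by
  rw [← sum_mul_normForm_right]
  refine Finset.sum_congr rfl fun k _ => ?_
  rw [← sum_mul_normForm_right, Finset.mul_sum]
  exact Finset.sum_congr rfl fun l _ => by ring

lemma sum_spinMassB_mul (x : Background d) :
    ∑ i, ∑ j, ∑ k, ∑ l, metric x i k * metric x j l * (spinMassB m i j x * spinMassB m k l x) =
      -4 * pairCurrent m x := by
  rw [pairCurrent, Finset.mul_sum]
  refine Finset.sum_congr rfl fun i _ => ?_
  rw [Finset.mul_sum]
  refine Finset.sum_congr rfl fun j _ => ?_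
  have h := sum_metric_metric_contract_contract x i j (dressedSpinor x m) (dressedSpinor x m)
  rw [wedge_wedge i j, map_neg, LinearMap.neg_apply, normForm_symm] at h
  have h' : normForm x (dressedSpinor x m) (wedge j (wedge i (dressedSpinor x m))) =
    -∑ k, ∑ l, metric x i k * metric x j l * normForm x (dressedSpinor x m)
      (contract l (contract k (dressedSpinor x m))) := by rw [h, neg_neg]
  rw [h', mul_neg, mul_neg, Finset.mul_sum, Finset.mul_sum, ← Finset.sum_neg_distrib]
  refine Finset.sum_congr rfl fun k _ => ?_
  rw [Finset.mul_sum, Finset.mul_sum, ← Finset.sum_neg_distrib]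
  refine Finset.sum_congr rfl fun l _ => ?_
  simp only [spinMassB]
  ring

lemma sum_wedge_wedge_contract_contract (x : Background d) (φ : Fock d) :
    ∑ i, ∑ j, normForm x φ (wedge i (wedge j (contract j (contract i φ)))) =
      normForm x φ (number (number φ)) - normForm x φ (number φ) := by
  have h : ∀ i, ∑ j, normForm x φ (wedge i (wedge j (contract j (contract i φ)))) =
      normForm x φ (wedge i (contract i (number φ))) - normForm x φ (wedge i (contract i φ)) := by
    intro i
    rw [← map_sum, ← map_sum, ← number_eq_sum, ← map_sub, ← map_sub, contract_number,
      add_sub_cancel_right]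
  simp only [h, Finset.sum_sub_distrib]
  rw [← map_sum, ← map_sum, ← number_eq_sum, ← number_eq_sum]

lemma sum_swap_first_third (F : Fin d → Fin d → Fin d → Fin d → ℝ) :
    ∑ i, ∑ j, ∑ k, ∑ l, F i j k l = ∑ i, ∑ j, ∑ k, ∑ l, F k j i l := by
  rw [Finset.sum_comm]
  nth_rewrite 2 [Finset.sum_comm]
  exact Finset.sum_congr rfl fun j _ => Finset.sum_comm

lemma sum_swap_pairs (F : Fin d → Fin d → Fin d → Fin d → ℝ) :
    ∑ i, ∑ j, ∑ k, ∑ l, F i j k l = ∑ i, ∑ j, ∑ k, ∑ l, F k l i j := by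
  calc ∑ i, ∑ j, ∑ k, ∑ l, F i j k l
      = ∑ p : Fin d × Fin d, ∑ q : Fin d × Fin d, F p.1 p.2 q.1 q.2 := by
        simp only [Fintype.sum_prod_type]
    _ = ∑ q : Fin d × Fin d, ∑ p : Fin d × Fin d, F p.1 p.2 q.1 q.2 := Finset.sum_comm
    _ = ∑ i, ∑ j, ∑ k, ∑ l, F k l i j := by simp only [Fintype.sum_prod_type]

/-- Antisymmetry in two indices joined by the symmetric factor g_ik. It removes the second
derivative terms in which two anticommuting contractions carry such indices. -/
lemma sum_metric_metric_eq_zero (x : Background d) (F : Fin d → Fin d → Fin d → Fin d → ℝ)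
    (hF : ∀ i j k l, F k j i l = -F i j k l) :
    ∑ i, ∑ j, ∑ k, ∑ l, metric x i k * metric x j l * F i j k l = 0 := by
  refine self_eq_neg.1 ?_
  conv_lhs => rw [sum_swap_first_third]
  simp only [← Finset.sum_neg_distrib]
  refine Finset.sum_congr rfl fun i _ => Finset.sum_congr rfl fun j _ =>
    Finset.sum_congr rfl fun k _ => Finset.sum_congr rfl fun l _ => ?_
  rw [hF, metric_symm x k i]; ring

/-- The fourfold contraction is killed by antisymmetry; the other term pairs two contractions with
two and is the expectation value of N(N-1). -/
lemma sum_spinMassBB (x : Background d) :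
    ∑ i, ∑ j, ∑ k, ∑ l, metric x i k * metric x j l * spinMassBB m i j k l x =
      2 * spinDegreeSq m x - 2 * spinDegree m x := by
  set ψ := dressedSpinor x m with hψ
  have h1 : ∀ i j, ∑ k, ∑ l, metric x i k * metric x j l *
      normForm x (contract j (contract i ψ)) (contract l (contract k ψ)) =
      normForm x ψ (wedge i (wedge j (contract j (contract i ψ)))) := by
    intro i j
    rw [sum_metric_metric_contract_contract, normForm_symm]
  have h2 := sum_metric_metric_eq_zero x
    (fun i j k l => normForm x ψ (contract l (contract k (contract j (contract i ψ))))) (by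
      intro i j k l
      have e : contract i (contract j (contract k ψ)) = -contract k (contract j (contract i ψ)) := by
        rw [contract_contract i j, contract_contract i k, map_neg, neg_neg, contract_contract j k]
      rw [e, map_neg, map_neg])
  have h3 : ∑ i, ∑ j, ∑ k, ∑ l, metric x i k * metric x j l * spinMassBB m i j k l x =
      2 * (∑ i, ∑ j, ∑ k, ∑ l, metric x i k * metric x j l *
        normForm x (contract j (contract i ψ)) (contract l (contract k ψ)) +
      ∑ i, ∑ j, ∑ k, ∑ l, metric x i k * metric x j l *
        normForm x ψ (contract l (contract k (contract j (contract i ψ))))) := by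
    simp only [mul_add, Finset.mul_sum, ← Finset.sum_add_distrib]
    refine Finset.sum_congr rfl fun i _ => Finset.sum_congr rfl fun j _ =>
      Finset.sum_congr rfl fun k _ => Finset.sum_congr rfl fun l _ => ?_
    rw [spinMassBB]; ring
  rw [h3, h2]
  simp only [h1]
  rw [sum_wedge_wedge_contract_contract, spinDegreeSq, spinDegree]
  ring

lemma sum_metric_metric_inv {x : Background d} (hx : x ∈ moduli d) (i j : Fin d) :
    ∑ k, ∑ l, metric x i k * metric x j l * (metric x)⁻¹ k l = metric x i j := by
  have h : ∀ k, ∑ l, metric x i k * metric x j l * (metric x)⁻¹ k l =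
      metric x i k * if j = k then 1 else 0 := by
    intro k
    rw [← sum_metric_mul_inv hx, Finset.mul_sum]
    exact Finset.sum_congr rfl fun l _ => by rw [inv_metric_symm x k l]; ring
  simp [h]

/-- The terms `hA1` to `hC` come from varying g⁻¹ and the volume. Of the two terms with four
contractions, `hD` vanishes by antisymmetry, while reordering `hE` gives minus the expectation value
of N(N-1). Purity plays no role at the linear level. -/
lemma sum_spinMassGG {x : Background d} (hx : x ∈ moduli d) :
    ∑ i, ∑ j, ∑ k, ∑ l, metric x i k * metric x j l * spinMassGG m i j k l x =
      (d ^ 2 + 2 * d) * spinMass m x - 2 * spinDegree m x - 2 * spinDegreeSq m x := by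
  set ψ := dressedSpinor x m with hψ
  set g := metric x with hg
  have hA1 : ∑ i, ∑ j, ∑ k, ∑ l, g i k * g j l * (g⁻¹ k i * g⁻¹ j l) = (d : ℝ) ^ 2 := by
    have h : ∀ i j, ∑ k, ∑ l, g i k * g j l * (g⁻¹ k i * g⁻¹ j l) = 1 := by
      intro i j
      have e : ∀ k l, g i k * g j l * (g⁻¹ k i * g⁻¹ j l) =
          (g i k * g⁻¹ k i) * (g j l * g⁻¹ l j) := fun k l => by
        rw [hg, inv_metric_symm x j l]; ring
      simp only [e]
      rw [← Finset.sum_mul_sum, hg, sum_metric_mul_inv hx, sum_metric_mul_inv hx]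
      simp
    simp [h, sq]
  have hA2 : ∑ i, ∑ j, ∑ k, ∑ l, g i k * g j l * (g⁻¹ k j * g⁻¹ i l) = (d : ℝ) := by
    have h : ∀ i j, ∑ k, ∑ l, g i k * g j l * (g⁻¹ k j * g⁻¹ i l) = if i = j then 1 else 0 := by
      intro i j
      have e : ∀ k l, g i k * g j l * (g⁻¹ k j * g⁻¹ i l) =
          (g i k * g⁻¹ k j) * (g j l * g⁻¹ l i) := fun k l => by
        rw [hg, inv_metric_symm x i l]; ring
      simp only [e]
      rw [← Finset.sum_mul_sum, hg, sum_metric_mul_inv hx, sum_metric_mul_inv hx]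
      by_cases hij : i = j
      · simp [hij]
      · simp [hij]
    simp [h]
  have hB : ∑ i, ∑ j, ∑ k, ∑ l, g i k * g j l * (g⁻¹ k l * spinMassG m i j x) =
      2 * spinDegree m x - d * spinMass m x := by
    rw [← sum_metric_mul_spinMassG m hx]
    refine Finset.sum_congr rfl fun i _ => Finset.sum_congr rfl fun j _ => ?_
    rw [← sum_metric_metric_inv hx, Finset.sum_mul]
    refine Finset.sum_congr rfl fun k _ => ?_
    rw [Finset.sum_mul]
    exact Finset.sum_congr rfl fun l _ => by ring
  have hC : ∑ i, ∑ j, ∑ k, ∑ l, g i k * g j l *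
      (g⁻¹ i j * normForm x (contract k ψ) (contract l ψ)) = spinDegree m x := by
    rw [sum_swap_pairs, spinDegree, ← sum_metric_mul_normForm]
    refine Finset.sum_congr rfl fun i _ => Finset.sum_congr rfl fun j _ => ?_
    rw [← sum_metric_metric_inv hx, Finset.sum_mul]
    refine Finset.sum_congr rfl fun k _ => ?_
    rw [Finset.sum_mul]
    exact Finset.sum_congr rfl fun l _ => by
      rw [hg, metric_symm x k i, metric_symm x l j]; ring
  have hD := sum_metric_metric_eq_zero x
    (fun i j k l => normForm x (contract i (contract k ψ)) (contract j (contract l ψ))) (by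
      intro i j k l
      rw [contract_contract k i, map_neg, LinearMap.neg_apply])
  have hE : ∑ i, ∑ j, ∑ k, ∑ l, g i k * g j l *
      normForm x (contract j (contract k ψ)) (contract i (contract l ψ)) =
      -(spinDegreeSq m x - spinDegree m x) := by
    have e1 : ∀ i j, ∑ k, ∑ l, g i k * g j l *
        normForm x (contract j (contract k ψ)) (contract i (contract l ψ)) =
        -∑ l, g j l * normForm x (contract j ψ) (wedge i (contract i (contract l ψ))) := by
      intro i j
      rw [Finset.sum_comm, ← Finset.sum_neg_distrib]
      refine Finset.sum_congr rfl fun l _ => ?_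
      rw [← sum_mul_normForm_left, Finset.mul_sum, ← Finset.sum_neg_distrib]
      refine Finset.sum_congr rfl fun k _ => ?_
      rw [contract_contract j k, map_neg, LinearMap.neg_apply]; ring
    simp only [e1, Finset.sum_neg_distrib]
    rw [Finset.sum_comm, spinDegreeSq, spinDegree, ← sum_metric_mul_normForm,
      ← sum_metric_mul_normForm, ← Finset.sum_sub_distrib]
    congr 1
    refine Finset.sum_congr rfl fun j _ => ?_
    rw [Finset.sum_comm, ← Finset.sum_sub_distrib]
    refine Finset.sum_congr rfl fun l _ => ?_
    rw [← Finset.mul_sum, ← map_sum, ← number_eq_sum, ← mul_sub, ← map_sub, contract_number,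
      add_sub_cancel_right]
  have key : ∑ i, ∑ j, ∑ k, ∑ l, g i k * g j l * spinMassGG m i j k l x =
      (∑ i, ∑ j, ∑ k, ∑ l, g i k * g j l * (g⁻¹ k i * g⁻¹ j l) +
        ∑ i, ∑ j, ∑ k, ∑ l, g i k * g j l * (g⁻¹ k j * g⁻¹ i l)) * spinMass m x -
      ∑ i, ∑ j, ∑ k, ∑ l, g i k * g j l * (g⁻¹ k l * spinMassG m i j x) +
      2 * (-∑ i, ∑ j, ∑ k, ∑ l, g i k * g j l *
          (g⁻¹ i j * normForm x (contract k ψ) (contract l ψ)) +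
        ∑ i, ∑ j, ∑ k, ∑ l, g i k * g j l *
          normForm x (contract i (contract k ψ)) (contract j (contract l ψ)) +
        ∑ i, ∑ j, ∑ k, ∑ l, g i k * g j l *
          normForm x (contract j (contract k ψ)) (contract i (contract l ψ))) := by
    simp only [Finset.mul_sum, Finset.sum_mul, ← Finset.sum_add_distrib, ← Finset.sum_neg_distrib,
      ← Finset.sum_sub_distrib]
    refine Finset.sum_congr rfl fun i _ => Finset.sum_congr rfl fun j _ =>
      Finset.sum_congr rfl fun k _ => Finset.sum_congr rfl fun l _ => ?_
    rw [spinMassGG]; ring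
  rw [key, hA1, hA2, hB, hC, hD, hE]
  ring

/-! ### Consequences of the pure spinor equations -/

/-- A Fierz identity: the purity equation is paired with (a, b) ↦ Σ_j ⟨α, ι_j a⟩⟨β, e_j∧b⟩, and ι_j
is moved past e_i∧. The anticommutator δ_ij produces the term with the number operator. -/
lemma IsPure.sum_currents {φ : Fock d} (h : IsPure φ) (x : Background d) (α β : Fock d) :
    normForm x α φ * normForm x β (number φ) -
      ∑ i, ∑ j, normForm x α (wedge i (contract j φ)) * normForm x β (wedge j (contract i φ)) +
      ∑ i, ∑ j, normForm x α (contract j (contract i φ)) * normForm x β (wedge j (wedge i φ)) =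
        0 := by
  have h1 : ∀ j, ∑ i, (normForm x α (contract j (wedge i φ)) *
      normForm x β (wedge j (contract i φ)) + normForm x α (contract j (contract i φ)) *
      normForm x β (wedge j (wedge i φ))) = 0 := fun j =>
    h.sum_eq_zero ((LinearMap.mul ℝ ℝ).compl₁₂ (normForm x α ∘ₗ contract j)
      (normForm x β ∘ₗ wedge j))
  have h2 : ∑ j, ∑ i, (normForm x α (contract j (wedge i φ)) *
      normForm x β (wedge j (contract i φ)) + normForm x α (contract j (contract i φ)) *
      normForm x β (wedge j (wedge i φ))) = 0 := Finset.sum_eq_zero fun j _ => h1 j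
  rw [Finset.sum_comm] at h2
  rw [← h2]
  simp only [contract_wedge, map_sub, sub_mul, Finset.sum_add_distrib, Finset.sum_sub_distrib]
  congr 2
  rw [number_eq_sum, map_sum, Finset.mul_sum]
  refine Finset.sum_congr rfl fun i _ => ?_
  rw [Finset.sum_eq_single i]
  · simp
  · intro j _ hj; simp [hj]
  · simp

lemma normForm_wedge_wedge (x : Background d) (i j : Fin d) (γ δ : Fock d) :
    ∑ k, ∑ l, metric x i k * metric x j l * normForm x (contract k (contract l γ)) δ =
      normForm x γ (wedge j (wedge i δ)) := by
  rw [← sum_mul_normForm_left, Finset.sum_comm]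
  refine Finset.sum_congr rfl fun l _ => ?_
  rw [← sum_mul_normForm_left, Finset.mul_sum]
  exact Finset.sum_congr rfl fun k _ => by ring

/-- All four operators are moved to the other entry of their pairings; the metric factors released
by one product are absorbed by the other. -/
lemma sum_contract_mul_wedge (x : Background d) (α β γ δ : Fock d) :
    ∑ i, ∑ j, normForm x α (contract j (contract i β)) * normForm x γ (wedge j (wedge i δ)) =
      ∑ i, ∑ j, normForm x (wedge i (wedge j α)) β *
        normForm x (contract i (contract j γ)) δ := by
  have h1 : ∑ i, ∑ j, normForm x α (contract j (contract i β)) *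
      normForm x γ (wedge j (wedge i δ)) = ∑ i, ∑ j, ∑ k, ∑ l, metric x i k * metric x j l *
        (normForm x α (contract j (contract i β)) *
          normForm x (contract k (contract l γ)) δ) := by
    refine Finset.sum_congr rfl fun i _ => Finset.sum_congr rfl fun j _ => ?_
    rw [← normForm_wedge_wedge, Finset.mul_sum]
    refine Finset.sum_congr rfl fun k _ => ?_
    rw [Finset.mul_sum]
    exact Finset.sum_congr rfl fun l _ => by ring
  rw [h1, sum_swap_pairs]
  refine Finset.sum_congr rfl fun i _ => Finset.sum_congr rfl fun j _ => ?_
  rw [← sum_metric_metric_contract_contract, Finset.sum_mul]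
  refine Finset.sum_congr rfl fun k _ => ?_
  rw [Finset.sum_mul]
  exact Finset.sum_congr rfl fun l _ => by rw [metric_symm x k i, metric_symm x l j]; ring

lemma IsPure.trace_currentMatrix_sq {m : Fock d} (hm : IsPure m) (x : Background d) :
    (currentMatrix m x * currentMatrix m x).trace - pairCurrent m x =
      spinMass m x * spinDegree m x := by
  have h := (hm.dressed x).sum_currents x (dressedSpinor x m) (dressedSpinor x m)
  have ht : (currentMatrix m x * currentMatrix m x).trace = ∑ i, ∑ j,
      normForm x (dressedSpinor x m) (wedge i (contract j (dressedSpinor x m))) *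
        normForm x (dressedSpinor x m) (wedge j (contract i (dressedSpinor x m))) := by
    simp only [Matrix.trace, Matrix.diag_apply, Matrix.mul_apply, currentMatrix, Matrix.of_apply]
  rw [ht, pairCurrent, spinMass, spinDegree]
  linarith

/-- `IsPure.sum_currents` is applied with (α, β) = (ψ, Nψ) and with (Nψ, ψ), and the results are
subtracted. The double sums with one e∧ and one ι agree after exchanging i and j. The others differ
by twice the pair current, because e_j∧e_i∧ raises N by two. -/
lemma IsPure.two_mul_pairCurrent {m : Fock d} (hm : IsPure m) (x : Background d) :
    -2 * pairCurrent m x = spinMass m x * spinDegreeSq m x - spinDegree m x ^ 2 := by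
  have h1 := (hm.dressed x).sum_currents x (dressedSpinor x m)
    (number (dressedSpinor x m))
  have h2 := (hm.dressed x).sum_currents x (number (dressedSpinor x m))
    (dressedSpinor x m)
  rw [pairCurrent, spinMass, spinDegreeSq, spinDegree]
  generalize dressedSpinor x m = ψ at *
  have hX : ∑ i, ∑ j, normForm x ψ (wedge i (contract j ψ)) *
      normForm x (number ψ) (wedge j (contract i ψ)) =
      ∑ i, ∑ j, normForm x (number ψ) (wedge i (contract j ψ)) *
      normForm x ψ (wedge j (contract i ψ)) := by
    rw [Finset.sum_comm]
    exact Finset.sum_congr rfl fun i _ => Finset.sum_congr rfl fun j _ => mul_comm _ _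
  have hY : ∑ i, ∑ j, normForm x ψ (contract j (contract i ψ)) *
      normForm x (number ψ) (wedge j (wedge i ψ)) =
      ∑ i, ∑ j, normForm x (number ψ) (contract j (contract i ψ)) *
        normForm x ψ (wedge j (wedge i ψ)) +
      2 * ∑ i, ∑ j, normForm x ψ (contract j (contract i ψ)) *
        normForm x ψ (wedge j (wedge i ψ)) := by
    have e1 : ∀ i j, normForm x (number ψ) (wedge j (wedge i ψ)) =
        normForm x ψ (wedge j (wedge i (number ψ))) +
          2 * normForm x ψ (wedge j (wedge i ψ)) := by
      intro i j
      rw [normForm_number, wedge_number i, map_sub, wedge_number j, map_sub, map_sub]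
      ring
    simp only [e1, mul_add, Finset.sum_add_distrib]
    rw [sum_contract_mul_wedge]
    congr 1
    · rw [Finset.sum_comm]
      refine Finset.sum_congr rfl fun i _ => Finset.sum_congr rfl fun j _ => ?_
      rw [normForm_symm x _ ψ, normForm_symm x _ (number ψ), mul_comm]
    · simp only [Finset.mul_sum]
      exact Finset.sum_congr rfl fun i _ => Finset.sum_congr rfl fun j _ => by ring
  have e2 : normForm x (number ψ) ψ = normForm x ψ (number ψ) := normForm_symm x _ _
  have e3 : normForm x (number ψ) (number ψ) = normForm x ψ (number (number ψ)) :=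
    normForm_number x _ _
  rw [hX, hY, e3] at h1
  rw [e2] at h2
  linarith

end TDuality

end

open scoped TensorProduct BigOperators
noncomputable section
namespace TDuality
variable {d : ℕ}

/-! ## Powers of a mass function under the differential operators -/

lemma continuous_metric_entry (i j : Fin d) : Continuous fun x : Background d => metric x i j := by
  simp only [metric, Matrix.of_apply]; fun_prop

/-- Positivity on the compact unit sphere is an open condition. Openness is what allows a formula
for first derivatives on the moduli space to be differentiated again. -/
lemma isOpen_moduli : IsOpen (moduli d) := by
  have hQ : ∀ x : Background d, x ∈ moduli d ↔ ∀ v ∈ Metric.sphere (0 : Fin d → ℝ) 1,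
      0 < ∑ i, ∑ j, v i * metric x i j * v j := by
    intro x
    have hq : ∀ v : Fin d → ℝ, dotProduct v ((metric x).mulVec v) =
        ∑ i, ∑ j, v i * metric x i j * v j := by
      intro v
      simp only [dotProduct, Matrix.mulVec, Finset.mul_sum, mul_assoc]
    constructor
    · intro hx v hv
      have hv0 : v ≠ 0 := by
        rintro rfl; simp at hv
      have := Matrix.PosDef.dotProduct_mulVec_pos hx hv0
      rwa [star_trivial, hq] at this
    · intro h
      refine Matrix.PosDef.of_dotProduct_mulVec_pos ?_ fun {v} hv => ?_
      · exact (Matrix.conjTranspose_eq_transpose_of_trivial _).trans (metric_transpose x)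
      · rw [star_trivial]
        have hn : ‖v‖ ≠ 0 := norm_ne_zero_iff.2 hv
        have h1 := h (‖v‖⁻¹ • v) (by simp [norm_smul, hn])
        rw [← hq, Matrix.mulVec_smul, dotProduct_smul, smul_dotProduct, smul_smul,
          smul_eq_mul] at h1
        exact (pos_iff_pos_of_mul_pos h1).1 (by positivity)
  rw [isOpen_iff_mem_nhds]
  intro x hx
  have h1 := (hQ x).1 hx
  have h2 : ∀ᶠ y in nhds x, ∀ v ∈ Metric.sphere (0 : Fin d → ℝ) 1,
      0 < ∑ i, ∑ j, v i * metric y i j * v j := by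
    refine (isCompact_sphere _ _).eventually_forall_of_forall_eventually fun v hv => ?_
    have hc : Continuous fun p : Background d × (Fin d → ℝ) =>
        ∑ i, ∑ j, p.2 i * metric p.1 i j * p.2 j := by
      refine continuous_finsetSum _ fun i _ => continuous_finsetSum _ fun j _ => ?_
      have := (continuous_metric_entry i j).comp
        (continuous_fst : Continuous (Prod.fst : Background d × (Fin d → ℝ) → Background d))
      exact (((continuous_apply i).comp continuous_snd).mul this).mul
        ((continuous_apply j).comp continuous_snd)
    exact hc.continuousAt.eventually (lt_mem_nhds (h1 v hv))
  filter_upwards [h2] with y hy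
  exact (hQ y).2 hy

lemma hasLineDerivAt_cpow {f : Background d → ℝ} {f' : ℝ} {x v : Background d} (hpos : 0 < f x)
    (h : HasLineDerivAt ℝ f f' x v) (c : ℂ) :
    HasLineDerivAt ℝ (fun y => (f y : ℂ) ^ c) (c * (f x : ℂ) ^ (c - 1) * f') x v := by
  rw [HasLineDerivAt] at h ⊢
  have h1 := h.ofReal_comp
  have h0 : f (x + (0 : ℝ) • v) = f x := by rw [zero_smul, add_zero]
  have h2 : HasDerivAt (fun z : ℂ => z ^ c) (c * (f x : ℂ) ^ (c - 1)) (f (x + (0 : ℝ) • v) : ℂ) := by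
    rw [h0]
    simpa using (hasDerivAt_id (f x : ℂ)).cpow_const (c := c) (Complex.ofReal_mem_slitPlane.2 hpos)
  exact HasDerivAt.comp (h := fun t : ℝ => (f (x + t • v) : ℂ)) (0 : ℝ) h2 h1

/-- The first and the diagonal second derivatives of a positive function on the moduli space. -/
structure Jet (f : Background d → ℝ) where
  pos : ∀ x ∈ moduli d, 0 < f x
  G : Fin d → Fin d → Background d → ℝ
  B : Fin d → Fin d → Background d → ℝ
  GG : Fin d → Fin d → Fin d → Fin d → Background d → ℝ
  BB : Fin d → Fin d → Fin d → Fin d → Background d → ℝ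
  hasG : ∀ x ∈ moduli d, ∀ i j, HasLineDerivAt ℝ f (G i j x) x (dirG i j)
  hasB : ∀ x ∈ moduli d, ∀ i j, HasLineDerivAt ℝ f (B i j x) x (dirB i j)
  hasGG : ∀ x ∈ moduli d, ∀ i j k l, HasLineDerivAt ℝ (G k l) (GG i j k l x) x (dirG i j)
  hasBB : ∀ x ∈ moduli d, ∀ i j k l, HasLineDerivAt ℝ (B k l) (BB i j k l x) x (dirB i j)

lemma lineDeriv_lineDeriv_cpow {f fv : Background d → ℝ} {fu fuv : ℝ} {x u v : Background d}
    (hx : x ∈ moduli d) (hpos : ∀ y ∈ moduli d, 0 < f y)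
    (hv : ∀ y ∈ moduli d, HasLineDerivAt ℝ f (fv y) y v) (hu : HasLineDerivAt ℝ f fu x u)
    (huv : HasLineDerivAt ℝ fv fuv x u) (s : ℂ) :
    lineDeriv ℝ (fun y => lineDeriv ℝ (fun z => (f z : ℂ) ^ (-s)) y v) x u =
      (f x : ℂ) ^ (-s - 2) * (-s * (f x * fuv) + s * (s + 1) * (fu * fv x)) := by
  have h1 : (fun y => lineDeriv ℝ (fun z => (f z : ℂ) ^ (-s)) y v) =ᶠ[nhds x]
      fun y => -s * (f y : ℂ) ^ (-s - 1) * fv y := by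
    filter_upwards [isOpen_moduli.mem_nhds hx] with y hy
    exact (hasLineDerivAt_cpow (hpos y hy) (hv y hy) (-s)).lineDeriv
  have h2 : HasLineDerivAt ℝ (fun y => -s * (f y : ℂ) ^ (-s - 1) * fv y)
      ((-s * ((-s - 1) * (f x : ℂ) ^ (-s - 1 - 1) * fu)) * fv x +
        -s * (f x : ℂ) ^ (-s - 1) * fuv) x u := by
    have e1 := (hasLineDerivAt_cpow (hpos x hx) hu (-s - 1))
    rw [HasLineDerivAt] at e1 huv ⊢
    refine ((e1.const_mul (-s)).mul huv.ofReal_comp).congr_deriv ?_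
    simp only [zero_smul, add_zero]
  rw [(h2.congr_of_eventuallyEq h1).lineDeriv]
  have hne : (f x : ℂ) ≠ 0 := Complex.ofReal_ne_zero.2 (hpos x hx).ne'
  have e : (f x : ℂ) ^ (-s - 1) = (f x : ℂ) ^ (-s - 2) * f x := by
    rw [show -s - 1 = (-s - 2) + 1 by ring, Complex.cpow_add _ _ hne, Complex.cpow_one]
  rw [e, show -s - 1 - 1 = -s - 2 by ring]
  ring

/-! ### The operators on complex powers: linear part and gradient part -/

namespace Jet

variable {f : Background d → ℝ} (J : Jet f)

lemma dG_cpow {x : Background d} (hx : x ∈ moduli d) (s : ℂ) (i j : Fin d) :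
    dG i j (fun y => (f y : ℂ) ^ (-s)) x = -s * (f x : ℂ) ^ (-s - 1) * J.G i j x :=
  (hasLineDerivAt_cpow (J.pos x hx) (J.hasG x hx i j) (-s)).lineDeriv

lemma scaleOp_cpow {x : Background d} (hx : x ∈ moduli d) (s : ℂ) :
    scaleOp (fun y => (f y : ℂ) ^ (-s)) x =
      -s * (f x : ℂ) ^ (-s - 1) * (∑ i, ∑ j, metric x i j * J.G i j x : ℝ) := by
  simp only [scaleOp, J.dG_cpow hx]
  push_cast
  rw [Finset.mul_sum]
  refine Finset.sum_congr rfl fun i _ => ?_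
  rw [Finset.mul_sum]
  exact Finset.sum_congr rfl fun j _ => by ring

lemma cpow_sub_one (J : Jet f) {x : Background d} (hx : x ∈ moduli d) (s : ℂ) :
    (f x : ℂ) ^ (-s - 1) = (f x : ℂ) ^ (-s - 2) * f x := by
  rw [show -s - 1 = (-s - 2) + 1 by ring,
    Complex.cpow_add _ _ (Complex.ofReal_ne_zero.2 (J.pos x hx).ne'), Complex.cpow_one]

lemma sum_dG_dG_cpow {x : Background d} (hx : x ∈ moduli d) (s : ℂ) :
    ∑ i, ∑ j, ∑ k, ∑ l, (metric x i k : ℂ) * (metric x j l : ℂ) *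
      dG i j (dG k l fun y => (f y : ℂ) ^ (-s)) x =
    (f x : ℂ) ^ (-s - 2) * (-s * (f x *
        (∑ i, ∑ j, ∑ k, ∑ l, metric x i k * metric x j l * J.GG i j k l x : ℝ)) +
      s * (s + 1) * (∑ i, ∑ j, ∑ k, ∑ l, metric x i k * metric x j l *
        (J.G i j x * J.G k l x) : ℝ)) := by
  push_cast
  simp only [Finset.mul_sum, ← Finset.sum_add_distrib]
  refine Finset.sum_congr rfl fun i _ => Finset.sum_congr rfl fun j _ =>
    Finset.sum_congr rfl fun k _ => Finset.sum_congr rfl fun l _ => ?_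
  have h : dG i j (dG k l fun y => (f y : ℂ) ^ (-s)) x = _ :=
    lineDeriv_lineDeriv_cpow hx J.pos (fun y hy => J.hasG y hy k l) (J.hasG x hx i j)
      (J.hasGG x hx i j k l) s
  rw [h]; ring

lemma sum_dB_dB_cpow {x : Background d} (hx : x ∈ moduli d) (s : ℂ) :
    ∑ i, ∑ j, ∑ k, ∑ l, (metric x i k : ℂ) * (metric x j l : ℂ) *
      dB i j (dB k l fun y => (f y : ℂ) ^ (-s)) x =
    (f x : ℂ) ^ (-s - 2) * (-s * (f x *
        (∑ i, ∑ j, ∑ k, ∑ l, metric x i k * metric x j l * J.BB i j k l x : ℝ)) +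
      s * (s + 1) * (∑ i, ∑ j, ∑ k, ∑ l, metric x i k * metric x j l *
        (J.B i j x * J.B k l x) : ℝ)) := by
  push_cast
  simp only [Finset.mul_sum, ← Finset.sum_add_distrib]
  refine Finset.sum_congr rfl fun i _ => Finset.sum_congr rfl fun j _ =>
    Finset.sum_congr rfl fun k _ => Finset.sum_congr rfl fun l _ => ?_
  have h : dB i j (dB k l fun y => (f y : ℂ) ^ (-s)) x = _ :=
    lineDeriv_lineDeriv_cpow hx J.pos (fun y hy => J.hasB y hy k l) (J.hasB x hx i j)
      (J.hasBB x hx i j k l) s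
  rw [h]; ring

/-- The Laplacian of a power. -/
lemma laplaceSO_cpow {x : Background d} (hx : x ∈ moduli d) (s : ℂ) {L Γ : ℝ}
    (hL : 1 / 4 * (∑ i, ∑ j, ∑ k, ∑ l, metric x i k * metric x j l * J.GG i j k l x +
      ∑ i, ∑ j, ∑ k, ∑ l, metric x i k * metric x j l * J.BB i j k l x) +
      1 / 2 * ∑ i, ∑ j, metric x i j * J.G i j x = L)
    (hΓ : 1 / 4 * (∑ i, ∑ j, ∑ k, ∑ l, metric x i k * metric x j l *
        (J.G i j x * J.G k l x) + ∑ i, ∑ j, ∑ k, ∑ l, metric x i k * metric x j l *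
        (J.B i j x * J.B k l x)) = Γ) :
    laplaceSO (fun y => (f y : ℂ) ^ (-s)) x =
      (f x : ℂ) ^ (-s - 2) * (-s * (f x * L) + s * (s + 1) * Γ) := by
  rw [laplaceSO, J.scaleOp_cpow hx, J.cpow_sub_one hx]
  simp only [mul_add, Finset.sum_add_distrib]
  rw [J.sum_dG_dG_cpow hx, J.sum_dB_dB_cpow hx, ← hL, ← hΓ]
  simp only [Complex.ofReal_add, Complex.ofReal_mul]
  push_cast
  ring

/-- The non-invariant operator on a power. -/
lemma box_cpow {x : Background d} (hx : x ∈ moduli d) (s : ℂ) {L Γ : ℝ}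
    {sc : Background d → ℝ} (hsc : ∀ y ∈ moduli d, ∑ i, ∑ j, metric y i j * J.G i j y = sc y)
    {D : Fin d → Fin d → ℝ} (hD : ∀ i j, HasLineDerivAt ℝ sc (D i j) x (dirG i j))
    (hL : 1 / 4 * (∑ i, ∑ j, ∑ k, ∑ l, metric x i k * metric x j l * J.GG i j k l x) +
      (d + 1) / 4 * sc x - 1 / 8 * ∑ i, ∑ j, metric x i j * D i j = L)
    (hΓ : 1 / 4 * (∑ i, ∑ j, ∑ k, ∑ l, metric x i k * metric x j l *
        (J.G i j x * J.G k l x)) - 1 / 8 * sc x ^ 2 = Γ) :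
    box (fun y => (f y : ℂ) ^ (-s)) x =
      (f x : ℂ) ^ (-s - 2) * (-s * (f x * L) + s * (s + 1) * Γ) := by
  have h1 : scaleOp (fun y => (f y : ℂ) ^ (-s)) =ᶠ[nhds x]
      fun y => -s * (f y : ℂ) ^ (-s - 1) * sc y := by
    filter_upwards [isOpen_moduli.mem_nhds hx] with y hy
    rw [J.scaleOp_cpow hy, hsc y hy]
  have h2 : ∀ i j, dG i j (scaleOp fun y => (f y : ℂ) ^ (-s)) x =
      -s * ((-s - 1) * (f x : ℂ) ^ (-s - 2) * J.G i j x) * sc x +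
        -s * ((f x : ℂ) ^ (-s - 2) * f x) * D i j := by
    intro i j
    have e1 := hasLineDerivAt_cpow (J.pos x hx) (J.hasG x hx i j) (-s - 1)
    have e2 := hD i j
    have e3 : HasLineDerivAt ℝ (fun y => -s * (f y : ℂ) ^ (-s - 1) * sc y)
        (-s * ((-s - 1) * (f x : ℂ) ^ (-s - 2) * J.G i j x) * sc x +
        -s * ((f x : ℂ) ^ (-s - 2) * f x) * D i j) x (dirG i j) := by
      rw [HasLineDerivAt] at e1 e2 ⊢
      refine ((e1.const_mul (-s)).mul e2.ofReal_comp).congr_deriv ?_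
      simp only [zero_smul, add_zero]
      rw [J.cpow_sub_one hx, show -s - 1 - 1 = -s - 2 by ring]
    exact (e3.congr_of_eventuallyEq h1).lineDeriv
  have h3 : scaleOp (scaleOp fun y => (f y : ℂ) ^ (-s)) x =
      (f x : ℂ) ^ (-s - 2) * (s * (s + 1) * sc x ^ 2 -
        s * f x * (∑ i, ∑ j, metric x i j * D i j : ℝ)) := by
    rw [scaleOp]
    simp only [h2]
    have e4 : (sc x : ℂ) ^ 2 = (∑ i, ∑ j, (metric x i j : ℂ) * J.G i j x) * sc x := by
      rw [sq, ← hsc x hx]; push_cast; rfl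
    rw [e4]
    push_cast
    simp only [Finset.sum_mul, Finset.mul_sum, ← Finset.sum_sub_distrib]
    exact Finset.sum_congr rfl fun i _ => Finset.sum_congr rfl fun j _ => by ring
  rw [box, laplaceGL, h3, J.scaleOp_cpow hx, hsc x hx, J.cpow_sub_one hx, J.sum_dG_dG_cpow hx,
    ← hL, ← hΓ]
  simp only [Complex.ofReal_add, Complex.ofReal_mul, Complex.ofReal_sub]
  push_cast
  ring

end Jet

end TDuality

end

open scoped TensorProduct BigOperators
noncomputable section
namespace TDuality
variable {d : ℕ}

/-! ## The spinor mass -/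

/-- The derivatives of the spinor mass. -/
def spinJet {m : Fock d} (hm : m ≠ 0) : Jet (spinMass m) where
  pos x hx := normForm_pos hx (dressedSpinor_injective x hm)
  G := spinMassG m
  B := spinMassB m
  GG := spinMassGG m
  BB := spinMassBB m
  hasG _ hx i j := hasLineDerivAt_spinMass_dirG m hx i j
  hasB _ _ i j := hasLineDerivAt_spinMass_dirB m _ i j
  hasGG _ hx i j k l := hasLineDerivAt_spinMassG m hx i j k l
  hasBB _ _ i j k l := hasLineDerivAt_spinMassB m _ i j k l

lemma cpow_sub_two_mul_sq {a : ℝ} (ha : 0 < a) (s : ℂ) :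
    (a : ℂ) ^ (-s - 2) * a ^ 2 = (a : ℂ) ^ (-s) := by
  have hne : (a : ℂ) ≠ 0 := Complex.ofReal_ne_zero.2 ha.ne'
  rw [← Complex.cpow_natCast, ← Complex.cpow_add _ _ hne]
  congr 1; push_cast; ring

/-- The ⟨ψ,Nψ⟩ and ⟨ψ,N²ψ⟩ contributions cancel in Δ𝓜² = (d²/4) 𝓜² without purity. The gradient part
is (d/4) 𝓜⁴ precisely because of the first Fierz identity. The eigenvalue is -s d²/4 + s(s+1) d/4.
-/
theorem laplaceSO_spinMass_cpow {m : Fock d} (hm : m ≠ 0) (hp : IsPure m) {x : Background d}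
    (hx : x ∈ moduli d) (s : ℂ) :
    laplaceSO (fun y => (spinMass m y : ℂ) ^ (-s)) x =
      s * d * (s - d + 1) / 4 * (spinMass m x : ℂ) ^ (-s) := by
  rw [(spinJet hm).laplaceSO_cpow hx s (L := d ^ 2 / 4 * spinMass m x)
    (Γ := d / 4 * spinMass m x ^ 2)]
  · rw [← cpow_sub_two_mul_sq ((spinJet hm).pos x hx) s]
    push_cast; ring
  · simp only [spinJet]
    rw [sum_spinMassGG m hx, sum_spinMassBB, sum_metric_mul_spinMassG m hx]; ring
  · simp only [spinJet]
    rw [sum_spinMassG_mul m hx, sum_spinMassB_mul]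
    linear_combination hp.trace_currentMatrix_sq x

/-- The quartic insertion that obstructs the eigenvalue equation of `□_d`. -/
def insertion (m : Fock d) (x : Background d) : ℝ :=
  spinMass m x * (spinDegreeSq m x - d * spinDegree m x)

/-- With Q = ⟨ψ,N(N-d)ψ⟩ and k = d(2-d)/8, the linear part is k𝓜² - Q. By both Fierz identities the
gradient part is 𝓜²(k𝓜² - Q/2): the squares of ⟨ψ,Nψ⟩ cancel. Hence k has coefficient -s + s(s+1) =
s², and Q has coefficient s - s(s+1)/2 = s(1-s)/2. -/
theorem box_spinMass_cpow {m : Fock d} (hm : m ≠ 0) (hp : IsPure m) {x : Background d}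
    (hx : x ∈ moduli d) (s : ℂ) :
    box (fun y => (spinMass m y : ℂ) ^ (-s)) x =
      s ^ 2 * d * (2 - d) / 8 * (spinMass m x : ℂ) ^ (-s) +
        s * (1 - s) / 2 * (insertion m x * (spinMass m x : ℂ) ^ (-(s + 2))) := by
  obtain ⟨D, hD, hsum⟩ := exists_hasLineDerivAt_scale m hx
  rw [(spinJet hm).box_cpow hx s (L := -spinDegreeSq m x + d * spinDegree m x +
      (2 * d - d ^ 2) / 8 * spinMass m x)
    (Γ := spinMass m x * ((2 * d - d ^ 2) / 8 * spinMass m x - 1 / 2 * spinDegreeSq m x +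
      d / 2 * spinDegree m x)) (sc := fun y => 2 * spinDegree m y - d * spinMass m y)
      (fun y hy => sum_metric_mul_spinMassG m hy) hD]
  · rw [← cpow_sub_two_mul_sq ((spinJet hm).pos x hx) s, insertion, neg_add, ← sub_eq_add_neg]
    push_cast; ring
  · simp only [spinJet]
    rw [sum_spinMassGG m hx, hsum]; ring
  · simp only [spinJet]
    rw [sum_spinMassG_mul m hx]
    have h1 := hp.trace_currentMatrix_sq x
    have h2 := hp.two_mul_pairCurrent x
    linear_combination h1 - 1 / 2 * h2

/-! ## The vector mass -/

section Vector

variable (m : Fin d ⊕ Fin d → ℝ)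

/-- The dressed momentum with raised index. -/
def raisedMomentum (k : Fin d) (x : Background d) : ℝ :=
  ∑ l, (metric x)⁻¹ k l * dressedMomentum x m l

/-- `𝓜²` of a vector. -/
def vectorMass (x : Background d) : ℝ :=
  (∑ i, ∑ j, dressedMomentum x m i * (metric x)⁻¹ i j * dressedMomentum x m j)
      + ∑ i, ∑ j, m (Sum.inr i) * metric x i j * m (Sum.inr j)

lemma vectorMass_eq (x : Background d) : vectorMass m x =
    ∑ i, dressedMomentum x m i * raisedMomentum m i x +
      ∑ i, ∑ j, m (Sum.inr i) * metric x i j * m (Sum.inr j) := by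
  simp only [vectorMass, raisedMomentum, Finset.mul_sum, mul_assoc]

lemma dressedMomentum_add_dirG (x : Background d) (i j k : Fin d) (t : ℝ) :
    dressedMomentum (x + t • dirG i j) m k = dressedMomentum x m k := by
  unfold dressedMomentum; rw [bField_add_dirG]

lemma dressedMomentum_add_dirB (x : Background d) (i j k : Fin d) (t : ℝ) :
    dressedMomentum (x + t • dirB i j) m k = dressedMomentum x m k +
      t * ((if k = i then m (Sum.inr j) else 0) - if k = j then m (Sum.inr i) else 0) := by
  simp only [dressedMomentum, bField_add_dirB, unitDir_apply, add_mul, Finset.sum_add_distrib,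
    mul_sub, sub_mul, Finset.sum_sub_distrib]
  simp only [mul_ite, mul_one, mul_zero, ite_mul, zero_mul, Finset.sum_ite_eq', Finset.mem_univ,
    if_true]
  ring

lemma raisedMomentum_sum (x : Background d) (i : Fin d) :
    ∑ k, (metric x)⁻¹ k i * dressedMomentum x m k = raisedMomentum m i x :=
  Finset.sum_congr rfl fun k _ => by rw [inv_metric_symm]

lemma hasLineDerivAt_raisedMomentum_dirG {x : Background d} (hx : x ∈ moduli d) (i j k : Fin d) :
    HasLineDerivAt ℝ (raisedMomentum m k)
      (-((metric x)⁻¹ k i * raisedMomentum m j x + (metric x)⁻¹ k j * raisedMomentum m i x)) x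
      (dirG i j) := by
  have h := fun l => hasLineDerivAt_inv_metric hx i j k l
  simp only [HasLineDerivAt, raisedMomentum, dressedMomentum_add_dirG] at h ⊢
  refine (HasDerivAt.fun_sum (u := Finset.univ) fun l _ =>
    (h l).mul_const (dressedMomentum x m l)).congr_deriv ?_
  rw [Finset.mul_sum, Finset.mul_sum, ← Finset.sum_add_distrib, ← Finset.sum_neg_distrib]
  exact Finset.sum_congr rfl fun l _ => by ring

lemma hasDerivAt_dressedMomentum_dirB (x : Background d) (i j k : Fin d) :
    HasDerivAt (fun t : ℝ => dressedMomentum (x + t • dirB i j) m k)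
      ((if k = i then m (Sum.inr j) else 0) - if k = j then m (Sum.inr i) else 0) 0 := by
  simp only [dressedMomentum_add_dirB]
  simpa using ((hasDerivAt_id (0 : ℝ)).mul_const
    ((if k = i then m (Sum.inr j) else 0) - if k = j then m (Sum.inr i) else 0)).const_add
      (dressedMomentum x m k)

lemma hasLineDerivAt_raisedMomentum_dirB (x : Background d) (i j k : Fin d) :
    HasLineDerivAt ℝ (raisedMomentum m k)
      ((metric x)⁻¹ k i * m (Sum.inr j) - (metric x)⁻¹ k j * m (Sum.inr i)) x (dirB i j) := by
  simp only [HasLineDerivAt, raisedMomentum, metric_add_dirB]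
  refine (HasDerivAt.fun_sum (u := Finset.univ) fun l _ =>
    (hasDerivAt_dressedMomentum_dirB m x i j l).const_mul ((metric x)⁻¹ k l)).congr_deriv ?_
  simp [mul_sub]

/-- `∂𝓜²/∂g_{ij}`. -/
def vectorMassG (i j : Fin d) (x : Background d) : ℝ :=
  2 * (m (Sum.inr i) * m (Sum.inr j) - raisedMomentum m i x * raisedMomentum m j x)

/-- `∂𝓜²/∂B_{ij}`. -/
def vectorMassB (i j : Fin d) (x : Background d) : ℝ :=
  2 * (raisedMomentum m i x * m (Sum.inr j) - raisedMomentum m j x * m (Sum.inr i))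

/-- `∂²𝓜²/∂g_{ij}∂g_{kl}`. -/
def vectorMassGG (i j k l : Fin d) (x : Background d) : ℝ :=
  2 * (((metric x)⁻¹ k i * raisedMomentum m j x + (metric x)⁻¹ k j * raisedMomentum m i x) *
      raisedMomentum m l x +
    ((metric x)⁻¹ l i * raisedMomentum m j x + (metric x)⁻¹ l j * raisedMomentum m i x) *
      raisedMomentum m k x)

/-- `∂²𝓜²/∂B_{ij}∂B_{kl}`. -/
def vectorMassBB (i j k l : Fin d) (x : Background d) : ℝ :=
  2 * (((metric x)⁻¹ k i * m (Sum.inr j) - (metric x)⁻¹ k j * m (Sum.inr i)) * m (Sum.inr l) -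
    ((metric x)⁻¹ l i * m (Sum.inr j) - (metric x)⁻¹ l j * m (Sum.inr i)) * m (Sum.inr k))

lemma hasLineDerivAt_momentum_dirG {x : Background d} (hx : x ∈ moduli d) (i j : Fin d) :
    HasLineDerivAt ℝ (fun y => ∑ k, dressedMomentum y m k * raisedMomentum m k y)
      (-2 * (raisedMomentum m i x * raisedMomentum m j x)) x (dirG i j) := by
  have h := fun k => hasLineDerivAt_raisedMomentum_dirG m hx i j k
  simp only [HasLineDerivAt, dressedMomentum_add_dirG] at h ⊢
  refine (HasDerivAt.fun_sum (u := Finset.univ) fun k _ =>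
    (h k).const_mul (dressedMomentum x m k)).congr_deriv ?_
  have h1 := raisedMomentum_sum m x i
  have h2 := raisedMomentum_sum m x j
  have : -2 * (raisedMomentum m i x * raisedMomentum m j x) =
      -((∑ k, (metric x)⁻¹ k i * dressedMomentum x m k) * raisedMomentum m j x +
        (∑ k, (metric x)⁻¹ k j * dressedMomentum x m k) * raisedMomentum m i x) := by
    rw [h1, h2]; ring
  rw [this, Finset.sum_mul, Finset.sum_mul, ← Finset.sum_add_distrib, ← Finset.sum_neg_distrib]
  exact Finset.sum_congr rfl fun k _ => by ring

lemma hasLineDerivAt_winding_dirG (x : Background d) (i j : Fin d) :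
    HasLineDerivAt ℝ (fun y => ∑ k, ∑ l, m (Sum.inr k) * metric y k l * m (Sum.inr l))
      (2 * (m (Sum.inr i) * m (Sum.inr j))) x (dirG i j) := by
  simp only [HasLineDerivAt, metric_add_dirG]
  refine (HasDerivAt.fun_sum (u := Finset.univ) fun k _ =>
    HasDerivAt.fun_sum (u := Finset.univ) (A' := fun l => m (Sum.inr k) * symUnit i j k l *
      m (Sum.inr l)) fun l _ => ?_).congr_deriv ?_
  · refine HasDerivAt.mul_const (HasDerivAt.const_mul _ ?_) _
    simpa using ((hasDerivAt_id (0 : ℝ)).mul_const (symUnit i j k l)).const_add (metric x k l)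
  · have := sum_symUnit_mul i j fun k l => m (Sum.inr k) * m (Sum.inr l)
    rw [show 2 * (m (Sum.inr i) * m (Sum.inr j)) = m (Sum.inr i) * m (Sum.inr j) +
      m (Sum.inr j) * m (Sum.inr i) by ring, ← this]
    exact Finset.sum_congr rfl fun k _ => Finset.sum_congr rfl fun l _ => by ring

lemma hasLineDerivAt_vectorMass_dirG {x : Background d} (hx : x ∈ moduli d) (i j : Fin d) :
    HasLineDerivAt ℝ (vectorMass m) (vectorMassG m i j x) x (dirG i j) := by
  rw [funext (vectorMass_eq m)]
  refine HasDerivAt.congr_deriv (HasDerivAt.add (hasLineDerivAt_momentum_dirG m hx i j)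
    (hasLineDerivAt_winding_dirG m x i j)) ?_
  rw [vectorMassG]; ring

lemma hasLineDerivAt_vectorMass_dirB (x : Background d) (i j : Fin d) :
    HasLineDerivAt ℝ (vectorMass m) (vectorMassB m i j x) x (dirB i j) := by
  rw [funext (vectorMass_eq m)]
  have h := fun k => hasLineDerivAt_raisedMomentum_dirB m x i j k
  simp only [HasLineDerivAt] at h ⊢
  simp only [metric_add_dirB]
  refine ((HasDerivAt.fun_sum (u := Finset.univ) fun k _ =>
    (hasDerivAt_dressedMomentum_dirB m x i j k).mul (h k)).add_const _).congr_deriv ?_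
  have h1 := raisedMomentum_sum m x i
  have h2 := raisedMomentum_sum m x j
  simp only [zero_smul, add_zero, Finset.sum_add_distrib, sub_mul, mul_sub, ite_mul, zero_mul,
    Finset.sum_sub_distrib, Finset.sum_ite_eq', Finset.mem_univ, if_true]
  have e : ∀ (a b : Fin d), ∑ k, dressedMomentum x m k * ((metric x)⁻¹ k a * m (Sum.inr b)) =
      raisedMomentum m a x * m (Sum.inr b) := by
    intro a b
    rw [← raisedMomentum_sum, Finset.sum_mul]
    exact Finset.sum_congr rfl fun k _ => by ring
  rw [e, e, vectorMassB]; ring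

/-- The derivatives of the vector mass. -/
def vectorJet (hpos : ∀ x ∈ moduli d, 0 < vectorMass m x) : Jet (vectorMass m) where
  pos := hpos
  G := vectorMassG m
  B := vectorMassB m
  GG := vectorMassGG m
  BB := vectorMassBB m
  hasG x hx i j := hasLineDerivAt_vectorMass_dirG m hx i j
  hasB x _ i j := hasLineDerivAt_vectorMass_dirB m x i j
  hasGG x hx i j k l := by
    have h1 := hasLineDerivAt_raisedMomentum_dirG m hx i j k
    have h2 := hasLineDerivAt_raisedMomentum_dirG m hx i j l
    rw [HasLineDerivAt] at h1 h2 ⊢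
    refine (((h1.mul h2).const_sub (m (Sum.inr k) * m (Sum.inr l))).const_mul 2).congr_deriv ?_
    simp only [zero_smul, add_zero, vectorMassGG]
    ring
  hasBB x _ i j k l := by
    have h1 := hasLineDerivAt_raisedMomentum_dirB m x i j k
    have h2 := hasLineDerivAt_raisedMomentum_dirB m x i j l
    rw [HasLineDerivAt] at h1 h2 ⊢
    exact ((h1.mul_const (m (Sum.inr l))).sub (h2.mul_const (m (Sum.inr k)))).const_mul 2

end Vector

/-- The pairing of two vectors with the metric. -/
def metricPair (x : Background d) (α β : Fin d → ℝ) : ℝ := ∑ i, ∑ j, metric x i j * (α i * β j)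

lemma metricPair_symm (x : Background d) (α β : Fin d → ℝ) :
    metricPair x α β = metricPair x β α := by
  rw [metricPair, metricPair, Finset.sum_comm]
  exact Finset.sum_congr rfl fun i _ => Finset.sum_congr rfl fun j _ => by
    rw [metric_symm]; ring

lemma sum_metric_metric_prod (x : Background d) (α β γ δ : Fin d → ℝ) :
    ∑ i, ∑ j, ∑ k, ∑ l, metric x i k * metric x j l * ((α i * β j) * (γ k * δ l)) =
      metricPair x α γ * metricPair x β δ := by
  rw [metricPair, metricPair, Finset.sum_mul_sum]
  refine Finset.sum_congr rfl fun i _ => Finset.sum_congr rfl fun j _ => ?_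
  rw [Finset.sum_mul_sum]
  exact Finset.sum_congr rfl fun k _ => Finset.sum_congr rfl fun l _ => by ring

lemma sum_metric_metric_inv_first {x : Background d} (hx : x ∈ moduli d) (β δ : Fin d → ℝ) :
    ∑ i, ∑ j, ∑ k, ∑ l, metric x i k * metric x j l * ((metric x)⁻¹ k i * β j * δ l) =
      d * metricPair x β δ := by
  have h : ∀ i, ∑ j, ∑ k, ∑ l, metric x i k * metric x j l * ((metric x)⁻¹ k i * β j * δ l) =
      metricPair x β δ := by
    intro i
    refine Finset.sum_congr rfl fun j _ => ?_
    have e : ∀ k l, metric x i k * metric x j l * ((metric x)⁻¹ k i * β j * δ l) =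
      (metric x i k * (metric x)⁻¹ k i) * (metric x j l * (β j * δ l)) := fun k l => by ring
    simp only [e]
    rw [← Finset.sum_mul_sum, sum_metric_mul_inv hx, if_pos rfl, one_mul]
  simp [h]

lemma sum_metric_metric_inv_cross {x : Background d} (hx : x ∈ moduli d) (α δ : Fin d → ℝ) :
    ∑ i, ∑ j, ∑ k, ∑ l, metric x i k * metric x j l * ((metric x)⁻¹ k j * α i * δ l) =
      metricPair x α δ := by
  refine Finset.sum_congr rfl fun i _ => ?_
  have e : ∀ j k l, metric x i k * metric x j l * ((metric x)⁻¹ k j * α i * δ l) =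
      (metric x i k * (metric x)⁻¹ k j) * (metric x j l * (α i * δ l)) := fun j k l => by ring
  simp only [e, ← Finset.sum_mul_sum, sum_metric_mul_inv hx, ite_mul, one_mul, zero_mul,
    Finset.sum_ite_eq, Finset.mem_univ, if_true]

lemma sum_swap_both (x : Background d) (F : Fin d → Fin d → Fin d → Fin d → ℝ) :
    ∑ i, ∑ j, ∑ k, ∑ l, metric x i k * metric x j l * F i j k l =
      ∑ i, ∑ j, ∑ k, ∑ l, metric x i k * metric x j l * F j i l k := by
  rw [Finset.sum_comm]
  refine Finset.sum_congr rfl fun i _ => Finset.sum_congr rfl fun j _ => ?_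
  rw [Finset.sum_comm]
  exact Finset.sum_congr rfl fun k _ => Finset.sum_congr rfl fun l _ => by ring

/-! ### Metric contractions of the derivatives of the vector mass -/

section VectorSums

variable (m : Fin d ⊕ Fin d → ℝ) {x : Background d} (hx : x ∈ moduli d)

/-- The momentum part of `𝓜²`. -/
def momentumSq (x : Background d) : ℝ :=
  metricPair x (fun i => raisedMomentum m i x) (fun i => raisedMomentum m i x)

/-- The winding part of `𝓜²`. -/
def windingSq (x : Background d) : ℝ :=
  metricPair x (fun i => m (Sum.inr i)) (fun i => m (Sum.inr i))

include hx in
lemma sum_metric_mul_raisedMomentum (i : Fin d) :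
    ∑ k, metric x i k * raisedMomentum m k x = dressedMomentum x m i := by
  simp only [raisedMomentum, Finset.mul_sum]
  rw [Finset.sum_comm]
  simp only [← mul_assoc, ← Finset.sum_mul, sum_metric_mul_inv hx, ite_mul, one_mul, zero_mul,
    Finset.sum_ite_eq, Finset.mem_univ, if_true]

include hx in
lemma vectorMass_eq_add : vectorMass m x = momentumSq m x + windingSq m x := by
  rw [vectorMass_eq, momentumSq, windingSq]
  congr 1
  · rw [metricPair]
    refine Finset.sum_congr rfl fun i _ => ?_
    rw [← sum_metric_mul_raisedMomentum m hx, Finset.sum_mul]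
    exact Finset.sum_congr rfl fun k _ => by ring
  · exact Finset.sum_congr rfl fun i _ => Finset.sum_congr rfl fun j _ => by ring

include hx in
-- The pairing is m̃_i m^i, and the B-dependent part of m̃ drops out by antisymmetry. This is the
-- only use of the half-BPS constraint for vectors.
lemma metricPair_momentum_winding (hm : ∑ i, m (Sum.inl i) * m (Sum.inr i) = 0) :
    metricPair x (fun i => raisedMomentum m i x) (fun i => m (Sum.inr i)) = 0 := by
  rw [metricPair_symm, metricPair]
  have h1 : ∀ i, ∑ j, metric x i j * (m (Sum.inr i) * raisedMomentum m j x) =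
      m (Sum.inl i) * m (Sum.inr i) +
        ∑ j, bField x i j * (m (Sum.inr i) * m (Sum.inr j)) := by
    intro i
    have : ∑ j, metric x i j * (m (Sum.inr i) * raisedMomentum m j x) =
        m (Sum.inr i) * dressedMomentum x m i := by
      rw [← sum_metric_mul_raisedMomentum m hx, Finset.mul_sum]
      exact Finset.sum_congr rfl fun k _ => by ring
    rw [this, dressedMomentum, mul_add, Finset.mul_sum, mul_comm]
    congr 1
    exact Finset.sum_congr rfl fun k _ => by ring
  simp only [h1, Finset.sum_add_distrib]
  rw [hm, zero_add]
  refine self_eq_neg.1 ?_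
  conv_lhs => rw [Finset.sum_comm]
  simp only [← Finset.sum_neg_distrib]
  exact Finset.sum_congr rfl fun i _ => Finset.sum_congr rfl fun j _ => by
    rw [bField_antisymm x j i]; ring

lemma sum_metric_mul_vectorMassG (x : Background d) :
    ∑ i, ∑ j, metric x i j * vectorMassG m i j x = 2 * (windingSq m x - momentumSq m x) := by
  simp only [momentumSq, windingSq, metricPair, ← Finset.sum_sub_distrib, Finset.mul_sum]
  exact Finset.sum_congr rfl fun i _ => Finset.sum_congr rfl fun j _ => by
    rw [vectorMassG]; ring

include hx in
lemma sum_vectorMassGG :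
    ∑ i, ∑ j, ∑ k, ∑ l, metric x i k * metric x j l * vectorMassGG m i j k l x =
      (4 * d + 4) * momentumSq m x := by
  have h1 := sum_metric_metric_inv_first hx (fun i => raisedMomentum m i x)
    fun i => raisedMomentum m i x
  have h2 := sum_metric_metric_inv_cross hx (fun i => raisedMomentum m i x)
    fun i => raisedMomentum m i x
  have h3 := h1
  have h4 := h2
  rw [sum_swap_both] at h3 h4
  -- Of the four terms of `vectorMassGG`, an inverse metric joining k,i or l,j gives a factor d, and
  -- one joining k,j or l,i a factor one. The four terms on the right are listed in the order of
  -- that definition.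
  have : (4 * d + 4) * momentumSq m x = 2 * ((d * momentumSq m x + momentumSq m x) +
      (momentumSq m x + d * momentumSq m x)) := by ring
  rw [this, momentumSq]
  nth_rewrite 1 [← h1]
  nth_rewrite 1 [← h2]
  nth_rewrite 1 [← h4]
  rw [← h3]
  simp only [Finset.mul_sum, ← Finset.sum_add_distrib]
  refine Finset.sum_congr rfl fun i _ => Finset.sum_congr rfl fun j _ =>
    Finset.sum_congr rfl fun k _ => Finset.sum_congr rfl fun l _ => ?_
  rw [vectorMassGG]; ring

end VectorSums

end TDuality

end

open scoped TensorProduct BigOperators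
noncomputable section
namespace TDuality
variable {d : ℕ}

section VectorSums

variable (m : Fin d ⊕ Fin d → ℝ) {x : Background d} (hx : x ∈ moduli d)

include hx in
lemma sum_vectorMassBB :
    ∑ i, ∑ j, ∑ k, ∑ l, metric x i k * metric x j l * vectorMassBB m i j k l x =
      (4 * d - 4) * windingSq m x := by
  have h1 := sum_metric_metric_inv_first hx (fun i => m (Sum.inr i)) fun i => m (Sum.inr i)
  have h2 := sum_metric_metric_inv_cross hx (fun i => m (Sum.inr i)) fun i => m (Sum.inr i)
  have h3 := h1
  have h4 := h2
  rw [sum_swap_both] at h3 h4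
  have : (4 * d - 4) * windingSq m x = 2 * ((d * windingSq m x - windingSq m x) -
      (windingSq m x - d * windingSq m x)) := by ring
  rw [this, windingSq]
  nth_rewrite 1 [← h1]
  nth_rewrite 1 [← h2]
  nth_rewrite 1 [← h4]
  rw [← h3]
  simp only [Finset.mul_sum, ← Finset.sum_sub_distrib]
  refine Finset.sum_congr rfl fun i _ => Finset.sum_congr rfl fun j _ =>
    Finset.sum_congr rfl fun k _ => Finset.sum_congr rfl fun l _ => ?_
  rw [vectorMassBB]; ring

lemma sum_vectorMassG_mul
    (h : metricPair x (fun i => raisedMomentum m i x) (fun i => m (Sum.inr i)) = 0) :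
    ∑ i, ∑ j, ∑ k, ∑ l, metric x i k * metric x j l *
      (vectorMassG m i j x * vectorMassG m k l x) =
      4 * (windingSq m x ^ 2 + momentumSq m x ^ 2) := by
  let n : Fin d → ℝ := fun i => m (Sum.inr i)
  let u : Fin d → ℝ := fun i => raisedMomentum m i x
  have h1 := sum_metric_metric_prod x n n n n
  have h2 := sum_metric_metric_prod x n n u u
  have h3 := sum_metric_metric_prod x u u n n
  have h4 := sum_metric_metric_prod x u u u u
  have hun : metricPair x u n = 0 := h
  have hnu : metricPair x n u = 0 := (metricPair_symm x n u).trans h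
  have : 4 * (windingSq m x ^ 2 + momentumSq m x ^ 2) =
      4 * (metricPair x n n * metricPair x n n - metricPair x n u * metricPair x n u -
        metricPair x u n * metricPair x u n + metricPair x u u * metricPair x u u) := by
    rw [hun, hnu, windingSq, momentumSq]; ring
  rw [this, ← h1, ← h2, ← h3, ← h4]
  simp only [Finset.mul_sum, ← Finset.sum_sub_distrib, ← Finset.sum_add_distrib]
  refine Finset.sum_congr rfl fun i _ => Finset.sum_congr rfl fun j _ =>
    Finset.sum_congr rfl fun k _ => Finset.sum_congr rfl fun l _ => ?_
  simp only [vectorMassG, n, u]; ring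

lemma sum_vectorMassB_mul
    (h : metricPair x (fun i => raisedMomentum m i x) (fun i => m (Sum.inr i)) = 0) :
    ∑ i, ∑ j, ∑ k, ∑ l, metric x i k * metric x j l *
      (vectorMassB m i j x * vectorMassB m k l x) =
      8 * (windingSq m x * momentumSq m x) := by
  let n : Fin d → ℝ := fun i => m (Sum.inr i)
  let u : Fin d → ℝ := fun i => raisedMomentum m i x
  have h1 := sum_metric_metric_prod x u n u n
  have h2 := sum_metric_metric_prod x u n n u
  have h3 := sum_metric_metric_prod x n u u n
  have h4 := sum_metric_metric_prod x n u n u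
  have hun : metricPair x u n = 0 := h
  have hnu : metricPair x n u = 0 := (metricPair_symm x n u).trans h
  have : 8 * (windingSq m x * momentumSq m x) =
      4 * (metricPair x u u * metricPair x n n - metricPair x u n * metricPair x n u -
        metricPair x n u * metricPair x u n + metricPair x n n * metricPair x u u) := by
    rw [hun, hnu, windingSq, momentumSq]; ring
  rw [this, ← h1, ← h2, ← h3, ← h4]
  simp only [Finset.mul_sum, ← Finset.sum_sub_distrib, ← Finset.sum_add_distrib]
  refine Finset.sum_congr rfl fun i _ => Finset.sum_congr rfl fun j _ =>
    Finset.sum_congr rfl fun k _ => Finset.sum_congr rfl fun l _ => ?_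
  simp only [vectorMassB, n, u]; ring

end VectorSums

/-! ### Positivity and eigenvalue equations of the vector mass -/

lemma dressedMomentum_ne_zero {x : Background d} {m : Fin d ⊕ Fin d → ℝ} (hm : m ≠ 0)
    (hn : ∀ i, m (Sum.inr i) = 0) : dressedMomentum x m ≠ 0 := by
  intro h
  apply hm
  funext a
  rcases a with i | i
  · have := congrFun h i
    simpa [dressedMomentum, hn] using this
  · exact hn i

lemma vectorMass_pos {x : Background d} (hx : x ∈ moduli d) {m : Fin d ⊕ Fin d → ℝ}
    (hm : m ≠ 0) : 0 < vectorMass m x := by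
  have hx' : (metric x).PosDef := hx
  have e : ∀ (A : Matrix (Fin d) (Fin d) ℝ) (v : Fin d → ℝ),
      ∑ i, ∑ j, v i * A i j * v j = dotProduct (star v) (A.mulVec v) := by
    intro A v
    simp only [star_trivial, dotProduct, Matrix.mulVec, Finset.mul_sum, mul_assoc]
  rw [vectorMass, e _ (dressedMomentum x m), e _ fun i => m (Sum.inr i)]
  by_cases hn : (fun i => m (Sum.inr i)) = 0
  · have h1 := hx'.inv.dotProduct_mulVec_pos
      (dressedMomentum_ne_zero (x := x) hm fun i => congrFun hn i)
    have h2 := hx'.posSemidef.dotProduct_mulVec_nonneg fun i => m (Sum.inr i)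
    linarith
  · have h1 := hx'.inv.posSemidef.dotProduct_mulVec_nonneg (dressedMomentum x m)
    have h2 := hx'.dotProduct_mulVec_pos hn
    linarith

/-- With u and n the momentum and winding parts of 𝓜², orthogonality makes the g-gradient contribute
u² + n² and the B-gradient 2un, a perfect square. -/
theorem laplaceSO_vectorMass_cpow {m : Fin d ⊕ Fin d → ℝ} (hm : m ≠ 0)
    (hb : ∑ i, m (Sum.inl i) * m (Sum.inr i) = 0) {x : Background d} (hx : x ∈ moduli d) (s : ℂ) :
    laplaceSO (fun y => (vectorMass m y : ℂ) ^ (-s)) x =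
      s * (s - d + 1) * (vectorMass m x : ℂ) ^ (-s) := by
  have hpair := metricPair_momentum_winding m hx hb
  have hpos : ∀ y ∈ moduli d, 0 < vectorMass m y := fun y hy => vectorMass_pos hy hm
  rw [(vectorJet m hpos).laplaceSO_cpow hx s (L := d * vectorMass m x)
    (Γ := vectorMass m x ^ 2)]
  · rw [← cpow_sub_two_mul_sq (hpos x hx) s]
    push_cast; ring
  · simp only [vectorJet]
    rw [sum_vectorMassGG m hx, sum_vectorMassBB m hx, sum_metric_mul_vectorMassG,
      vectorMass_eq_add m hx]
    ring
  · simp only [vectorJet]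
    rw [sum_vectorMassG_mul m hpair, sum_vectorMassB_mul m hpair, vectorMass_eq_add m hx]
    ring

/-- There is no B-derivative here; the cross term of the square is supplied by the squared scaling
operator instead: u² + n² - (n - u)²/2 = (u + n)²/2. Linear and gradient parts are both half of
those of Δ. -/
theorem box_vectorMass_cpow {m : Fin d ⊕ Fin d → ℝ} (hm : m ≠ 0)
    (hb : ∑ i, m (Sum.inl i) * m (Sum.inr i) = 0) {x : Background d} (hx : x ∈ moduli d) (s : ℂ) :
    box (fun y => (vectorMass m y : ℂ) ^ (-s)) x =
      s * (s - d + 1) / 2 * (vectorMass m x : ℂ) ^ (-s) := by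
  have hpair := metricPair_momentum_winding m hx hb
  have hpos : ∀ y ∈ moduli d, 0 < vectorMass m y := fun y hy => vectorMass_pos hy hm
  let sc : Background d → ℝ := fun y =>
    2 * ((∑ k, ∑ l, m (Sum.inr k) * metric y k l * m (Sum.inr l)) -
      ∑ k, dressedMomentum y m k * raisedMomentum m k y)
  have hw : ∀ y : Background d, windingSq m y =
      ∑ k, ∑ l, m (Sum.inr k) * metric y k l * m (Sum.inr l) := by
    intro y
    rw [windingSq, metricPair]
    exact Finset.sum_congr rfl fun i _ => Finset.sum_congr rfl fun j _ => by ring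
  have hs : ∀ y ∈ moduli d, sc y = 2 * (windingSq m y - momentumSq m y) := by
    intro y hy
    have h1 := vectorMass_eq m y
    have h2 := vectorMass_eq_add m hy
    simp only [sc]
    rw [hw y] at h2 ⊢
    linarith
  have hsum : ∑ i, ∑ j, metric x i j * (2 * (2 * (m (Sum.inr i) * m (Sum.inr j)) -
      -2 * (raisedMomentum m i x * raisedMomentum m j x))) = 4 * vectorMass m x := by
    rw [vectorMass_eq_add m hx, momentumSq, windingSq, metricPair, metricPair]
    simp only [← Finset.sum_add_distrib, Finset.mul_sum]
    exact Finset.sum_congr rfl fun i _ => Finset.sum_congr rfl fun j _ => by ring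
  rw [(vectorJet m hpos).box_cpow hx s (L := d / 2 * vectorMass m x)
    (Γ := vectorMass m x ^ 2 / 2) (sc := sc)
    (fun y hy => (sum_metric_mul_vectorMassG m y).trans (hs y hy).symm)
    (fun i j => ((hasLineDerivAt_winding_dirG m x i j).sub
      (hasLineDerivAt_momentum_dirG m hx i j)).const_mul (2 : ℝ))]
  · rw [← cpow_sub_two_mul_sq (hpos x hx) s]
    push_cast; ring
  · simp only [vectorJet]
    rw [hsum, sum_vectorMassGG m hx, hs x hx, vectorMass_eq_add m hx]
    ring
  · simp only [vectorJet]
    rw [sum_vectorMassG_mul m hpair, hs x hx, vectorMass_eq_add m hx]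
    ring

end TDuality

end

open scoped TensorProduct BigOperators
noncomputable section
namespace TDuality
variable {d : ℕ}

/-! ## Termwise differentiation of lattice sums -/

section Series

variable {ι E : Type*} [NormedAddCommGroup E] [NormedSpace ℝ E]

/-- A function with a first derivative, which has a continuous derivative, is `C²`. -/
theorem contDiffOn_two_of_hasFDerivAt {F : Type*} [NormedAddCommGroup F] [NormedSpace ℝ F]
    {f : E → F} {f' : E → E →L[ℝ] F} {f'' : E → E →L[ℝ] E →L[ℝ] F} {S : Set E} (hS : IsOpen S)
    (h1 : ∀ x ∈ S, HasFDerivAt f (f' x) x) (h2 : ∀ x ∈ S, HasFDerivAt f' (f'' x) x)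
    (h3 : ContinuousOn f'' S) : ContDiffOn ℝ 2 f S := by
  have c0 : ContDiffOn ℝ 0 (fderiv ℝ f') S :=
    contDiffOn_zero.2 (h3.congr fun x hx => (h2 x hx).fderiv)
  have c1 : ContDiffOn ℝ (0 + 1) f' S := (contDiffOn_succ_iff_fderiv_of_isOpen hS).2
    ⟨fun x hx => (h2 x hx).differentiableAt.differentiableWithinAt, by simp, c0⟩
  rw [zero_add] at c1
  have c2 : ContDiffOn ℝ (1 + 1) f S := (contDiffOn_succ_iff_fderiv_of_isOpen hS).2
    ⟨fun x hx => (h1 x hx).differentiableAt.differentiableWithinAt, by simp,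
      c1.congr fun x hx => (h1 x hx).fderiv⟩
  rwa [one_add_one_eq_two] at c2

section

variable {F : Type*} [NormedAddCommGroup F] [NormedSpace ℝ F] [CompleteSpace F] {f : ι → E → F}
  {u : ι → ℝ} {S : Set E}

theorem hasFDerivAt_tsum_of_contDiffOn (hu : Summable u) (hS : IsOpen S) (hS' : IsPreconnected S)
    (hf : ∀ i, ContDiffOn ℝ 1 (f i) S) (h0 : ∀ i, ∀ x ∈ S, ‖f i x‖ ≤ u i)
    (h1 : ∀ i, ∀ x ∈ S, ‖fderiv ℝ (f i) x‖ ≤ u i) :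
    (∀ x ∈ S, HasFDerivAt (fun x => ∑' i, f i x) (∑' i, fderiv ℝ (f i) x) x) ∧
    (∀ x ∈ S, ∀ v, HasSum (fun i => fderiv ℝ (f i) x v) ((∑' i, fderiv ℝ (f i) x) v)) ∧
    ContinuousOn (fun x => ∑' i, fderiv ℝ (f i) x) S := by
  have S1 : ∀ x ∈ S, Summable fun i => fderiv ℝ (f i) x :=
    fun x hx => hu.of_norm_bounded fun i => h1 i x hx
  refine ⟨fun x hx => hasFDerivAt_tsum_of_isPreconnected hu hS hS' (fun i x hx =>
    (((hf i).differentiableOn (by norm_num)).differentiableAt (hS.mem_nhds hx)).hasFDerivAt) h1 hx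
      (hu.of_norm_bounded fun i => h0 i x hx) hx, fun x hx v => ?_,
    continuousOn_tsum (fun i => (hf i).continuousOn_fderiv_of_isOpen hS le_rfl) hu h1⟩
  exact (S1 x hx).hasSum.mapL (ContinuousLinearMap.apply ℝ F v)

/-- A series of `C²` functions whose derivatives up to the second order are dominated is `C²`, and
is differentiated term by term. -/
theorem contDiffOn_two_tsum (hu : Summable u)
    (hS : IsOpen S) (hS' : IsPreconnected S) (hf : ∀ i, ContDiffOn ℝ 2 (f i) S)
    (h0 : ∀ i, ∀ x ∈ S, ‖f i x‖ ≤ u i) (h1 : ∀ i, ∀ x ∈ S, ‖fderiv ℝ (f i) x‖ ≤ u i)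
    (h2 : ∀ i, ∀ x ∈ S, ‖fderiv ℝ (fderiv ℝ (f i)) x‖ ≤ u i) :
    ContDiffOn ℝ 2 (fun x => ∑' i, f i x) S ∧
    (∀ x ∈ S, ∀ v, HasSum (fun i => fderiv ℝ (f i) x v) (fderiv ℝ (fun x => ∑' i, f i x) x v)) ∧
    ∀ x ∈ S, ∀ v w, HasSum (fun i => fderiv ℝ (fderiv ℝ (f i)) x v w)
      (fderiv ℝ (fderiv ℝ (fun x => ∑' i, f i x)) x v w) := by
  have c1 : ∀ i, ContDiffOn ℝ 1 (fderiv ℝ (f i)) S := fun i =>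
    (hf i).fderiv_of_isOpen hS (by norm_num)
  obtain ⟨D0, H0, -⟩ := hasFDerivAt_tsum_of_contDiffOn hu hS hS'
    (fun i => (hf i).of_le (by norm_num)) h0 h1
  obtain ⟨D1, H1, C1⟩ := hasFDerivAt_tsum_of_contDiffOn hu hS hS' c1 h1 h2
  refine ⟨contDiffOn_two_of_hasFDerivAt hS D0 D1 C1, fun x hx v => ?_, fun x hx v w => ?_⟩
  · rw [(D0 x hx).fderiv]
    exact H0 x hx v
  · have E2 : fderiv ℝ (fderiv ℝ (fun x => ∑' i, f i x)) x =
        fderiv ℝ (fun x => ∑' i, fderiv ℝ (f i) x) x := by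
      refine Filter.EventuallyEq.fderiv_eq ?_
      filter_upwards [hS.mem_nhds hx] with y hy using (D0 y hy).fderiv
    rw [E2, (D1 x hx).fderiv]
    exact (H1 x hx v).mapL (ContinuousLinearMap.apply ℝ F w)

end

/-- The partial derivative in the first variable of a `C^{n+1}` function is `C^n`. -/
theorem contDiffOn_fderiv_fst {V F : Type*} [NormedAddCommGroup V] [NormedSpace ℝ V]
    [NormedAddCommGroup F] [NormedSpace ℝ F] {f : E × V → F} {S : Set (E × V)} (hS : IsOpen S)
    {n m : WithTop ℕ∞} (hf : ContDiffOn ℝ n f S) (hmn : m + 1 ≤ n) :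
    ContDiffOn ℝ m (fun p : E × V => fderiv ℝ (fun y => f (y, p.2)) p.1) S := by
  have h1 : ContDiffOn ℝ m (fun p => (fderiv ℝ f p).comp (ContinuousLinearMap.inl ℝ E V)) S :=
    (hf.fderiv_of_isOpen hS hmn).clm_comp contDiffOn_const
  refine h1.congr fun p hp => ?_
  have hd : HasFDerivAt f (fderiv ℝ f p) (p.1, p.2) :=
    ((hf.differentiableOn (by
      rintro rfl; simp at hmn)).differentiableAt (hS.mem_nhds hp)).hasFDerivAt
  exact (hd.comp p.1 (hasFDerivAt_prodMk_left p.1 p.2)).fderiv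

section Product

variable {V F : Type*} [NormedAddCommGroup V] [NormedSpace ℝ V] [NormedAddCommGroup F]
  [NormedSpace ℝ F] {P : E × V → F} {S : Set (E × V)} {B : Set E} {K : Set V}

/-- The derivatives of a `C²` function in the first variable are bounded on compact sets. -/
theorem exists_bound_fderiv_fst (hS : IsOpen S) (hP : ContDiffOn ℝ 2 P S) (hB : IsCompact B)
    (hK : IsCompact K) (hBK : B ×ˢ K ⊆ S) : ∃ C, ∀ x ∈ B, ∀ v ∈ K,
      ‖P (x, v)‖ ≤ C ∧ ‖fderiv ℝ (fun y => P (y, v)) x‖ ≤ C ∧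
      ‖fderiv ℝ (fderiv ℝ (fun y => P (y, v))) x‖ ≤ C := by
  have c1 := contDiffOn_fderiv_fst (m := 1) hS hP (by norm_num)
  have c2 := contDiffOn_fderiv_fst (m := 0) hS c1 (by norm_num)
  obtain ⟨C0, hC0⟩ := (hB.prod hK).exists_bound_of_continuousOn (hP.continuousOn.mono hBK)
  obtain ⟨C1, hC1⟩ := (hB.prod hK).exists_bound_of_continuousOn (c1.continuousOn.mono hBK)
  obtain ⟨C2, hC2⟩ := (hB.prod hK).exists_bound_of_continuousOn
    (E := E →L[ℝ] E →L[ℝ] F) (c2.continuousOn.mono hBK)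
  exact ⟨max C0 (max C1 C2), fun x hx v hv => ⟨(hC0 (x, v) ⟨hx, hv⟩).trans (le_max_left _ _),
    (hC1 (x, v) ⟨hx, hv⟩).trans ((le_max_left _ _).trans (le_max_right _ _)),
    (hC2 (x, v) ⟨hx, hv⟩).trans ((le_max_right _ _).trans (le_max_right _ _))⟩⟩

variable [NormedSpace ℂ F] [SMulCommClass ℝ ℂ F]

theorem fderiv_congr_const_smul {O : Set E} (hO : IsOpen O) {f g : E → F} {c : ℂ}
    (h : ∀ x ∈ O, f x = c • g x) (hg : DifferentiableOn ℝ g O) :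
    ∀ x ∈ O, fderiv ℝ f x = c • fderiv ℝ g x ∧ ‖fderiv ℝ f x‖ = ‖c‖ * ‖fderiv ℝ g x‖ := by
  intro x hx
  have e : fderiv ℝ f x = c • fderiv ℝ g x := by
    rw [← fderiv_const_smul (hg.differentiableAt (hO.mem_nhds hx))]
    refine Filter.EventuallyEq.fderiv_eq ?_
    filter_upwards [hO.mem_nhds hx] with y hy using h y hy
  exact ⟨e, by rw [e, norm_smul]⟩

/-- All summands are slices of one C² function P, at parameters in a compact set. Its derivatives
are uniformly bounded there, so summability of the coefficients alone dominates the series and its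
derivatives up to second order. -/
theorem contDiffOn_two_tsum_smul [CompleteSpace F] (hS : IsOpen S) (hP : ContDiffOn ℝ 2 P S)
    (hB : IsCompact B) (hK : IsCompact K) (hBK : B ×ˢ K ⊆ S) {O : Set E} (hO : IsOpen O)
    (hO' : IsPreconnected O) (hOB : O ⊆ B) {c : ι → ℂ} (hc : Summable fun i => ‖c i‖) {v : ι → V}
    (hv : ∀ i, v i ∈ K) {f : ι → E → F} (hf : ∀ i, ∀ x ∈ O, f i x = c i • P (x, v i)) :
    ContDiffOn ℝ 2 (fun x => ∑' i, f i x) O ∧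
    (∀ x ∈ O, ∀ v, HasSum (fun i => fderiv ℝ (f i) x v) (fderiv ℝ (fun x => ∑' i, f i x) x v)) ∧
    ∀ x ∈ O, ∀ v w, HasSum (fun i => fderiv ℝ (fderiv ℝ (f i)) x v w)
      (fderiv ℝ (fderiv ℝ (fun x => ∑' i, f i x)) x v w) := by
  obtain ⟨C, hC⟩ := exists_bound_fderiv_fst hS hP hB hK hBK
  have slice : ∀ i, ContDiffOn ℝ 2 (fun y => P (y, v i)) O := fun i =>
    hP.comp (f := fun y => (y, v i)) (by fun_prop) fun y hy => hBK ⟨hOB hy, hv i⟩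
  have e1 := fun i =>
    fderiv_congr_const_smul hO (hf i) ((slice i).differentiableOn (by norm_num))
  have e2 := fun i =>
    fderiv_congr_const_smul hO (fun x hx => (e1 i x hx).1) (((slice i).fderiv_of_isOpen hO (m := 1)
      (by norm_num)).differentiableOn (by norm_num))
  refine contDiffOn_two_tsum (hc.mul_right C) hO hO' (fun i => ?_) (fun i x hx => ?_)
    (fun i x hx => ?_) fun i x hx => ?_
  · exact ((slice i).const_smul (c i)).congr (hf i)
  · rw [hf i x hx, norm_smul]
    exact mul_le_mul_of_nonneg_left (hC x (hOB hx) _ (hv i)).1 (norm_nonneg _)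
  · exact (e1 i x hx).2.trans_le
      (mul_le_mul_of_nonneg_left (hC x (hOB hx) _ (hv i)).2.1 (norm_nonneg _))
  · exact (e2 i x hx).2.trans_le
      (mul_le_mul_of_nonneg_left (hC x (hOB hx) _ (hv i)).2.2 (norm_nonneg _))

end Product

end Series

/-- A mass formula that is quadratic in the charge, positive and twice continuously
differentiable. -/
structure ChargeSystem.Regular (R : ChargeSystem d) : Prop where
  smul : ∀ x (c : ℝ) v, R.massSq x (c • v) = c ^ 2 * R.massSq x v
  pos : ∀ x ∈ moduli d, ∀ v, v ≠ 0 → 0 < R.massSq x v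
  contDiffOn : ContDiffOn ℝ 2 (fun p : Background d × (R.Index → ℝ) => R.massSq p.1 p.2)
    (moduli d ×ˢ Set.univ)
  ne_zero : ∀ m ∈ R.charges, m ≠ 0

/-- The real vector of an integer charge. -/
def realCharge {ι : Type*} (m : ι → ℤ) : ι → ℝ := fun a => (m a : ℝ)

lemma realCharge_ne_zero {ι : Type*} {m : ι → ℤ} (hm : m ≠ 0) : realCharge m ≠ 0 := by
  intro h
  apply hm
  funext a
  simpa [realCharge] using congrFun h a

theorem summable_norm_realCharge_rpow {ι : Type*} [Fintype ι] {r : ℝ}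
    (hr : r < -(Fintype.card ι : ℝ)) : Summable fun m : ι → ℤ => ‖realCharge m‖ ^ r := by
  classical
  let b := Pi.basisFun ℝ ι
  have hrank : Module.finrank ℤ (Submodule.span ℤ (Set.range b)) = Fintype.card ι :=
    Module.finrank_eq_card_basis (b.restrictScalars ℤ)
  have h := ZLattice.summable_norm_rpow (L := Submodule.span ℤ (Set.range b)) r (by rwa [hrank])
  have hmem : ∀ m : ι → ℤ, realCharge m ∈ Submodule.span ℤ (Set.range b) := by
    intro m
    rw [Module.Basis.mem_span_iff_repr_mem ℤ b]
    intro i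
    exact ⟨m i, by simp [b, realCharge]⟩
  refine h.comp_injective (i := fun m => (⟨realCharge m, hmem m⟩ : Submodule.span ℤ (Set.range b)))
    fun m n hmn => ?_
  funext a
  have := congrFun (congrArg Subtype.val hmn) a
  simpa [realCharge] using this

/-! ### Length and direction of a charge -/

namespace ChargeSystem

variable {R : ChargeSystem d}

/-- The set of moduli and nonzero real charges. -/
def domain (R : ChargeSystem d) : Set (Background d × (R.Index → ℝ)) := moduli d ×ˢ {0}ᶜ

lemma isOpen_domain : IsOpen R.domain := isOpen_moduli.prod isOpen_compl_singleton

/-- `[𝓜²]^{-s}` as a function of the moduli and of a real charge. -/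
def power (R : ChargeSystem d) (s : ℂ) (p : Background d × (R.Index → ℝ)) : ℂ :=
  (R.massSq p.1 p.2 : ℂ) ^ (-s)

lemma term_eq_power (s : ℂ) (m : R.Index → ℤ) (x : Background d) :
    R.term s m x = R.power s (x, realCharge m) := rfl

namespace Regular

lemma pos_domain (h : R.Regular) {p : Background d × (R.Index → ℝ)} (hp : p ∈ R.domain) :
    0 < R.massSq p.1 p.2 := h.pos _ hp.1 _ hp.2

lemma contDiffOn_power (h : R.Regular) (s : ℂ) : ContDiffOn ℝ 2 (R.power s) R.domain := by
  have h1 : ContDiffOn ℝ 2 (fun p : Background d × (R.Index → ℝ) => R.massSq p.1 p.2) R.domain :=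
    h.contDiffOn.mono fun p hp => ⟨hp.1, trivial⟩
  have h2 : ContDiffOn ℝ 2 (fun p : Background d × (R.Index → ℝ) =>
      Complex.exp ((Real.log (R.massSq p.1 p.2) : ℂ) * (-s))) R.domain := by
    refine ContDiffOn.cexp (ContDiffOn.mul ?_ contDiffOn_const)
    exact Complex.ofRealCLM.contDiff.comp_contDiffOn (h1.log fun p hp => (h.pos_domain hp).ne')
  refine h2.congr fun p hp => ?_
  have hpos := h.pos_domain hp
  rw [power, Complex.cpow_def_of_ne_zero (Complex.ofReal_ne_zero.2 hpos.ne'),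
    Complex.ofReal_log hpos.le]

lemma norm_term (h : R.Regular) {x : Background d} (hx : x ∈ moduli d) {m : R.Index → ℤ}
    (hm : m ≠ 0) (s : ℂ) : ‖R.term s m x‖ = R.mass x m ^ (-s.re) := by
  have hp : 0 < R.mass x m := h.pos x hx _ (realCharge_ne_zero hm)
  rw [term, Complex.norm_cpow_eq_rpow_re_of_pos hp, Complex.neg_re]

/-- The radial part of a term. -/
def radial (s : ℂ) {ι : Type*} [Fintype ι] (m : ι → ℤ) : ℂ := ((‖realCharge m‖ ^ 2 : ℝ) : ℂ) ^ (-s)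

/-- The angular part of a charge. -/
def angular {ι : Type*} [Fintype ι] (m : ι → ℤ) : ι → ℝ := ‖realCharge m‖⁻¹ • realCharge m

lemma angular_mem_sphere {ι : Type*} [Fintype ι] {m : ι → ℤ} (hm : m ≠ 0) :
    angular m ∈ Metric.sphere (0 : ι → ℝ) 1 := by
  have : ‖realCharge m‖ ≠ 0 := norm_ne_zero_iff.2 (realCharge_ne_zero hm)
  simp [angular, norm_smul, this]

lemma mass_eq (h : R.Regular) (x : Background d) {m : R.Index → ℤ} (hm : m ≠ 0) :
    R.massSq x (realCharge m) = ‖realCharge m‖ ^ 2 * R.massSq x (angular m) := by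
  rw [← h.smul, angular, smul_smul,
    mul_inv_cancel₀ (norm_ne_zero_iff.2 (realCharge_ne_zero hm)), one_smul]

lemma mem_domain_of_sphere {x : Background d} (hx : x ∈ moduli d) {v : R.Index → ℝ}
    (hv : v ∈ Metric.sphere (0 : R.Index → ℝ) 1) : (x, v) ∈ R.domain := by
  refine ⟨hx, ?_⟩
  rintro rfl
  simp at hv

/-- Separates a coefficient independent of the moduli from a function of the moduli and of a
direction in the compact sphere, the form required by `contDiffOn_two_tsum_smul`. -/
lemma term_eq (h : R.Regular) {x : Background d} (hx : x ∈ moduli d) {m : R.Index → ℤ}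
    (hm : m ≠ 0) (s : ℂ) : R.term s m x = radial s m * R.power s (x, angular m) := by
  have h1 : 0 < R.massSq x (angular m) :=
    h.pos_domain (mem_domain_of_sphere hx (angular_mem_sphere hm))
  rw [term_eq_power, power, power, h.mass_eq x hm, Complex.ofReal_mul,
    Complex.mul_cpow_ofReal_nonneg (by positivity) h1.le, radial]

/-- The series converges absolutely for large `Re s`. -/
theorem convergesAt_of_mem_halfPlane (h : R.Regular) {s : ℂ} (hs : s ∈ R.halfPlane) :
    R.ConvergesAt s := by
  intro x hx
  have hcont : ContinuousOn (fun v => R.massSq x v) (Metric.sphere (0 : R.Index → ℝ) 1) :=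
    h.contDiffOn.continuousOn.comp (f := fun v : R.Index → ℝ => (x, v))
      (by fun_prop) fun v _ => ⟨hx, trivial⟩
  obtain ⟨c, hc, hle⟩ := (isCompact_sphere (0 : R.Index → ℝ) 1).exists_forall_le' hcont (a := 0)
    fun v hv => h.pos_domain (mem_domain_of_sphere hx hv)
  have hs' : (Fintype.card R.Index : ℝ) / 2 < s.re := hs
  have hs0 : 0 ≤ s.re := le_trans (by positivity) hs'.le
  have hsum : Summable fun m : R.charges =>
      c ^ (-s.re) * ‖realCharge (m : R.Index → ℤ)‖ ^ (-(2 * s.re)) :=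
    ((summable_norm_realCharge_rpow (by linarith)).comp_injective
      Subtype.val_injective).mul_left _
  refine hsum.of_nonneg_of_le (fun _ => norm_nonneg _) fun m => ?_
  have hm := h.ne_zero _ m.2
  have hn : 0 < ‖realCharge (m : R.Index → ℤ)‖ := norm_pos_iff.2 (realCharge_ne_zero hm)
  rw [h.norm_term hx hm]
  have e : R.mass x m = ‖realCharge (m : R.Index → ℤ)‖ ^ 2 * R.massSq x (angular m) :=
    h.mass_eq x hm
  have hang := hle _ (angular_mem_sphere hm)
  rw [e, Real.mul_rpow (by positivity) (hc.le.trans hang), mul_comm, ← Real.rpow_natCast,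
    ← Real.rpow_mul hn.le]
  have e2 : ((2 : ℕ) : ℝ) * -s.re = -(2 * s.re) := by push_cast; ring
  rw [e2]
  refine mul_le_mul_of_nonneg_right ?_ (by positivity)
  exact Real.rpow_le_rpow_of_nonpos hc hang (by linarith)

/-- The angular factor is bounded below on the sphere, so convergence at one point already gives the
moduli-independent summability needed near every point. -/
lemma summable_radial (h : R.Regular) {s : ℂ} (hs : R.ConvergesAt s) {x : Background d}
    (hx : x ∈ moduli d) : Summable fun m : R.charges => ‖radial s (m : R.Index → ℤ)‖ := by
  have hcont : ContinuousOn (fun v => ‖R.power s (x, v)‖) (Metric.sphere (0 : R.Index → ℝ) 1) :=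
    ((h.contDiffOn_power s).continuousOn.comp (f := fun v : R.Index → ℝ => (x, v))
      (by fun_prop) fun v hv => mem_domain_of_sphere hx hv).norm
  obtain ⟨c, hc, hle⟩ := (isCompact_sphere (0 : R.Index → ℝ) 1).exists_forall_le' hcont (a := 0)
    fun v hv => by
      have := h.pos_domain (mem_domain_of_sphere hx hv)
      rw [power, Complex.norm_cpow_eq_rpow_re_of_pos this]
      exact Real.rpow_pos_of_pos this _
  refine ((hs x hx).mul_left c⁻¹).of_nonneg_of_le (fun _ => norm_nonneg _) fun m => ?_
  have hm := h.ne_zero _ m.2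
  rw [h.term_eq hx hm, norm_mul, ← mul_assoc, mul_comm c⁻¹, mul_assoc]
  have := hle _ (angular_mem_sphere hm)
  refine le_mul_of_one_le_right (norm_nonneg _) ?_
  rw [← inv_mul_cancel₀ hc.ne']
  exact mul_le_mul_of_nonneg_left this (inv_pos.2 hc).le

/-- Near each point of the moduli space, a convergent series is `C²` and is differentiated term by
term. -/
theorem local_series (h : R.Regular) {s : ℂ} (hs : R.ConvergesAt s) {x₀ : Background d}
    (hx₀ : x₀ ∈ moduli d) : ∃ r > 0, ContDiffOn ℝ 2 (R.series s) (Metric.ball x₀ r) ∧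
    (∀ x ∈ Metric.ball x₀ r, ∀ v,
      HasSum (fun m : R.charges => fderiv ℝ (R.term s m) x v) (fderiv ℝ (R.series s) x v)) ∧
    ∀ x ∈ Metric.ball x₀ r, ∀ v w,
      HasSum (fun m : R.charges => fderiv ℝ (fderiv ℝ (R.term s m)) x v w)
        (fderiv ℝ (fderiv ℝ (R.series s)) x v w) := by
  obtain ⟨r, hr, hball⟩ := Metric.nhds_basis_closedBall.mem_iff.1 (isOpen_moduli.mem_nhds hx₀)
  have hsub : Metric.ball x₀ r ⊆ moduli d := Metric.ball_subset_closedBall.trans hball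
  refine ⟨r, hr, contDiffOn_two_tsum_smul isOpen_domain (h.contDiffOn_power s)
    (isCompact_closedBall x₀ r) (isCompact_sphere (0 : R.Index → ℝ) 1)
    (fun p hp => mem_domain_of_sphere (hball hp.1) hp.2) Metric.isOpen_ball
    (convex_ball x₀ r).isPreconnected Metric.ball_subset_closedBall
    (h.summable_radial hs hx₀) (fun m => angular_mem_sphere (h.ne_zero _ m.2)) fun m x hx => ?_⟩
  exact h.term_eq (hsub hx) (h.ne_zero _ m.2) s

theorem contDiffOn_series (h : R.Regular) {s : ℂ} (hs : R.ConvergesAt s) :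
    ContDiffOn ℝ 2 (R.series s) (moduli d) := by
  intro x hx
  obtain ⟨r, hr, h1, -, -⟩ := h.local_series hs hx
  exact (h1.contDiffAt (Metric.ball_mem_nhds x hr)).contDiffWithinAt

theorem contDiffOn_term (h : R.Regular) (s : ℂ) {m : R.Index → ℤ} (hm : m ≠ 0) :
    ContDiffOn ℝ 2 (R.term s m) (moduli d) :=
  (h.contDiffOn_power s).comp (f := fun y => (y, realCharge m)) (by fun_prop)
    fun _ hy => ⟨hy, realCharge_ne_zero hm⟩

end Regular

end ChargeSystem

end TDuality

end

open scoped TensorProduct BigOperators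
noncomputable section
namespace TDuality
variable {d : ℕ}

/-! ## The operators on `C²` functions -/

/-- A second order expression in the first derivatives `A` and the second derivatives `H`. -/
def secondOrder (α β γ δ : ℂ) (x : Background d) (A : Background d → ℂ)
    (H : Background d → Background d → ℂ) : ℂ :=
  (∑ i, ∑ j, ∑ k, ∑ l, (metric x i k : ℂ) * (metric x j l : ℂ) *
      (α * H (dirG i j) (dirG k l) + β * H (dirB i j) (dirB k l))) +
    γ * (∑ i, ∑ j, (metric x i j : ℂ) * A (dirG i j)) +
    δ * (∑ i, ∑ j, ∑ k, ∑ l, (metric x i j : ℂ) * (metric x k l : ℂ) *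
      H (dirG i j) (dirG k l))

/-- An operator of the form `secondOrder`. -/
def IsSecondOrder (D : (Background d → ℂ) → Background d → ℂ) : Prop :=
  ∃ α β γ δ : ℂ, ∀ F : Background d → ℂ, ∀ x, ContDiffAt ℝ 2 F x →
    D F x = secondOrder α β γ δ x (fderiv ℝ F x) fun v w => fderiv ℝ (fderiv ℝ F) x v w

lemma hasSum_secondOrder {ι : Type*} (α β γ δ : ℂ) (x : Background d) {A : ι → Background d → ℂ}
    {H : ι → Background d → Background d → ℂ} {A₀ : Background d → ℂ}
    {H₀ : Background d → Background d → ℂ} (hA : ∀ v, HasSum (fun i => A i v) (A₀ v))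
    (hH : ∀ v w, HasSum (fun i => H i v w) (H₀ v w)) :
    HasSum (fun i => secondOrder α β γ δ x (A i) (H i)) (secondOrder α β γ δ x A₀ H₀) := by
  refine HasSum.add (HasSum.add ?_ (HasSum.mul_left _ ?_)) (HasSum.mul_left _ ?_)
  · exact hasSum_sum fun i _ => hasSum_sum fun j _ => hasSum_sum fun k _ => hasSum_sum fun l _ =>
      (((hH _ _).mul_left α).add ((hH _ _).mul_left β)).mul_left _
  · exact hasSum_sum fun i _ => hasSum_sum fun j _ => (hA _).mul_left _
  · exact hasSum_sum fun i _ => hasSum_sum fun j _ => hasSum_sum fun k _ => hasSum_sum fun l _ =>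
      (hH _ _).mul_left _

lemma differentiableOn_secondOrder {U : Set ℂ} (α β γ δ : ℂ) (x : Background d)
    {A : ℂ → Background d → ℂ} {H : ℂ → Background d → Background d → ℂ}
    (hA : ∀ v, DifferentiableOn ℂ (fun s => A s v) U)
    (hH : ∀ v w, DifferentiableOn ℂ (fun s => H s v w) U) :
    DifferentiableOn ℂ (fun s => secondOrder α β γ δ x (A s) (H s)) U := by
  unfold secondOrder
  refine DifferentiableOn.add (DifferentiableOn.add ?_ (DifferentiableOn.const_mul ?_ _))
    (DifferentiableOn.const_mul ?_ _)
  · exact DifferentiableOn.fun_sum fun i _ => DifferentiableOn.fun_sum fun j _ =>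
      DifferentiableOn.fun_sum fun k _ => DifferentiableOn.fun_sum fun l _ =>
      (((hH _ _).const_mul α).add ((hH _ _).const_mul β)).const_mul _
  · exact DifferentiableOn.fun_sum fun i _ => DifferentiableOn.fun_sum fun j _ => (hA _).const_mul _
  · exact DifferentiableOn.fun_sum fun i _ => DifferentiableOn.fun_sum fun j _ =>
      DifferentiableOn.fun_sum fun k _ => DifferentiableOn.fun_sum fun l _ => (hH _ _).const_mul _

section ContDiffAt

variable {F : Background d → ℂ} {x : Background d}

lemma lineDeriv_eq_of_contDiffAt (hF : ContDiffAt ℝ 2 F x) (v : Background d) :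
    lineDeriv ℝ F x v = fderiv ℝ F x v :=
  (hF.differentiableAt (by norm_num)).lineDeriv_eq_fderiv

lemma eventually_lineDeriv_eq (hF : ContDiffAt ℝ 2 F x) (v : Background d) :
    (fun y => lineDeriv ℝ F y v) =ᶠ[nhds x] fun y => fderiv ℝ F y v := by
  filter_upwards [hF.eventually (by norm_num)] with y hy using lineDeriv_eq_of_contDiffAt hy v

lemma hasLineDerivAt_lineDeriv (hF : ContDiffAt ℝ 2 F x) (v w : Background d) :
    HasLineDerivAt ℝ (fun y => lineDeriv ℝ F y w) (fderiv ℝ (fderiv ℝ F) x v w) x v := by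
  have h1 : HasFDerivAt (fderiv ℝ F) (fderiv ℝ (fderiv ℝ F) x) x :=
    ((hF.fderiv_right (m := 1) (by norm_num)).differentiableAt (by norm_num)).hasFDerivAt
  have h2 : HasFDerivAt (fun y => fderiv ℝ F y w)
      ((ContinuousLinearMap.apply ℝ ℂ w).comp (fderiv ℝ (fderiv ℝ F) x)) x :=
    (ContinuousLinearMap.apply ℝ ℂ w).hasFDerivAt.comp x h1
  exact (h2.hasLineDerivAt v).congr_of_eventuallyEq (eventually_lineDeriv_eq hF w)

lemma dG_eq (hF : ContDiffAt ℝ 2 F x) (i j : Fin d) : dG i j F x = fderiv ℝ F x (dirG i j) :=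
  lineDeriv_eq_of_contDiffAt hF _

lemma dG_dG_eq (hF : ContDiffAt ℝ 2 F x) (i j k l : Fin d) :
    dG i j (dG k l F) x = fderiv ℝ (fderiv ℝ F) x (dirG i j) (dirG k l) :=
  (hasLineDerivAt_lineDeriv hF _ _).lineDeriv

lemma dB_dB_eq (hF : ContDiffAt ℝ 2 F x) (i j k l : Fin d) :
    dB i j (dB k l F) x = fderiv ℝ (fderiv ℝ F) x (dirB i j) (dirB k l) :=
  (hasLineDerivAt_lineDeriv hF _ _).lineDeriv

lemma dG_symm (F : Background d → ℂ) (i j : Fin d) : dG i j F = dG j i F := by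
  funext x; rw [dG, dG, add_comm]

/-- The first order term comes from differentiating the coefficients g_kl: the symmetric direction
hits both orders of the indices, whence the factor two. -/
lemma dG_scaleOp (hF : ContDiffAt ℝ 2 F x) (i j : Fin d) :
    dG i j (scaleOp F) x = 2 * dG i j F x +
      ∑ k, ∑ l, (metric x k l : ℂ) * fderiv ℝ (fderiv ℝ F) x (dirG i j) (dirG k l) := by
  have h : HasLineDerivAt ℝ (scaleOp F) (∑ k, ∑ l, ((symUnit i j k l : ℂ) * dG k l F x +
      (metric x k l : ℂ) * fderiv ℝ (fderiv ℝ F) x (dirG i j) (dirG k l))) x (dirG i j) := by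
    rw [HasLineDerivAt]
    refine HasDerivAt.fun_sum fun k _ => HasDerivAt.fun_sum fun l _ => ?_
    have h1 : HasDerivAt (fun t : ℝ => ((metric (x + t • dirG i j) k l : ℝ) : ℂ))
        (symUnit i j k l : ℂ) 0 := by
      refine HasDerivAt.ofReal_comp (f := fun t : ℝ => metric (x + t • dirG i j) k l) ?_
      simp only [metric_add_dirG, Matrix.add_apply, Matrix.smul_apply, smul_eq_mul]
      simpa using ((hasDerivAt_id (0 : ℝ)).mul_const (symUnit i j k l)).const_add (metric x k l)
    refine (h1.mul (hasLineDerivAt_lineDeriv hF (dirG i j) (dirG k l))).congr_deriv ?_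
    simp only [zero_smul, add_zero]
    rfl
  have h3 : dG i j (scaleOp F) x = _ := h.lineDeriv
  rw [h3]
  simp only [Finset.sum_add_distrib]
  congr 1
  have h4 : ∀ f : Fin d → Fin d → ℂ, ∑ k, ∑ l, (symUnit i j k l : ℂ) * f k l = f i j + f j i := by
    intro f
    simp only [symUnit, Matrix.of_apply, unitDir_apply, add_mul, Finset.sum_add_distrib,
      Complex.ofReal_add, apply_ite Complex.ofReal, Complex.ofReal_one, Complex.ofReal_zero,
      ite_mul, one_mul, zero_mul, Finset.sum_ite_irrel, Finset.sum_const_zero, Finset.sum_ite_eq',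
      Finset.mem_univ, if_true]
  rw [h4 fun k l => dG k l F x, dG_symm F j i]
  ring

lemma scaleOp_eq (hF : ContDiffAt ℝ 2 F x) :
    scaleOp F x = ∑ i, ∑ j, (metric x i j : ℂ) * fderiv ℝ F x (dirG i j) := by
  simp only [scaleOp, dG_eq hF]

lemma scaleOp_scaleOp_eq (hF : ContDiffAt ℝ 2 F x) :
    scaleOp (scaleOp F) x = 2 * scaleOp F x +
      ∑ i, ∑ j, ∑ k, ∑ l, (metric x i j : ℂ) * (metric x k l : ℂ) *
        fderiv ℝ (fderiv ℝ F) x (dirG i j) (dirG k l) := by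
  rw [scaleOp]
  simp only [dG_scaleOp hF, mul_add, Finset.sum_add_distrib]
  congr 1
  · rw [scaleOp, Finset.mul_sum]
    refine Finset.sum_congr rfl fun i _ => ?_
    rw [Finset.mul_sum]
    exact Finset.sum_congr rfl fun j _ => by ring
  · simp only [Finset.mul_sum, mul_assoc]

end ContDiffAt

theorem isSecondOrder_laplaceSO : IsSecondOrder (laplaceSO (d := d)) := by
  refine ⟨1 / 4, 1 / 4, 1 / 2, 0, fun F x hF => ?_⟩
  rw [laplaceSO, secondOrder, scaleOp_eq hF]
  simp only [dG_dG_eq hF, dB_dB_eq hF, ← mul_add]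
  rw [zero_mul, add_zero, Finset.mul_sum]
  congr 1
  simp only [Finset.mul_sum]
  exact Finset.sum_congr rfl fun i _ => Finset.sum_congr rfl fun j _ =>
    Finset.sum_congr rfl fun k _ => Finset.sum_congr rfl fun l _ => by ring

theorem isSecondOrder_box : IsSecondOrder (box (d := d)) := by
  -- The correction -1/4 is -1/8 times the first order term 2 `scaleOp` contained in the square of
  -- `scaleOp`.
  refine ⟨1 / 4, 0, ((d : ℂ) + 1) / 4 - 1 / 4, -(1 / 8), fun F x hF => ?_⟩
  rw [box, laplaceGL, secondOrder, scaleOp_scaleOp_eq hF, scaleOp_eq hF]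
  simp only [dG_dG_eq hF, zero_mul, add_zero, mul_left_comm _ (1 / 4 : ℂ), ← Finset.mul_sum]
  ring

/-! ## The eigenvalue equation for convergent series -/

namespace ChargeSystem.Regular

variable {R : ChargeSystem d} {D : (Background d → ℂ) → Background d → ℂ}

theorem hasSum_operator (h : R.Regular) (hD : IsSecondOrder D) {s : ℂ} (hs : R.ConvergesAt s)
    {x : Background d} (hx : x ∈ moduli d) :
    HasSum (fun m : R.charges => D (R.term s m) x) (D (R.series s) x) := by
  obtain ⟨α, β, γ, δ, hD⟩ := hD
  obtain ⟨r, hr, h0, h1, h2⟩ := h.local_series hs hx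
  have hmem := Metric.mem_ball_self (x := x) hr
  rw [hD _ _ (h0.contDiffAt (Metric.ball_mem_nhds x hr))]
  have e : ∀ m : R.charges, D (R.term s m) x = secondOrder α β γ δ x (fderiv ℝ (R.term s m) x)
      fun v w => fderiv ℝ (fderiv ℝ (R.term s m)) x v w := fun m => hD _ _
    ((h.contDiffOn_term s (h.ne_zero _ m.2)).contDiffAt (isOpen_moduli.mem_nhds hx))
  simp only [e]
  exact hasSum_secondOrder α β γ δ x (h1 x hmem) (h2 x hmem)

theorem hasSum_series {s : ℂ} (hs : R.ConvergesAt s) {x : Background d} (hx : x ∈ moduli d) :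
    HasSum (fun m : R.charges => R.term s m x) (R.series s x) := (hs x hx).of_norm.hasSum

theorem sumEigenmode (h : R.Regular) (hD : IsSecondOrder D) {s lam : ℂ}
    (ht : R.TermwiseEigenmode D s lam) : R.SumEigenmode D s lam := by
  refine fun hs => ⟨h.contDiffOn_series hs, fun x hx => ?_⟩
  refine (h.hasSum_operator hD hs hx).unique ?_
  have e : ∀ m : R.charges, D (R.term s m) x = lam * R.term s m x := fun m => ht m m.2 x hx
  simp only [e]
  exact (hasSum_series hs hx).mul_left lam

end ChargeSystem.Regular

end TDuality

end

open scoped TensorProduct BigOperators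
noncomputable section
namespace TDuality
variable {d : ℕ}

/-! ## Analytic continuation of the eigenvalue equation -/

section Parameter

variable {V : Type*} [NormedAddCommGroup V] [NormedSpace ℝ V] {G : ℂ → V → ℂ} {U : Set ℂ}
  {O : Set V}

theorem contDiffOn_fderiv_snd (hU : IsOpen U) (hO : IsOpen O) {n m : WithTop ℕ∞}
    (hG : ContDiffOn ℝ n (fun p : ℂ × V => G p.1 p.2) (U ×ˢ O)) (hmn : m + 1 ≤ n) (v : V) :
    ContDiffOn ℝ m (fun p : ℂ × V => fderiv ℝ (G p.1) p.2 v) (U ×ˢ O) := by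
  have hS := hU.prod hO
  have h1 : ContDiffOn ℝ m
      (fun p => (fderiv ℝ (fun p : ℂ × V => G p.1 p.2) p) ((0 : ℂ), v)) (U ×ˢ O) :=
    (hG.fderiv_of_isOpen hS hmn).clm_apply contDiffOn_const
  refine h1.congr fun p hp => ?_
  have hd : HasFDerivAt (fun p : ℂ × V => G p.1 p.2)
      (fderiv ℝ (fun p : ℂ × V => G p.1 p.2) p) (p.1, p.2) :=
    ((hG.differentiableOn (by
      rintro rfl; simp at hmn)).differentiableAt (hS.mem_nhds hp)).hasFDerivAt
  have h2 : HasFDerivAt (G p.1) _ p.2 := hd.comp p.2 (hasFDerivAt_prodMk_right p.1 p.2)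
  rw [h2.fderiv]
  rfl

/-- The derivative with respect to a real parameter of a family of holomorphic functions is
holomorphic. -/
theorem differentiableOn_fderiv_parameter (hU : IsOpen U) (hO : IsOpen O)
    (hhol : ∀ x ∈ O, DifferentiableOn ℂ (fun s => G s x) U)
    (hG : ContDiffOn ℝ 1 (fun p : ℂ × V => G p.1 p.2) (U ×ˢ O)) {x : V} (hx : x ∈ O) (v : V) :
    DifferentiableOn ℂ (fun s => fderiv ℝ (G s) x v) U := by
  have hP := (contDiffOn_fderiv_snd (m := 0) hU hO hG (by norm_num) v).continuousOn
  have hline : ContinuousAt (fun t : ℝ => x + t • v) 0 := by fun_prop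
  have hlineO : ∀ᶠ t : ℝ in nhdsWithin 0 {0}ᶜ, x + t • v ∈ O :=
    (hline.eventually (hO.mem_nhds (by simpa using hx))).filter_mono nhdsWithin_le_nhds
  -- The difference quotients are holomorphic in s. Joint continuity of the derivative makes them
  -- converge locally uniformly in s, and such limits are holomorphic.
  have hlim : TendstoLocallyUniformlyOn (fun (t : ℝ) s => (t : ℂ)⁻¹ * (G s (x + t • v) - G s x))
      (fun s => fderiv ℝ (G s) x v) (nhdsWithin 0 {0}ᶜ) U := by
    rw [Metric.tendstoLocallyUniformlyOn_iff]
    intro ε hε s₀ hs₀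
    have hc : ContinuousAt (fun p : ℂ × V => fderiv ℝ (G p.1) p.2 v) (s₀, x) :=
      hP.continuousAt ((hU.prod hO).mem_nhds ⟨hs₀, hx⟩)
    have hnear : ∀ᶠ p in nhds (s₀, x), p ∈ U ×ˢ O ∧
        dist (fderiv ℝ (G p.1) p.2 v) (fderiv ℝ (G s₀) x v) < ε / 4 :=
      ((hU.prod hO).eventually_mem (x := (s₀, x)) ⟨hs₀, hx⟩).and
        (Metric.continuousAt_iff'.1 hc _ (by positivity))
    obtain ⟨r, hr, hball⟩ := Metric.eventually_nhds_iff_ball.1 hnear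
    refine ⟨Metric.ball s₀ r, mem_nhdsWithin_of_mem_nhds (Metric.ball_mem_nhds s₀ hr), ?_⟩
    obtain ⟨η, hη, hsmall⟩ := Metric.eventually_nhds_iff_ball.1
      (hline.eventually (Metric.ball_mem_nhds _ hr))
    have hη' : ∀ᶠ t : ℝ in nhdsWithin 0 {0}ᶜ, t ∈ Metric.ball 0 η ∧ t ≠ 0 := by
      filter_upwards [nhdsWithin_le_nhds (Metric.ball_mem_nhds 0 hη), self_mem_nhdsWithin]
        with t h1 h2 using ⟨h1, h2⟩
    filter_upwards [hη'] with t ht s hs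
    have hmem : ∀ τ ∈ Metric.ball (0 : ℝ) η, (s, x + τ • v) ∈ Metric.ball (s₀, x) r := by
      intro τ hτ
      rw [← ball_prod_same]
      refine ⟨hs, ?_⟩
      have h1 : x + τ • v ∈ Metric.ball (x + (0 : ℝ) • v) r := hsmall τ hτ
      simpa using h1
    have hbound : ∀ τ ∈ Metric.ball (0 : ℝ) η,
        ‖fderiv ℝ (G s) (x + τ • v) v - fderiv ℝ (G s) x v‖ ≤ ε / 2 := by
      intro τ hτ
      have h1 := (hball _ (hmem τ hτ)).2
      have h2 := (hball _ (hmem 0 (Metric.mem_ball_self hη))).2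
      simp only [zero_smul, add_zero] at h2
      rw [← dist_eq_norm]
      refine (dist_triangle_right _ _ (fderiv ℝ (G s₀) x v)).trans ?_
      linarith
    have hder : ∀ τ ∈ Metric.ball (0 : ℝ) η,
        HasDerivWithinAt (fun τ : ℝ => G s (x + τ • v) - (τ : ℂ) * fderiv ℝ (G s) x v)
          (fderiv ℝ (G s) (x + τ • v) v - fderiv ℝ (G s) x v) (Metric.ball 0 η) τ := by
      intro τ hτ
      have hUO := (hball _ (hmem τ hτ)).1
      have h1 : DifferentiableAt ℝ (G s) (x + τ • v) := by
        have h := (hG.differentiableOn (by norm_num)).differentiableAt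
          ((hU.prod hO).mem_nhds hUO)
        exact h.comp (x + τ • v) (hasFDerivAt_prodMk_right s (x + τ • v)).differentiableAt
      have h2 : HasDerivAt (fun τ : ℝ => x + τ • v) v τ := by
        simpa using ((hasDerivAt_id τ).smul_const v).const_add x
      have h3 : HasDerivAt (fun τ : ℝ => (τ : ℂ) * fderiv ℝ (G s) x v) (fderiv ℝ (G s) x v) τ := by
        simpa using (Complex.ofRealCLM.hasDerivAt (x := τ)).mul_const (fderiv ℝ (G s) x v)
      exact ((h1.hasFDerivAt.comp_hasDerivAt τ h2).sub h3).hasDerivWithinAt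
    -- The mean value inequality is applied after subtracting the linear part τ · ∂G, so that it
    -- bounds the error of the difference quotient directly.
    have hmv := (convex_ball (0 : ℝ) η).norm_image_sub_le_of_norm_hasDerivWithin_le hder hbound
      (Metric.mem_ball_self hη) ht.1
    simp only [zero_smul, add_zero, Complex.ofReal_zero, zero_mul, sub_zero] at hmv
    have ht0 : (t : ℂ) ≠ 0 := Complex.ofReal_ne_zero.2 ht.2
    have htn : 0 < ‖t‖ := norm_pos_iff.2 ht.2
    rw [dist_comm, dist_eq_norm]
    have e : (t : ℂ)⁻¹ * (G s (x + t • v) - G s x) - fderiv ℝ (G s) x v =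
        (t : ℂ)⁻¹ * (G s (x + t • v) - (t : ℂ) * fderiv ℝ (G s) x v - G s x) := by
      field_simp
      ring
    rw [e, norm_mul, norm_inv, Complex.norm_real]
    calc ‖t‖⁻¹ * _ ≤ ‖t‖⁻¹ * (ε / 2 * ‖t‖) := mul_le_mul_of_nonneg_left hmv (by positivity)
      _ = ε / 2 := by field_simp
      _ < ε := by linarith
  refine hlim.differentiableOn ?_ hU
  filter_upwards [hlineO] with t ht
  exact ((hhol _ ht).sub (hhol x hx)).const_mul _

end Parameter

lemma IsSecondOrder.congr {D : (Background d → ℂ) → Background d → ℂ} (hD : IsSecondOrder D)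
    {F G : Background d → ℂ} {x : Background d} (hF : ContDiffAt ℝ 2 F x) (h : F =ᶠ[nhds x] G) :
    D F x = D G x := by
  obtain ⟨α, β, γ, δ, hD⟩ := hD
  rw [hD F x hF, hD G x (hF.congr_of_eventuallyEq h.symm), h.fderiv_eq, h.fderiv.fderiv_eq]

namespace ChargeSystem

variable {R : ChargeSystem d} {D : (Background d → ℂ) → Background d → ℂ} {U : Set ℂ}
  {E : ℂ → Background d → ℂ}

namespace IsContinuation

lemma contDiffAt (hE : R.IsContinuation U E) {s : ℂ} (hs : s ∈ U) {x : Background d}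
    (hx : x ∈ moduli d) : ContDiffAt ℝ 2 (E s) x := by
  have h : ContDiffAt ℝ 2 (fun p : ℂ × Background d => E p.1 p.2) (s, x) :=
    hE.contDiffOn.contDiffAt ((hE.isOpen.prod isOpen_moduli).mem_nhds ⟨hs, hx⟩)
  exact h.comp (f := fun y : Background d => (s, y)) x (by fun_prop)

/-- Second order operators in the moduli preserve holomorphy in the order. -/
theorem differentiableOn_operator (hE : R.IsContinuation U E) (hD : IsSecondOrder D)
    {x : Background d} (hx : x ∈ moduli d) : DifferentiableOn ℂ (fun s => D (E s) x) U := by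
  obtain ⟨α, β, γ, δ, hD⟩ := hD
  have h1 : ∀ v, ∀ y ∈ moduli d, DifferentiableOn ℂ (fun s => fderiv ℝ (E s) y v) U :=
    fun v y hy => differentiableOn_fderiv_parameter hE.isOpen isOpen_moduli hE.holomorphic
      (hE.contDiffOn.of_le (by norm_num)) hy v
  have h2 : ∀ v w, DifferentiableOn ℂ
      (fun s => fderiv ℝ (fun y => fderiv ℝ (E s) y w) x v) U := fun v w =>
    differentiableOn_fderiv_parameter (G := fun s y => fderiv ℝ (E s) y w) hE.isOpen isOpen_moduli
      (h1 w) (contDiffOn_fderiv_snd hE.isOpen isOpen_moduli hE.contDiffOn (by norm_num) w) hx v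
  refine (differentiableOn_secondOrder α β γ δ x (fun v => h1 v x hx) (H := fun s v w =>
    fderiv ℝ (fun y => fderiv ℝ (E s) y w) x v) h2).congr fun s hs => ?_
  have hc := hE.contDiffAt hs hx
  rw [hD (E s) x hc]
  congr 1
  funext v w
  have h3 : HasFDerivAt (fderiv ℝ (E s)) (fderiv ℝ (fderiv ℝ (E s)) x) x :=
    ((hc.fderiv_right (m := 1) (by norm_num)).differentiableAt (by norm_num)).hasFDerivAt
  have h4 : HasFDerivAt (fun y => fderiv ℝ (E s) y w)
      ((ContinuousLinearMap.apply ℝ ℂ w).comp (fderiv ℝ (fderiv ℝ (E s)) x)) x :=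
    (ContinuousLinearMap.apply ℝ ℂ w).hasFDerivAt.comp x h3
  rw [h4.fderiv]
  rfl

lemma operator_eq_series (hE : R.IsContinuation U E) (hD : IsSecondOrder D) {s : ℂ}
    (hs : s ∈ R.halfPlane) {x : Background d} (hx : x ∈ moduli d) :
    D (E s) x = D (R.series s) x := by
  refine hD.congr (hE.contDiffAt (hE.halfPlane_subset hs) hx) ?_
  filter_upwards [isOpen_moduli.mem_nhds hx] with y hy using hE.eq_series s hs y hy

/-- Two holomorphic functions that agree on the half-plane of convergence agree. -/
theorem eqOn (hE : R.IsContinuation U E) {f g : ℂ → ℂ} (hf : DifferentiableOn ℂ f U)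
    (hg : DifferentiableOn ℂ g U) (h : ∀ s ∈ R.halfPlane, f s = g s) : Set.EqOn f g U := by
  have ho : IsOpen R.halfPlane := isOpen_lt continuous_const Complex.continuous_re
  have hmem : (((Fintype.card R.Index : ℝ) / 2 + 1 : ℝ) : ℂ) ∈ R.halfPlane := by
    show _ < (Complex.re _)
    rw [Complex.ofReal_re]
    linarith
  refine (hf.analyticOnNhd hE.isOpen).eqOn_of_preconnected_of_eventuallyEq
    (hg.analyticOnNhd hE.isOpen) hE.isPreconnected (hE.halfPlane_subset hmem) ?_
  filter_upwards [ho.mem_nhds hmem] with s hs using h s hs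

end IsContinuation

/-! ### Eigenvalue equations for continued series -/

namespace Regular

/-- If every term solves an inhomogeneous eigenvalue equation whose source is a quartic insertion,
then so does each continuation of the series. -/
theorem continued_insertion (h : R.Regular) (hD : IsSecondOrder D) {a b : ℂ → ℂ}
    (ha : Differentiable ℂ a) (hb : Differentiable ℂ b) {x : Background d} (hx : x ∈ moduli d)
    {P : (R.Index → ℤ) → ℝ}
    (hterm : ∀ s, ∀ m ∈ R.charges,
      D (R.term s m) x = a s * R.term s m x + b s * ((P m : ℂ) * R.term (s + 2) m x))
    (hE : R.IsContinuation U E) {F : ℂ → ℂ} (hF : DifferentiableOn ℂ F U)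
    (hFP : ∀ s ∈ R.halfPlane,
      F s = ∑' m : R.charges, (P (m : R.Index → ℤ) : ℂ) * R.term (s + 2) m x)
    {s : ℂ} (hs : s ∈ U) : D (E s) x = a s * E s x + b s * F s := by
  refine hE.eqOn (f := fun s => D (E s) x) (g := fun s => a s * E s x + b s * F s)
    (hE.differentiableOn_operator hD hx)
    ((ha.differentiableOn.mul (hE.holomorphic x hx)).add (hb.differentiableOn.mul hF))
    (fun s hs => ?_) hs
  have hconv := h.convergesAt_of_mem_halfPlane hs
  have h1 := (h.hasSum_operator hD hconv hx).sub ((hasSum_series hconv hx).mul_left (a s))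
  have e : ∀ m : R.charges, D (R.term s m) x - a s * R.term s m x =
      b s * ((P (m : R.Index → ℤ) : ℂ) * R.term (s + 2) m x) := by
    intro m; rw [hterm s m m.2]; ring
  simp only [e] at h1
  have h2 := h1.tsum_eq
  rw [tsum_mul_left, ← hFP s hs] at h2
  simp only [h2, hE.operator_eq_series hD hs hx, hE.eq_series s hs x hx]
  ring

theorem continued (h : R.Regular) (hD : IsSecondOrder D) {lam : ℂ → ℂ}
    (hlam : Differentiable ℂ lam) (ht : ∀ s, R.TermwiseEigenmode D s (lam s))
    (hE : R.IsContinuation U E) {s : ℂ} (hs : s ∈ U) : EigenEq D (lam s) (E s) := by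
  intro x hx
  have h1 := h.continued_insertion hD hlam (differentiable_const 0) hx (P := fun _ => 0)
    (fun s m hm => by rw [ht s m hm x hx]; ring) hE (differentiableOn_const 0)
    (fun s _ => by simp) hs
  simpa using h1

/-- An eigenvalue equation for the terms at all orders holds for the sums. -/
theorem isEigenmode (h : R.Regular) (hD : IsSecondOrder D) {lam : ℂ → ℂ}
    (hlam : Differentiable ℂ lam) (ht : ∀ s, R.TermwiseEigenmode D s (lam s)) (s : ℂ) :
    R.IsEigenmode D s (lam s) :=
  ⟨ht s, h.sumEigenmode hD (ht s), fun _ _ hE hs => h.continued hD hlam ht hE hs⟩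

/-- An eigenvalue equation up to quartic insertions holds for the sums at the zeros of the
coefficient of the insertion. -/
theorem isIsolatedEigenmode (h : R.Regular) (hD : IsSecondOrder D) {a b : ℂ → ℂ}
    (ha : Differentiable ℂ a) (hb : Differentiable ℂ b)
    (P : Background d → MvPolynomial R.Index ℝ) (hP : ∀ x, (P x).IsHomogeneous 4)
    (hterm : ∀ s, ∀ m ∈ R.charges, ∀ x ∈ moduli d, D (R.term s m) x = a s * R.term s m x +
      b s * ((MvPolynomial.eval (realCharge m) (P x) : ℝ) * R.term (s + 2) m x))
    {s : ℂ} (hbs : b s = 0) : R.IsIsolatedEigenmode D s (a s) := by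
  have ht : R.TermwiseEigenmode D s (a s) := fun m hm x hx => by
    rw [hterm s m hm x hx, hbs]; ring
  refine ⟨ht, h.sumEigenmode hD ht, fun U E hE hins hs x hx => ?_⟩
  -- Vanishing of b at s suffices only because F is holomorphic there; a pole of the insertion could
  -- compensate the zero.
  obtain ⟨F, hF, hFP⟩ := hins x hx (P x) (hP x)
  have h1 := h.continued_insertion hD ha hb hx
    (P := fun m => MvPolynomial.eval (realCharge m) (P x))
    (fun s m hm => hterm s m hm x hx) hE hF hFP hs
  rw [h1, hbs]; ring

end Regular

end ChargeSystem

end TDuality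

end

open scoped TensorProduct BigOperators
noncomputable section
namespace TDuality
variable {d : ℕ}

/-! ## Regularity of the mass formulas -/

section Smooth

variable {P : Type*} [NormedAddCommGroup P] [NormedSpace ℝ P] {S : Set P} {k : WithTop ℕ∞}

lemma contDiffOn_det {n : Type*} [Fintype n] [DecidableEq n] {A : P → Matrix n n ℝ}
    (hA : ∀ i j, ContDiffOn ℝ k (fun p => A p i j) S) : ContDiffOn ℝ k (fun p => (A p).det) S := by
  simp only [Matrix.det_apply']
  exact ContDiffOn.sum fun σ _ => contDiffOn_const.mul (contDiffOn_prod fun i _ => hA _ _)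

lemma contDiffOn_inv_entry {n : Type*} [Fintype n] [DecidableEq n] {A : P → Matrix n n ℝ}
    (hA : ∀ i j, ContDiffOn ℝ k (fun p => A p i j) S) (hdet : ∀ p ∈ S, (A p).det ≠ 0) (i j : n) :
    ContDiffOn ℝ k (fun p => (A p)⁻¹ i j) S := by
  simp only [Matrix.inv_def, Ring.inverse_eq_inv', Matrix.smul_apply, smul_eq_mul,
    Matrix.adjugate_apply]
  refine ((contDiffOn_det hA).inv hdet).mul (contDiffOn_det fun a b => ?_)
  simp only [Matrix.updateRow_apply]
  split_ifs
  · exact contDiffOn_const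
  · exact hA a b

variable {x : P → Background d}

lemma contDiffOn_metric (hx : ContDiffOn ℝ k x S) (i j : Fin d) :
    ContDiffOn ℝ k (fun p => metric (x p) i j) S := by
  have h : ∀ i j, ContDiffOn ℝ k (fun p => x p i j) S := fun i j =>
    contDiffOn_pi.1 (contDiffOn_pi.1 hx i) j
  exact ((h i j).add (h j i)).div_const 2

lemma contDiffOn_bField (hx : ContDiffOn ℝ k x S) (i j : Fin d) :
    ContDiffOn ℝ k (fun p => bField (x p) i j) S := by
  have h : ∀ i j, ContDiffOn ℝ k (fun p => x p i j) S := fun i j =>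
    contDiffOn_pi.1 (contDiffOn_pi.1 hx i) j
  exact ((h i j).sub (h j i)).div_const 2

lemma contDiffOn_minor (hx : ContDiffOn ℝ k x S) (I J : Finset (Fin d)) :
    ContDiffOn ℝ k (fun p => minor (metric (x p)) I J) S := by
  unfold minor
  split_ifs with h
  · exact contDiffOn_det fun _ _ => contDiffOn_metric hx _ _
  · exact contDiffOn_const

lemma contDiffOn_linearMap (T : Fock d →ₗ[ℝ] Fock d) {φ : P → Fock d} (hφ : ContDiffOn ℝ k φ S) :
    ContDiffOn ℝ k (fun p => T (φ p)) S :=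
  (LinearMap.toContinuousLinearMap T).contDiff.comp_contDiffOn hφ

lemma contDiffOn_dressedSpinor (hx : ContDiffOn ℝ k x S) {φ : P → Fock d}
    (hφ : ContDiffOn ℝ k φ S) : ContDiffOn ℝ k (fun p => dressedSpinor (x p) (φ p)) S := by
  have hpow : ∀ n : ℕ, ContDiffOn ℝ k (fun p => (bContract (x p) ^ n) (φ p)) S := by
    intro n
    induction n with
    | zero => exact hφ
    | succ n ih =>
      simp only [pow_succ', Module.End.mul_apply, bContract_apply]
      exact ContDiffOn.sum fun j _ => ContDiffOn.sum fun l _ =>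
        ((contDiffOn_bField hx j l).div_const 2).smul
          (contDiffOn_linearMap _ (contDiffOn_linearMap _ ih))
  unfold dressedSpinor
  exact ContDiffOn.sum fun n _ => (hpow n).const_smul _

end Smooth

theorem regular_vectorSystem : (vectorSystem d).Regular where
  smul x c := fun (v : Fin d ⊕ Fin d → ℝ) => by
    have h : ∀ i, dressedMomentum x (c • v) i = c * dressedMomentum x v i := by
      intro i
      simp only [dressedMomentum, Pi.smul_apply, smul_eq_mul, mul_add, Finset.mul_sum]
      congr 1
      exact Finset.sum_congr rfl fun j _ => by ring
    change vectorMass (c • v) x = c ^ 2 * vectorMass v x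
    simp only [vectorMass, h, mul_add, Finset.mul_sum, Pi.smul_apply, smul_eq_mul]
    congr 1 <;>
    exact Finset.sum_congr rfl fun i _ => Finset.sum_congr rfl fun j _ => by ring
  pos x hx v hv := vectorMass_pos hx hv
  contDiffOn := by
    have h1 : ContDiffOn ℝ 2 (fun p : Background d × (Fin d ⊕ Fin d → ℝ) => p.1)
        (moduli d ×ˢ Set.univ) := contDiffOn_fst
    have h2 : ∀ a, ContDiffOn ℝ 2 (fun p : Background d × (Fin d ⊕ Fin d → ℝ) => p.2 a)
        (moduli d ×ˢ Set.univ) := fun a => contDiffOn_pi.1 contDiffOn_snd a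
    have h3 : ∀ i, ContDiffOn ℝ 2
        (fun p : Background d × (Fin d ⊕ Fin d → ℝ) => dressedMomentum p.1 p.2 i)
        (moduli d ×ˢ Set.univ) := fun i =>
      (h2 _).add (ContDiffOn.sum fun j _ => (contDiffOn_bField h1 i j).mul (h2 _))
    refine ContDiffOn.add (ContDiffOn.sum fun i _ => ContDiffOn.sum fun j _ => ?_)
      (ContDiffOn.sum fun i _ => ContDiffOn.sum fun j _ => ?_)
    · exact ((h3 i).mul (contDiffOn_inv_entry (fun i j => contDiffOn_metric h1 i j)
        (fun p hp => (Matrix.PosDef.det_pos hp.1).ne') i j)).mul (h3 j)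
    · exact ((h2 _).mul (contDiffOn_metric h1 i j)).mul (h2 _)
  ne_zero m hm := hm.1

/-! ## The spinor systems -/

/-- `toFock` as a linear map. -/
def toFockₗ (d parity : ℕ) : (SpinorIndex d parity → ℝ) →ₗ[ℝ] Fock d where
  toFun := toFock
  map_add' m n := by
    funext I
    simp only [toFock, Pi.add_apply]
    split_ifs <;> simp
  map_smul' c m := by
    funext I
    simp only [toFock, Pi.smul_apply, RingHom.id_apply]
    split_ifs <;> simp

variable {parity : ℕ}

lemma toFock_ne_zero {v : SpinorIndex d parity → ℝ} (hv : v ≠ 0) : toFock v ≠ 0 := by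
  intro h
  apply hv
  funext I
  have := congrFun h I.1
  simpa [toFock, I.2] using this

lemma spinSystem_massSq (x : Background d) (v : SpinorIndex d parity → ℝ) :
    (spinSystem d parity).massSq x v = spinMass (toFock v) x := by
  change 1 / √((metric x).det) * _ = _
  rw [spinMass, normForm_apply, gram_apply, one_div]

lemma spinSystem_term (s : ℂ) (m : SpinorIndex d parity → ℤ) :
    (spinSystem d parity).term s m =
      fun x => (spinMass (toFock (realCharge m)) x : ℂ) ^ (-s) := by
  funext x
  exact congrArg (fun a : ℝ => (a : ℂ) ^ (-s)) (spinSystem_massSq x (realCharge m))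

lemma toFock_realCharge_ne_zero {m : SpinorIndex d parity → ℤ}
    (hm : m ∈ (spinSystem d parity).charges) : toFock (realCharge m) ≠ 0 :=
  toFock_ne_zero (realCharge_ne_zero hm.1)

lemma isPure_toFock {m : SpinorIndex d parity → ℤ} (hm : m ∈ (spinSystem d parity).charges) :
    IsPure (toFock (realCharge m)) := isPure_of_mem hm.2

/-- The dressing of a charge as a linear map. -/
def dressedₗ (parity : ℕ) (x : Background d) : (SpinorIndex d parity → ℝ) →ₗ[ℝ] Fock d :=
  (IsNilpotent.exp (bContract x : Module.End ℝ (Fock d))) ∘ₗ toFockₗ d parity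

lemma dressedₗ_apply (x : Background d) (v : SpinorIndex d parity → ℝ) :
    dressedₗ parity x v = dressedSpinor x (toFock v) := (dressedSpinor_eq_exp x _).symm

theorem regular_spinSystem (d parity : ℕ) : (spinSystem d parity).Regular where
  smul x c := fun (v : SpinorIndex d parity → ℝ) => by
    change (spinSystem d parity).massSq x (c • v : SpinorIndex d parity → ℝ) = _
    rw [spinSystem_massSq, spinSystem_massSq, spinMass, spinMass, ← dressedₗ_apply,
      ← dressedₗ_apply, map_smul, map_smul, map_smul, LinearMap.smul_apply, smul_eq_mul,
      smul_eq_mul]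
    ring
  pos x hx := fun (v : SpinorIndex d parity → ℝ) hv => by
    rw [spinSystem_massSq]
    exact normForm_pos hx (dressedSpinor_injective x (toFock_ne_zero hv))
  contDiffOn := by
    have h1 : ContDiffOn ℝ 2 (fun p : Background d × (SpinorIndex d parity → ℝ) => p.1)
        (moduli d ×ˢ Set.univ) := contDiffOn_fst
    have h2 : ContDiffOn ℝ 2 (fun p : Background d × (SpinorIndex d parity → ℝ) => toFock p.2)
        (moduli d ×ˢ Set.univ) :=
      (LinearMap.toContinuousLinearMap (toFockₗ d parity)).contDiff.comp_contDiffOn contDiffOn_snd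
    have h3 := fun I => contDiffOn_pi.1 (contDiffOn_dressedSpinor h1 h2) I
    have h4 : ContDiffOn ℝ 2
        (fun p : Background d × (SpinorIndex d parity → ℝ) => (metric p.1).det)
        (moduli d ×ˢ Set.univ) := contDiffOn_det fun i j => contDiffOn_metric h1 i j
    refine ContDiffOn.mul ?_ (ContDiffOn.sum fun I _ => ContDiffOn.sum fun J _ =>
      ((h3 I).mul (contDiffOn_minor h1 I J)).mul (h3 J))
    exact contDiffOn_const.div (h4.sqrt fun p hp => (Matrix.PosDef.det_pos hp.1).ne')
      fun p hp => (Real.sqrt_pos.2 (Matrix.PosDef.det_pos hp.1)).ne'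
  ne_zero m hm := hm.1

/-! ## Polynomial form of the insertion -/

/-- The quadratic polynomial of a bilinear form. -/
def quadPoly {ι : Type*} [Fintype ι] [DecidableEq ι] (b : LinearMap.BilinForm ℝ (ι → ℝ)) :
    MvPolynomial ι ℝ :=
  ∑ i, ∑ j, MvPolynomial.C (b (Pi.single i 1) (Pi.single j 1)) *
    (MvPolynomial.X i * MvPolynomial.X j)

lemma quadPoly_isHomogeneous {ι : Type*} [Fintype ι] [DecidableEq ι]
    (b : LinearMap.BilinForm ℝ (ι → ℝ)) : (quadPoly b).IsHomogeneous 2 := by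
  refine MvPolynomial.IsHomogeneous.sum _ _ _ fun i _ =>
    MvPolynomial.IsHomogeneous.sum _ _ _ fun j _ => ?_
  have h := (MvPolynomial.isHomogeneous_C ι (b (Pi.single i 1) (Pi.single j 1))).mul
    ((MvPolynomial.isHomogeneous_X ℝ i).mul (MvPolynomial.isHomogeneous_X ℝ j))
  simpa using h

lemma eval_quadPoly {ι : Type*} [Fintype ι] [DecidableEq ι]
    (b : LinearMap.BilinForm ℝ (ι → ℝ)) (v : ι → ℝ) :
    MvPolynomial.eval v (quadPoly b) = b v v := by
  have hv : v = ∑ i, v i • Pi.single i (1 : ℝ) := by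
    simpa using (pi_eq_sum_univ' v)
  conv_rhs => rw [hv]
  simp only [quadPoly, map_sum, map_mul, MvPolynomial.eval_C, MvPolynomial.eval_X, map_smul,
    LinearMap.sum_apply, LinearMap.smul_apply, smul_eq_mul]
  rw [Finset.sum_comm]
  simp only [Finset.mul_sum]
  exact Finset.sum_congr rfl fun i _ => Finset.sum_congr rfl fun j _ => by ring

/-- The insertion as a polynomial in the charge. -/
def insertionPoly (parity : ℕ) (x : Background d) : MvPolynomial (SpinorIndex d parity) ℝ :=
  quadPoly ((normForm x).compl₁₂ (dressedₗ parity x) (dressedₗ parity x)) *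
    quadPoly ((normForm x).compl₁₂ (dressedₗ parity x)
      ((number ∘ₗ number - (d : ℝ) • number) ∘ₗ dressedₗ parity x))

lemma insertionPoly_isHomogeneous (x : Background d) :
    (insertionPoly parity x).IsHomogeneous 4 :=
  (quadPoly_isHomogeneous _).mul (quadPoly_isHomogeneous _)

lemma insertion_eq (φ : Fock d) (x : Background d) : insertion φ x = spinMass φ x *
    normForm x (dressedSpinor x φ) (number (number (dressedSpinor x φ)) -
      (d : ℝ) • number (dressedSpinor x φ)) := by
  rw [map_sub, map_smul, smul_eq_mul]; rfl

lemma eval_insertionPoly (x : Background d) (v : SpinorIndex d parity → ℝ) :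
    MvPolynomial.eval v (insertionPoly parity x) = insertion (toFock v) x := by
  rw [insertionPoly, map_mul, eval_quadPoly, eval_quadPoly, insertion_eq]
  simp only [LinearMap.compl₁₂_apply, LinearMap.comp_apply, LinearMap.sub_apply,
    LinearMap.smul_apply, dressedₗ_apply]
  rfl

/-! ## Tensors of definite parity -/

/-- The components of degrees of the other parity vanish. -/
def HasParity (parity : ℕ) (φ : Fock d) : Prop := ∀ I, I.card % 2 ≠ parity → φ I = 0

lemma hasParity_toFock (v : SpinorIndex d parity → ℝ) : HasParity parity (toFock v) :=
  fun I hI => by rw [toFock, dif_neg hI]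

lemma HasParity.bContract {φ : Fock d} (h : HasParity parity φ) (x : Background d) :
    HasParity parity (bContract x φ) := by
  intro I hI
  rw [bContract_apply, Finset.sum_apply]
  refine Finset.sum_eq_zero fun j _ => ?_
  rw [Finset.sum_apply]
  refine Finset.sum_eq_zero fun k _ => ?_
  rw [Pi.smul_apply, contract_apply, contract_apply]
  split_ifs with h1 h2
  · simp
  · simp
  · rw [h, mul_zero, mul_zero, smul_zero]
    rw [Finset.card_insert_of_notMem h2, Finset.card_insert_of_notMem h1]
    omega

lemma HasParity.dressed {φ : Fock d} (h : HasParity parity φ) (x : Background d) :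
    HasParity parity (dressedSpinor x φ) := by
  have hp : ∀ n : ℕ, HasParity parity ((TDuality.bContract x ^ n) φ) := by
    intro n
    induction n with
    | zero => exact h
    | succ n ih =>
      rw [pow_succ', Module.End.mul_apply]
      exact ih.bContract x
  intro I hI
  rw [dressedSpinor, Finset.sum_apply]
  exact Finset.sum_eq_zero fun n _ => by rw [Pi.smul_apply, hp n I hI, smul_zero]

/-- In low dimensions the insertion is a multiple of the square of the mass. -/
lemma insertion_eq_of_hasParity {φ : Fock d} (h : HasParity parity φ) {κ : ℝ}
    (hκ : ∀ p ≤ d, p % 2 = parity → (p : ℝ) * (p - d) = κ) (x : Background d) :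
    insertion φ x = κ * spinMass φ x ^ 2 := by
  have e : number (number (dressedSpinor x φ)) - (d : ℝ) • number (dressedSpinor x φ) =
      κ • dressedSpinor x φ := by
    funext I
    simp only [Pi.sub_apply, Pi.smul_apply, number_apply, smul_eq_mul]
    by_cases hI : I.card % 2 = parity
    · have hc : I.card ≤ d := by simpa using Finset.card_le_univ I
      rw [← hκ _ hc hI]; ring
    · rw [h.dressed x I hI]; ring
  rw [insertion_eq, e, map_smul, smul_eq_mul, spinMass]
  ring

/-! ## Termwise equations -/

lemma spinSystem_mass_pos {m : SpinorIndex d parity → ℤ} (hm : m ∈ (spinSystem d parity).charges)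
    {x : Background d} (hx : x ∈ moduli d) : 0 < spinMass (toFock (realCharge m)) x :=
  normForm_pos hx (dressedSpinor_injective x (toFock_realCharge_ne_zero hm))

theorem vectorSystem_termwise_laplaceSO (s : ℂ) :
    (vectorSystem d).TermwiseEigenmode laplaceSO s (s * (s - d + 1)) := fun m hm x hx =>
  laplaceSO_vectorMass_cpow (realCharge_ne_zero hm.1)
    (by have h := congrArg (Int.cast (R := ℝ)) hm.2; push_cast at h; exact h) hx s

theorem vectorSystem_termwise_box (s : ℂ) :
    (vectorSystem d).TermwiseEigenmode box s (s * (s - d + 1) / 2) := fun m hm x hx =>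
  box_vectorMass_cpow (realCharge_ne_zero hm.1)
    (by have h := congrArg (Int.cast (R := ℝ)) hm.2; push_cast at h; exact h) hx s

theorem spinSystem_termwise_laplaceSO (parity : ℕ) (s : ℂ) :
    (spinSystem d parity).TermwiseEigenmode laplaceSO s (s * d * (s - d + 1) / 4) := by
  intro (m : SpinorIndex d parity → ℤ) hm x hx
  rw [spinSystem_term]
  exact laplaceSO_spinMass_cpow (toFock_realCharge_ne_zero hm) (isPure_toFock hm) hx s

theorem spinSystem_box {m : SpinorIndex d parity → ℤ} (hm : m ∈ (spinSystem d parity).charges)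
    {x : Background d} (hx : x ∈ moduli d) (s : ℂ) :
    box ((spinSystem d parity).term s m) x =
      s ^ 2 * d * (2 - d) / 8 * (spinSystem d parity).term s m x +
        s * (1 - s) / 2 * (insertion (toFock (realCharge m)) x *
          (spinSystem d parity).term (s + 2) m x) := by
  rw [spinSystem_term, spinSystem_term]
  exact box_spinMass_cpow (toFock_realCharge_ne_zero hm) (isPure_toFock hm) hx s

theorem spinSystem_isIsolatedEigenmode_box (d parity : ℕ) :
    (spinSystem d parity).IsIsolatedEigenmode box 1 (d * (2 - d) / 8) := by
  have h := (regular_spinSystem d parity).isIsolatedEigenmode isSecondOrder_box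
    (a := fun s => s ^ 2 * d * (2 - d) / 8) (b := fun s => s * (1 - s) / 2)
    (by fun_prop) (by fun_prop) (insertionPoly parity) insertionPoly_isHomogeneous
    (fun s (m : SpinorIndex d parity → ℤ) hm x hx => by
      rw [spinSystem_box hm hx, ← eval_insertionPoly]; rfl) (s := 1) (by simp)
  simpa using h

/-- When N(N-d) is the constant κ on the degrees of this parity, the source is κ times the original
term and merely shifts the eigenvalue. -/
theorem spinSystem_termwise_box_of_low {κ : ℝ}
    (hκ : ∀ p ≤ d, p % 2 = parity → (p : ℝ) * (p - d) = κ) (s : ℂ) :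
    (spinSystem d parity).TermwiseEigenmode box s
      (s ^ 2 * d * (2 - d) / 8 + s * (1 - s) / 2 * κ) := by
  intro (m : SpinorIndex d parity → ℤ) hm x hx
  rw [spinSystem_box hm hx, insertion_eq_of_hasParity (hasParity_toFock _) hκ, spinSystem_term,
    spinSystem_term]
  beta_reduce
  rw [← cpow_sub_two_mul_sq (spinSystem_mass_pos hm hx) s, show -(s + 2) = -s - 2 by ring]
  push_cast
  ring

end TDuality

end

open scoped TensorProduct BigOperators
noncomputable section
namespace TDuality
variable {d : ℕ}

/-! ## Degenerating backgrounds -/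

/-- The radii of the torus with metric `probe I T`. -/
def probeRadius (I : Finset (Fin d)) (T : ℝ) (i : Fin d) : ℝ := if i ∈ I then T⁻¹ else T

/-- The rectangular torus with radii `1/T` in the directions `I` and `T` in the other directions. -/
def probe (I : Finset (Fin d)) (T : ℝ) : Background d :=
  fun i j => if i = j then probeRadius I T i ^ 2 else 0

lemma probeRadius_pos (I : Finset (Fin d)) {T : ℝ} (hT : 0 < T) (i : Fin d) :
    0 < probeRadius I T i := by
  rw [probeRadius]
  split_ifs
  · exact inv_pos.2 hT
  · exact hT

lemma metric_probe (I : Finset (Fin d)) (T : ℝ) :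
    metric (probe I T) = Matrix.diagonal fun i => probeRadius I T i ^ 2 := by
  ext i j
  rw [metric, Matrix.of_apply, Matrix.diagonal_apply, probe, probe]
  by_cases h : i = j
  · subst h; simp
  · rw [if_neg h, if_neg (Ne.symm h)]; simp

lemma bField_probe (I : Finset (Fin d)) (T : ℝ) : bField (probe I T) = 0 := by
  ext i j
  rw [bField, Matrix.of_apply, Matrix.zero_apply, probe, probe]
  by_cases h : i = j
  · subst h; simp
  · rw [if_neg h, if_neg (Ne.symm h)]; simp

lemma probe_mem_moduli (I : Finset (Fin d)) {T : ℝ} (hT : 0 < T) : probe I T ∈ moduli d := by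
  rw [moduli, Set.mem_ofPred_eq, metric_probe]
  exact Matrix.PosDef.diagonal fun i => pow_pos (probeRadius_pos I hT i) 2

lemma dressedSpinor_of_bField_eq_zero {x : Background d} (hx : bField x = 0) (φ : Fock d) :
    dressedSpinor x φ = φ := by
  have h : bContract x = 0 := by
    rw [bContract, hx]
    simp
  rw [dressedSpinor_eq_exp, h, IsNilpotent.exp_zero]
  rfl

/-- The weight of the component `J` in the mass formula on `probe I T`. -/
def probeWeight (I J : Finset (Fin d)) (T : ℝ) : ℝ :=
  ∏ i, if (i ∈ I ↔ i ∈ J) then 1 else T ^ 2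

lemma probeWeight_self (I : Finset (Fin d)) (T : ℝ) : probeWeight I I T = 1 := by
  simp [probeWeight]

lemma probeWeight_at_one (I J : Finset (Fin d)) : probeWeight I J 1 = 1 := by
  simp [probeWeight]

lemma one_le_probeWeight (I J : Finset (Fin d)) {T : ℝ} (hT : 1 ≤ T) :
    1 ≤ probeWeight I J T := by
  refine Finset.one_le_prod fun i _ => ?_
  split_ifs
  · exact le_rfl
  · exact one_le_pow₀ hT

lemma sq_le_probeWeight {I J : Finset (Fin d)} (hIJ : J ≠ I) {T : ℝ} (hT : 1 ≤ T) :
    T ^ 2 ≤ probeWeight I J T := by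
  obtain ⟨i, hi⟩ : ∃ i, ¬(i ∈ I ↔ i ∈ J) := by
    by_contra! h
    exact hIJ (Finset.ext fun i => (h i).symm)
  have h1 : 1 ≤ T ^ 2 := one_le_pow₀ hT
  rw [probeWeight, ← Finset.mul_prod_erase _ _ (Finset.mem_univ i), if_neg hi]
  refine le_mul_of_one_le_right (by positivity) (Finset.one_le_prod fun j _ => ?_)
  split_ifs
  · exact le_rfl
  · exact h1

/-- The factor T^d normalises the weight of e_I to one; every index in the symmetric difference of I
and J then costs T². -/
lemma normForm_probe (I : Finset (Fin d)) {T : ℝ} (hT : 0 < T) (φ χ : Fock d) :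
    T ^ d * normForm (probe I T) φ χ = ∑ J, probeWeight I J T * (φ J * χ J) := by
  have hr := probeRadius_pos I hT
  have hdet : √((metric (probe I T)).det) = ∏ i, probeRadius I T i := by
    rw [metric_probe, Matrix.det_diagonal, Finset.prod_pow,
      Real.sqrt_sq (Finset.prod_nonneg fun i _ => (hr i).le)]
  rw [normForm_apply, hdet, gram_eq_sum_compound, metric_probe, Finset.mul_sum, Finset.mul_sum]
  refine Finset.sum_congr rfl fun J _ => ?_
  have hw : probeWeight I J T =
      T ^ d * (∏ i, probeRadius I T i)⁻¹ * ∏ i ∈ J, probeRadius I T i ^ 2 := by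
    have h1 : ∏ i ∈ J, probeRadius I T i ^ 2 =
        ∏ i, if i ∈ J then probeRadius I T i ^ 2 else 1 := by
      rw [Finset.prod_ite_mem, Finset.univ_inter]
    have h2 : T ^ d = ∏ _i : Fin d, T := by simp
    rw [h1, h2, ← Finset.prod_inv_distrib, ← Finset.prod_mul_distrib, ← Finset.prod_mul_distrib,
      probeWeight]
    refine Finset.prod_congr rfl fun i _ => ?_
    have hT' := hT.ne'
    by_cases hi : i ∈ I <;> by_cases hj : i ∈ J <;>
      simp only [probeRadius, hi, hj, if_true, if_false, iff_true, iff_false, not_true, iff_self] <;> field_simp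
  rw [compound_diagonal, hw]
  ring

/-- The rescaled mass formula on `probe I T`. -/
def probeMass (I : Finset (Fin d)) (φ : Fock d) (T : ℝ) : ℝ :=
  ∑ J, probeWeight I J T * φ J ^ 2

/-- The rescaled expectation value of `N (N - d)` on `probe I T`. -/
def probeDegree (I : Finset (Fin d)) (φ : Fock d) (T : ℝ) : ℝ :=
  ∑ J, probeWeight I J T * ((J.card : ℝ) * (J.card - d) * φ J ^ 2)

lemma spinMass_probe (I : Finset (Fin d)) {T : ℝ} (hT : 0 < T) (φ : Fock d) :
    T ^ d * spinMass φ (probe I T) = probeMass I φ T := by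
  rw [spinMass, dressedSpinor_of_bField_eq_zero (bField_probe I T), normForm_probe I hT, probeMass]
  exact Finset.sum_congr rfl fun J _ => by ring

lemma insertion_probe (I : Finset (Fin d)) {T : ℝ} (hT : 0 < T) (φ : Fock d) :
    T ^ d * T ^ d * insertion φ (probe I T) = probeMass I φ T * probeDegree I φ T := by
  rw [insertion_eq, dressedSpinor_of_bField_eq_zero (bField_probe I T), mul_mul_mul_comm,
    spinMass_probe I hT, normForm_probe I hT, probeDegree]
  congr 1
  refine Finset.sum_congr rfl fun J _ => ?_
  simp only [Pi.sub_apply, Pi.smul_apply, number_apply, smul_eq_mul]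
  ring

/-- Bounds the source by a multiple of the mass, uniformly in T and in the charge, which is what
domination of the series requires. -/
lemma abs_probeDegree_le (I : Finset (Fin d)) (φ : Fock d) {T : ℝ} (hT : 1 ≤ T) :
    |probeDegree I φ T| ≤ d ^ 2 * probeMass I φ T := by
  rw [probeDegree, probeMass, Finset.mul_sum]
  refine (Finset.abs_sum_le_sum_abs _ _).trans (Finset.sum_le_sum fun J _ => ?_)
  have hw := one_le_probeWeight I J hT
  have hc : (J.card : ℝ) ≤ d := by exact_mod_cast (by simpa using Finset.card_le_univ J)
  have hc0 : (0 : ℝ) ≤ J.card := Nat.cast_nonneg _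
  have hk : |(J.card : ℝ) * (J.card - d)| ≤ d ^ 2 := by
    rw [abs_le]; constructor <;> nlinarith
  rw [abs_mul, abs_mul, abs_of_nonneg (by linarith : 0 ≤ probeWeight I J T),
    abs_of_nonneg (sq_nonneg (φ J))]
  nlinarith [mul_le_mul_of_nonneg_left hk (mul_nonneg (by linarith : 0 ≤ probeWeight I J T)
    (sq_nonneg (φ J)))]

lemma probeMass_one_le (I : Finset (Fin d)) (φ : Fock d) {T : ℝ} (hT : 1 ≤ T) :
    probeMass I φ 1 ≤ probeMass I φ T := by
  refine Finset.sum_le_sum fun J _ => mul_le_mul_of_nonneg_right ?_ (sq_nonneg _)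
  rw [probeWeight_at_one]
  exact one_le_probeWeight I J hT

lemma probeMass_one_pos (I : Finset (Fin d)) {φ : Fock d} (hφ : φ ≠ 0) :
    0 < probeMass I φ 1 := by
  obtain ⟨J, hJ⟩ := Function.ne_iff.1 hφ
  simp only [probeMass, probeWeight_at_one, one_mul]
  exact Finset.sum_pos' (fun _ _ => sq_nonneg _) ⟨J, Finset.mem_univ J, by
    have : φ J ≠ 0 := hJ
    positivity⟩

lemma sq_mul_le_probeMass {I J : Finset (Fin d)} (hJ : J ≠ I) (φ : Fock d) {T : ℝ} (hT : 1 ≤ T) :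
    T ^ 2 * φ J ^ 2 ≤ probeMass I φ T := by
  refine (mul_le_mul_of_nonneg_right (sq_le_probeWeight hJ hT) (sq_nonneg _)).trans ?_
  exact Finset.single_le_sum (f := fun J => probeWeight I J T * φ J ^ 2) (fun K _ =>
    mul_nonneg (zero_le_one.trans (one_le_probeWeight I K hT)) (sq_nonneg _)) (Finset.mem_univ J)

lemma probeMass_of_support {I : Finset (Fin d)} {φ : Fock d} (h : ∀ J, J ≠ I → φ J = 0) (T : ℝ) :
    probeMass I φ T = φ I ^ 2 := by
  rw [probeMass, Finset.sum_eq_single I (fun J _ hJ => by rw [h J hJ]; ring) (by simp),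
    probeWeight_self, one_mul]

lemma probeDegree_of_support {I : Finset (Fin d)} {φ : Fock d} (h : ∀ J, J ≠ I → φ J = 0)
    (T : ℝ) : probeDegree I φ T = (I.card : ℝ) * (I.card - d) * φ I ^ 2 := by
  rw [probeDegree, Finset.sum_eq_single I (fun J _ hJ => by rw [h J hJ]; ring) (by simp),
    probeWeight_self, one_mul]

/-- The rescaled defect of the eigenvalue equation of `□_d` for a term. -/
def probeDefect (s lam : ℂ) (I : Finset (Fin d)) (φ : Fock d) (T : ℝ) : ℂ :=
  (probeMass I φ T : ℂ) ^ (-s) * ((s ^ 2 * d * (2 - d) / 8 - lam) +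
    s * (1 - s) / 2 * ((probeDegree I φ T / probeMass I φ T : ℝ) : ℂ))

variable {parity : ℕ}

/-- The factor (T^d)^{-s} is common to all charges, so the sum may be rescaled by it; after this the
contribution of n e_I no longer depends on T. -/
lemma box_sub_probe {m : SpinorIndex d parity → ℤ} (hm : m ∈ (spinSystem d parity).charges)
    (s lam : ℂ) (I : Finset (Fin d)) {T : ℝ} (hT : 0 < T) :
    ((T ^ d : ℝ) : ℂ) ^ (-s) * (box ((spinSystem d parity).term s m) (probe I T) -
        lam * (spinSystem d parity).term s m (probe I T)) =
      probeDefect s lam I (toFock (realCharge m)) T := by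
  have hx := probe_mem_moduli I hT
  have hc : (0 : ℝ) < T ^ d := by positivity
  have hf := spinSystem_mass_pos hm hx
  have h1 := spinMass_probe I hT (toFock (realCharge m))
  have h2 := insertion_probe I hT (toFock (realCharge m))
  rw [spinSystem_box hm hx, spinSystem_term, spinSystem_term, probeDefect]
  beta_reduce
  rw [← h1, Complex.ofReal_mul (T ^ d) (spinMass _ _),
    Complex.mul_cpow_ofReal_nonneg hc.le hf.le, ← cpow_sub_two_mul_sq hf s,
    show -(s + 2) = -s - 2 by ring]
  have h3 : insertion (toFock (realCharge m)) (probe I T) =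
      spinMass (toFock (realCharge m)) (probe I T) ^ 2 *
        (probeDegree I (toFock (realCharge m)) T /
          (T ^ d * spinMass (toFock (realCharge m)) (probe I T))) := by
    rw [← h1] at h2
    have hc' := hc.ne'
    have hf' := hf.ne'
    field_simp
    have h4 := mul_left_cancel₀ hc' (by linear_combination h2 : T ^ d *
      (T ^ d * insertion (toFock (realCharge m)) (probe I T)) =
        T ^ d * (spinMass (toFock (realCharge m)) (probe I T) *
          probeDegree I (toFock (realCharge m)) T))
    linear_combination h4
  rw [h3, Complex.ofReal_mul, Complex.ofReal_pow (spinMass _ _)]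
  ring

/-! ## Extremal charges -/

/-- The charge `n e_I`. -/
def extremalCharge (I : SpinorIndex d parity) (n : ℤ) : SpinorIndex d parity → ℤ := Pi.single I n

lemma toFock_extremalCharge (I : SpinorIndex d parity) (n : ℤ) :
    toFock (realCharge (extremalCharge I n)) = Pi.single I.1 (n : ℝ) := by
  funext J
  rw [toFock]
  split_ifs with h
  · rw [realCharge, extremalCharge]
    by_cases hJ : J = I.1
    · subst hJ; simp
    · rw [Pi.single_eq_of_ne hJ, Pi.single_eq_of_ne (fun e => hJ (congrArg Subtype.val e))]
      simp
  · rw [Pi.single_eq_of_ne]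
    rintro rfl
    exact h I.2

lemma extremalCharge_mem (I : SpinorIndex d parity) {n : ℤ} (hn : n ≠ 0) :
    extremalCharge I n ∈ (spinSystem d parity).charges := by
  refine ⟨fun h => hn ?_, ?_⟩
  · have := congrFun h I
    simpa [extremalCharge] using this
  · have h := single_mem_highestComponent I.2 (n : ℝ)
    rw [← toFock_extremalCharge] at h
    exact h

lemma probeDefect_of_support {s : ℂ} (lam : ℂ) {I : Finset (Fin d)} {φ : Fock d}
    (h : ∀ J, J ≠ I → φ J = 0) (hI : φ I ≠ 0) (T : ℝ) : probeDefect s lam I φ T =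
      ((φ I ^ 2 : ℝ) : ℂ) ^ (-s) * ((s ^ 2 * d * (2 - d) / 8 - lam) +
        s * (1 - s) / 2 * ((I.card : ℂ) * (I.card - d))) := by
  rw [probeDefect, probeMass_of_support h, probeDegree_of_support h,
    mul_div_cancel_right₀ _ (pow_ne_zero 2 hI)]
  push_cast
  rfl

/-- The eigenvalue that the charges `n e_I` require. -/
lemma eigenvalue_of_termwise {s lam : ℂ} (h : (spinSystem d parity).TermwiseEigenmode box s lam)
    (I : SpinorIndex d parity) : (s ^ 2 * d * (2 - d) / 8 - lam) +
      s * (1 - s) / 2 * (((I.1.card : ℕ) : ℂ) * ((I.1.card : ℕ) - d)) = 0 := by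
  have hm := extremalCharge_mem I one_ne_zero
  have h1 := box_sub_probe hm s lam I.1 one_pos
  rw [h _ hm _ (probe_mem_moduli I.1 one_pos), sub_self, mul_zero, toFock_extremalCharge,
    probeDefect_of_support lam (fun J hJ => Pi.single_eq_of_ne hJ _) (by simp)] at h1
  simpa using h1.symm

/-- Two extremal charges of different `N (N - d)` force `s = 0` or `s = 1`. -/
lemma eq_zero_or_one_of_card {s K : ℂ} {p q : ℕ} (hp : K + s * (1 - s) / 2 * ((p : ℂ) * (p - d)) = 0)
    (hq : K + s * (1 - s) / 2 * ((q : ℂ) * (q - d)) = 0) (hne : p ≠ q) (hd : p + q ≠ d) :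
    s = 0 ∨ s = 1 := by
  have h : s * (1 - s) * (((p : ℂ) - q) * ((p : ℂ) + q - d)) = 0 := by
    linear_combination 2 * (hp - hq)
  have h1 : ((p : ℂ) - q) ≠ 0 := sub_ne_zero.2 (by exact_mod_cast hne)
  have h2 : ((p : ℂ) + q - d) ≠ 0 := sub_ne_zero.2 (by exact_mod_cast hd)
  rcases mul_eq_zero.1 h with h | h
  · rcases mul_eq_zero.1 h with h | h
    · exact Or.inl h
    · exact Or.inr (sub_eq_zero.1 h).symm
  · exact absurd h (mul_ne_zero h1 h2)

lemma exists_spinorIndex {p : ℕ} (hp : p ≤ d) (hpar : p % 2 = parity) :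
    ∃ I : SpinorIndex d parity, I.1.card = p := by
  obtain ⟨I, -, hI⟩ := Finset.exists_subset_card_eq (s := (Finset.univ : Finset (Fin d))) (n := p)
    (by simpa using hp)
  exact ⟨⟨I, by rw [hI, hpar]⟩, hI⟩

end TDuality

end

open scoped TensorProduct BigOperators
noncomputable section
namespace TDuality
variable {d parity : ℕ}

/-! ## Sums that are not eigenfunctions -/

/-- The sum over the charges `n e_I`. -/
theorem hasSum_int_sq_cpow {s : ℂ} (hs : 1 / 2 < s.re) :
    HasSum (fun n : ℤ => ((((n : ℝ) ^ 2 : ℝ) : ℂ)) ^ (-s)) (2 * riemannZeta (2 * s)) := by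
  have hs2 : 1 < (2 * s).re := by
    simp only [Complex.mul_re, Complex.re_ofNat, Complex.im_ofNat, zero_mul, sub_zero]; linarith
  have hpow : ∀ n : ℕ, ((((n : ℝ) ^ 2 : ℝ) : ℂ)) ^ (-s) = 1 / (n : ℂ) ^ (2 * s) := by
    intro n
    rw [Complex.ofReal_pow, Complex.ofReal_natCast, Complex.cpow_neg, one_div, sq,
      Complex.natCast_mul_natCast_cpow, ← sq, ← Complex.cpow_nat_mul]
    push_cast
    rfl
  have hsum := Complex.summable_one_div_nat_cpow.2 hs2
  have h0 : HasSum (fun n : ℕ => 1 / (n : ℂ) ^ (2 * s)) (riemannZeta (2 * s)) := by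
    rw [zeta_eq_tsum_one_div_nat_cpow hs2]
    exact hsum.hasSum
  have h1 : HasSum (fun n : ℕ => 1 / ((n + 1 : ℕ) : ℂ) ^ (2 * s)) (riemannZeta (2 * s)) := by
    rw [zeta_eq_tsum_one_div_nat_add_one_cpow hs2]
    have := ((summable_nat_add_iff 1).2 hsum).hasSum
    simpa only [Nat.cast_add, Nat.cast_one] using this
  rw [two_mul]
  refine HasSum.of_nat_of_neg_add_one ?_ ?_
  · simpa only [Int.cast_natCast, hpow] using h0
  · refine h1.congr_fun fun n => ?_
    rw [← hpow]
    congr 2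
    push_cast
    ring

/-- The charges n e_I with n ≥ 1 form a subseries Σ n^{-2s} at the unit torus, whose absolute
convergence forces 2 Re s > 1. -/
lemma half_lt_re_of_convergesAt {s : ℂ} (I : SpinorIndex d parity)
    (hs : (spinSystem d parity).ConvergesAt s) : 1 / 2 < s.re := by
  have h := hs _ (probe_mem_moduli I.1 one_pos)
  let j : ℕ → (spinSystem d parity).charges := fun n =>
    ⟨extremalCharge I ((n : ℤ) + 1), extremalCharge_mem I (by positivity)⟩
  have hj : Function.Injective j := by
    intro a b hab
    have h1 := congrFun (congrArg Subtype.val hab) I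
    simp only [j, extremalCharge, Pi.single_eq_same] at h1
    omega
  have h2 := h.comp_injective hj
  have h3 : ∀ n : ℕ, ‖(spinSystem d parity).term s (j n) (probe I.1 1)‖ =
      ((n + 1 : ℕ) : ℝ) ^ (-(2 * s.re)) := by
    intro n
    have h4 := spinMass_probe I.1 one_pos (Pi.single I.1 ((((n : ℤ) + 1 : ℤ)) : ℝ) : Fock d)
    rw [probeMass_of_support (fun J hJ => Pi.single_eq_of_ne hJ _), Pi.single_eq_same, one_pow,
      one_mul] at h4
    rw [spinSystem_term (d := d) (parity := parity) s (j n).1]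
    beta_reduce
    change ‖(spinMass (toFock (realCharge (extremalCharge I ((n : ℤ) + 1)))) _ : ℂ) ^ (-s)‖ = _
    have hn : (0 : ℝ) ≤ ((n + 1 : ℕ) : ℝ) := by positivity
    rw [toFock_extremalCharge, h4, Complex.norm_cpow_eq_rpow_re_of_pos (by positivity),
      show ((((n : ℤ) + 1 : ℤ)) : ℝ) = ((n + 1 : ℕ) : ℝ) by push_cast; rfl,
      ← Real.rpow_natCast, ← Real.rpow_mul hn]
    congr 1
    push_cast
    rw [Complex.neg_re]; ring
  have h5 : Summable fun n : ℕ => ((n + 1 : ℕ) : ℝ) ^ (-(2 * s.re)) := by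
    simpa only [Function.comp_def, h3] using h2
  have h6 := Real.summable_nat_rpow.1 ((summable_nat_add_iff 1).1 h5)
  linarith

/-- The limit of the rescaled defect under the degeneration. -/
def limitDefect (s lam : ℂ) (I : SpinorIndex d parity) (m : SpinorIndex d parity → ℤ) : ℂ :=
  open Classical in
  if ∃ n : ℤ, m = extremalCharge I n then
    ((((m I : ℝ) ^ 2 : ℝ) : ℂ)) ^ (-s) * ((s ^ 2 * d * (2 - d) / 8 - lam) +
        s * (1 - s) / 2 * (((I.1.card : ℕ) : ℂ) * ((I.1.card : ℕ) - d)))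
  else 0

lemma hasSum_limitDefect {s : ℂ} (lam : ℂ) (hs : 1 / 2 < s.re) (I : SpinorIndex d parity) :
    HasSum (fun m : (spinSystem d parity).charges => limitDefect s lam I m.1)
      (2 * riemannZeta (2 * s) * ((s ^ 2 * d * (2 - d) / 8 - lam) +
        s * (1 - s) / 2 * (((I.1.card : ℕ) : ℂ) * ((I.1.card : ℕ) - d)))) := by
  -- This gives 0^{-s} = 0, so the zero charge, excluded from the lattice sum but present as n = 0,
  -- contributes nothing to the limit.
  have hs0 : -s ≠ 0 := by
    intro h
    rw [neg_eq_zero] at h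
    rw [h] at hs
    norm_num at hs
  have hinj : Function.Injective (extremalCharge I) := by
    intro a b hab
    have h1 := congrFun hab I
    simpa [extremalCharge] using h1
  have h1 : HasSum (limitDefect s lam I) (2 * riemannZeta (2 * s) *
      ((s ^ 2 * d * (2 - d) / 8 - lam) +
        s * (1 - s) / 2 * (((I.1.card : ℕ) : ℂ) * ((I.1.card : ℕ) - d)))) := by
    rw [← hinj.hasSum_iff]
    · refine ((hasSum_int_sq_cpow hs).mul_right _).congr_fun fun n => ?_
      rw [Function.comp_apply, limitDefect, if_pos ⟨n, rfl⟩]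
      simp [extremalCharge]
    · intro m hm
      rw [limitDefect, if_neg]
      rintro ⟨n, rfl⟩
      exact hm ⟨n, rfl⟩
  refine (hasSum_subtype_iff_of_support_subset ?_).2 h1
  intro m hm
  rw [Function.mem_support, limitDefect] at hm
  split_ifs at hm with h
  · obtain ⟨n, rfl⟩ := h
    refine extremalCharge_mem I ?_
    rintro rfl
    apply hm
    simp [extremalCharge, Complex.zero_cpow hs0]
  · exact absurd rfl hm

lemma norm_probeDefect_le (s lam : ℂ) (I : Finset (Fin d)) {φ : Fock d}
    (hφ : φ ≠ 0) {T : ℝ} (hT : 1 ≤ T) : ‖probeDefect s lam I φ T‖ ≤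
      probeMass I φ T ^ (-s.re) * (‖s ^ 2 * d * (2 - d) / 8 - lam‖ +
        ‖s * (1 - s) / 2‖ * d ^ 2) := by
  have hpos : 0 < probeMass I φ T := (probeMass_one_pos I hφ).trans_le (probeMass_one_le I φ hT)
  rw [probeDefect, norm_mul, Complex.norm_cpow_eq_rpow_re_of_pos hpos, Complex.neg_re]
  refine mul_le_mul_of_nonneg_left ((norm_add_le _ _).trans (add_le_add le_rfl ?_))
    (Real.rpow_nonneg hpos.le _)
  rw [norm_mul, Complex.norm_real, Real.norm_eq_abs, abs_div, abs_of_pos hpos]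
  exact mul_le_mul_of_nonneg_left ((div_le_iff₀ hpos).2 (abs_probeDegree_le I φ hT))
    (norm_nonneg _)

/-- For a charge n e_I the defect is constant in T. Any other charge has a nonzero integer component
at some J ≠ I, so its rescaled mass is at least T² and the power with Re s > 0 decays. -/
lemma tendsto_probeDefect (s lam : ℂ) (hs : 0 < s.re) (I : SpinorIndex d parity)
    {m : SpinorIndex d parity → ℤ} (hm : m ≠ 0) :
    Filter.Tendsto (fun k : ℕ => probeDefect s lam I.1 (toFock (realCharge m)) ((k : ℝ) + 1))
      Filter.atTop (nhds (limitDefect s lam I m)) := by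
  have hφ := toFock_ne_zero (realCharge_ne_zero hm)
  by_cases h : ∃ n : ℤ, m = extremalCharge I n
  · rw [limitDefect, if_pos h]
    obtain ⟨n, rfl⟩ := h
    have hn : n ≠ 0 := by
      rintro rfl
      exact hm (by simp [extremalCharge])
    rw [toFock_extremalCharge]
    refine tendsto_const_nhds.congr fun k => ?_
    rw [probeDefect_of_support lam (fun J hJ => Pi.single_eq_of_ne hJ _)
      (by simpa using hn)]
    simp [extremalCharge]
  · rw [limitDefect, if_neg h]
    obtain ⟨J, hJI, hJ⟩ : ∃ J : SpinorIndex d parity, J ≠ I ∧ m J ≠ 0 := by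
      by_contra! hall
      refine h ⟨m I, funext fun J => ?_⟩
      by_cases hJ : J = I
      · subst hJ; simp [extremalCharge]
      · rw [hall J hJ, extremalCharge, Pi.single_eq_of_ne hJ]
    have hJ1 : J.1 ≠ I.1 := fun e => hJI (Subtype.ext e)
    have hval : toFock (realCharge m) J.1 = (m J : ℝ) := by
      rw [toFock, dif_pos J.2]; rfl
    have hgrow : Filter.Tendsto
        (fun k : ℕ => probeMass I.1 (toFock (realCharge m)) ((k : ℝ) + 1))
        Filter.atTop Filter.atTop := by
      refine Filter.tendsto_atTop_mono (fun k => ?_) ((tendsto_natCast_atTop_atTop (R := ℝ)))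
      have hT : (1 : ℝ) ≤ (k : ℝ) + 1 := by
        have : (0 : ℝ) ≤ k := Nat.cast_nonneg k
        linarith
      refine le_trans ?_ (sq_mul_le_probeMass hJ1 (toFock (realCharge m)) hT)
      have h1 : (1 : ℝ) ≤ (m J : ℝ) ^ 2 := by
        have : (1 : ℤ) ≤ m J ^ 2 := (by positivity : 0 < m J ^ 2)
        exact_mod_cast this
      rw [hval]
      nlinarith
    have hlim := ((tendsto_rpow_neg_atTop hs).comp hgrow).mul_const
      (‖s ^ 2 * d * (2 - d) / 8 - lam‖ + ‖s * (1 - s) / 2‖ * d ^ 2)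
    rw [zero_mul] at hlim
    refine squeeze_zero_norm (fun k => ?_) hlim
    exact norm_probeDefect_le s lam I.1 hφ (by
      have : (0 : ℝ) ≤ k := Nat.cast_nonneg k
      linarith)

/-- The eigenvalue that the sum over the charges requires. -/
theorem eigenvalue_of_sum {s lam : ℂ} (hconv : (spinSystem d parity).ConvergesAt s)
    (h : EigenEq box lam ((spinSystem d parity).series s)) (I : SpinorIndex d parity) :
    (s ^ 2 * d * (2 - d) / 8 - lam) +
      s * (1 - s) / 2 * (((I.1.card : ℕ) : ℂ) * ((I.1.card : ℕ) - d)) = 0 := by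
  have hreg := regular_spinSystem d parity
  have hs := half_lt_re_of_convergesAt I hconv
  have hzero : ∀ k : ℕ, ∑' m : (spinSystem d parity).charges,
      probeDefect s lam I.1 (toFock (realCharge m.1)) ((k : ℝ) + 1) =
      0 := by
    intro k
    have hT : (0 : ℝ) < (k : ℝ) + 1 := by positivity
    have hx := probe_mem_moduli I.1 hT
    have h1 := ((hreg.hasSum_operator isSecondOrder_box hconv hx).sub
      ((ChargeSystem.Regular.hasSum_series hconv hx).mul_left lam)).mul_left
      (((((k : ℝ) + 1) ^ d : ℝ) : ℂ) ^ (-s))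
    rw [h _ hx, sub_self, mul_zero] at h1
    refine (h1.congr_fun fun m => ?_).tsum_eq
    exact (box_sub_probe m.2 s lam I.1 hT).symm
  -- The weights are one at T = 1 and never smaller afterwards. Since Re s > 0, the terms at T = 1
  -- dominate those at all T ≥ 1, and they are the terms of the series at the unit torus.
  have hbound : Summable fun m : (spinSystem d parity).charges =>
      probeMass I.1 (toFock (realCharge m.1)) 1 ^ (-s.re) *
        (‖s ^ 2 * d * (2 - d) / 8 - lam‖ + ‖s * (1 - s) / 2‖ * d ^ 2) := by
    refine ((hconv _ (probe_mem_moduli I.1 one_pos)).congr fun m => ?_).mul_right _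
    rw [hreg.norm_term (probe_mem_moduli I.1 one_pos) m.2.1]
    have h1 : (spinSystem d parity).mass (probe I.1 1) m.1 =
        spinMass (toFock (realCharge m.1)) (probe I.1 1) :=
      spinSystem_massSq _ (realCharge m.1)
    rw [h1, ← spinMass_probe I.1 one_pos, one_pow, one_mul]
  have hlim := tendsto_tsum_of_dominated_convergence hbound
    (fun m : (spinSystem d parity).charges => tendsto_probeDefect s lam (by linarith) I m.2.1)
    (Filter.Eventually.of_forall fun k m => by
      have hk : (1 : ℝ) ≤ (k : ℝ) + 1 := by
        have : (0 : ℝ) ≤ k := Nat.cast_nonneg k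
        linarith
      have hφ : toFock (realCharge m.1) ≠ 0 :=
        toFock_realCharge_ne_zero m.2
      refine (norm_probeDefect_le s lam I.1 hφ hk).trans ?_
      refine mul_le_mul_of_nonneg_right ?_ (by positivity)
      exact Real.rpow_le_rpow_of_nonpos (probeMass_one_pos I.1 hφ)
        (probeMass_one_le I.1 _ hk) (by linarith))
  simp only [hzero] at hlim
  have h2 := tendsto_nhds_unique hlim tendsto_const_nhds
  rw [(hasSum_limitDefect lam hs I).tsum_eq] at h2
  have hs2 : 1 < (2 * s).re := by
    simp only [Complex.mul_re, Complex.re_ofNat, Complex.im_ofNat, zero_mul, sub_zero]; linarith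
  -- ζ has no zeros to the right of Re = 1, so the remaining factor must vanish.
  exact (mul_eq_zero.1 h2).resolve_left
    (mul_ne_zero two_ne_zero (riemannZeta_ne_zero_of_one_lt_re hs2))

theorem not_eigenEq_of_card {s : ℂ} (hs : s ≠ 1) (hconv : (spinSystem d parity).ConvergesAt s)
    {p q : ℕ} (hp : p ≤ d) (hq : q ≤ d) (hp' : p % 2 = parity) (hq' : q % 2 = parity)
    (hne : p ≠ q) (hd : p + q ≠ d) : ¬ ∃ lam, EigenEq box lam ((spinSystem d parity).series s) := by
  rintro ⟨lam, h⟩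
  obtain ⟨I, rfl⟩ := exists_spinorIndex hp hp'
  obtain ⟨J, rfl⟩ := exists_spinorIndex hq hq'
  rcases eq_zero_or_one_of_card (eigenvalue_of_sum hconv h I) (eigenvalue_of_sum hconv h J) hne hd
    with rfl | h1
  -- The alternative s = 0 is excluded by convergence, which forces Re s > 1/2.
  · have := half_lt_re_of_convergesAt I hconv
    norm_num at this
  · exact hs h1

theorem eq_one_of_termwise_of_card {s : ℂ} (hs : s ≠ 0) {p q : ℕ} (hp : p ≤ d) (hq : q ≤ d)
    (hp' : p % 2 = parity) (hq' : q % 2 = parity) (hne : p ≠ q) (hd : p + q ≠ d)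
    (h : ∃ lam, (spinSystem d parity).TermwiseEigenmode box s lam) : s = 1 := by
  obtain ⟨lam, h⟩ := h
  obtain ⟨I, rfl⟩ := exists_spinorIndex hp hp'
  obtain ⟨J, rfl⟩ := exists_spinorIndex hq hq'
  exact (eq_zero_or_one_of_card (eigenvalue_of_termwise h I) (eigenvalue_of_termwise h J)
    hne hd).resolve_left hs

end TDuality

end

/-! ### The orders and dimensions with eigenmodes -/

open TDuality in
theorem mainTheorem7 (d : ℕ) (hd : 1 ≤ d) :
    -- absolute convergence for large `Re s`
    (∀ s ∈ (vectorSystem d).halfPlane, (vectorSystem d).ConvergesAt s) ∧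
    (∀ s ∈ (spinorSystem d).halfPlane, (spinorSystem d).ConvergesAt s) ∧
    (∀ s ∈ (conjSpinorSystem d).halfPlane, (conjSpinorSystem d).ConvergesAt s) ∧
    -- the vector series
    (∀ s : ℂ, (vectorSystem d).IsEigenmode laplaceSO s (s * (s - d + 1)) ∧
      (vectorSystem d).IsEigenmode box s (s * (s - d + 1) / 2)) ∧
    -- the spinor series under the Laplacian
    (∀ s : ℂ, (spinorSystem d).IsEigenmode laplaceSO s (s * d * (s - d + 1) / 4) ∧
      (conjSpinorSystem d).IsEigenmode laplaceSO s (s * d * (s - d + 1) / 4)) ∧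
    -- the spinor series under the non-invariant operator at `s = 1`
    (spinorSystem d).IsIsolatedEigenmode box 1 (d * (2 - d) / 8) ∧
    (conjSpinorSystem d).IsIsolatedEigenmode box 1 (d * (2 - d) / 8) ∧
    -- there is no other order `s ≠ 0` at which they are eigenmodes, but for low `d`
    (∀ s : ℂ, s ≠ 0 →
      ((∃ lam, (spinorSystem d).TermwiseEigenmode box s lam) ↔
        s = 1 ∨ d = 1 ∨ d = 2 ∨ d = 4) ∧
      ((∃ lam, (conjSpinorSystem d).TermwiseEigenmode box s lam) ↔
        s = 1 ∨ d = 1 ∨ d = 2)) ∧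
    (3 ≤ d → d ≠ 4 → ∀ s : ℂ, s ≠ 1 → (spinorSystem d).ConvergesAt s →
      ¬ ∃ lam, EigenEq box lam ((spinorSystem d).series s)) ∧
    (3 ≤ d → ∀ s : ℂ, s ≠ 1 → (conjSpinorSystem d).ConvergesAt s →
      ¬ ∃ lam, EigenEq box lam ((conjSpinorSystem d).series s)) ∧
    -- four dimensions
    (d = 4 → ∀ s : ℂ, (spinorSystem d).IsEigenmode box s (s * (s - 3) / 2)) := by
  have hV := regular_vectorSystem (d := d)
  have hS := regular_spinSystem d 1
  have hC := regular_spinSystem d 0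
  refine ⟨fun s hs => hV.convergesAt_of_mem_halfPlane hs,
    fun s hs => hS.convergesAt_of_mem_halfPlane hs,
    fun s hs => hC.convergesAt_of_mem_halfPlane hs, fun s => ⟨?_, ?_⟩, fun s => ⟨?_, ?_⟩,
    spinSystem_isIsolatedEigenmode_box d 1, spinSystem_isIsolatedEigenmode_box d 0,
    fun s hs => ⟨⟨fun h => ?_, fun h => ?_⟩, ⟨fun h => ?_, fun h => ?_⟩⟩,
    fun h3 h4 s hs hconv => ?_, fun h3 s hs hconv => ?_, fun h4 s => ?_⟩
  · exact hV.isEigenmode isSecondOrder_laplaceSO (lam := fun s => s * (s - d + 1))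
      (by fun_prop) vectorSystem_termwise_laplaceSO s
  · exact hV.isEigenmode isSecondOrder_box (lam := fun s => s * (s - d + 1) / 2)
      (by fun_prop) vectorSystem_termwise_box s
  · exact hS.isEigenmode isSecondOrder_laplaceSO (lam := fun s => s * d * (s - d + 1) / 4)
      (by fun_prop) (spinSystem_termwise_laplaceSO 1) s
  · exact hC.isEigenmode isSecondOrder_laplaceSO (lam := fun s => s * d * (s - d + 1) / 4)
      (by fun_prop) (spinSystem_termwise_laplaceSO 0) s
  -- With d ≥ 3 and d ≠ 4 the degrees 1 and 3 both occur and 1 + 3 ≠ d, so they require different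
  -- eigenvalues.
  · by_contra! hcon
    exact hcon.1 (eq_one_of_termwise_of_card hs (p := 1) (q := 3) (by omega) (by omega) rfl rfl
      (by omega) (by omega) h)
  · rcases h with rfl | rfl | rfl | rfl
    · exact ⟨_, (spinSystem_isIsolatedEigenmode_box d 1).termwise⟩
    · exact ⟨_, spinSystem_termwise_box_of_low (κ := 0) (fun p hp hpar => by
        obtain rfl : p = 1 := by omega
        norm_num) s⟩
    · exact ⟨_, spinSystem_termwise_box_of_low (κ := -1) (fun p hp hpar => by
        obtain rfl : p = 1 := by omega
        norm_num) s⟩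
    -- In four dimensions the odd degrees 1 and 3 are exchanged by p ↦ d - p, hence share p(p-4) =
    -- -3.
    · exact ⟨_, spinSystem_termwise_box_of_low (κ := -3) (fun p hp hpar => by
        obtain rfl | rfl : p = 1 ∨ p = 3 := by omega
        all_goals norm_num) s⟩
  -- For d ≥ 3 the degrees 0 and 2 both occur and 0 + 2 ≠ d. No exception arises at d = 4, since the
  -- degree 2 gives -4 and the degrees 0 and 4 give 0.
  · by_contra! hcon
    exact hcon.1 (eq_one_of_termwise_of_card hs (p := 0) (q := 2) (by omega) (by omega) rfl rfl
      (by omega) (by omega) h)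
  · rcases h with rfl | rfl | rfl
    · exact ⟨_, (spinSystem_isIsolatedEigenmode_box d 0).termwise⟩
    · exact ⟨_, spinSystem_termwise_box_of_low (κ := 0) (fun p hp hpar => by
        obtain rfl : p = 0 := by omega
        norm_num) s⟩
    · exact ⟨_, spinSystem_termwise_box_of_low (κ := 0) (fun p hp hpar => by
        obtain rfl | rfl : p = 0 ∨ p = 2 := by omega
        all_goals norm_num) s⟩
  · exact not_eigenEq_of_card hs hconv (p := 1) (q := 3) (by omega) h3 rfl rfl (by omega)
      (by omega)
  · exact not_eigenEq_of_card hs hconv (p := 0) (q := 2) (by omega) (by omega) rfl rfl (by omega)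
      (by omega)
  · subst h4
    refine hS.isEigenmode isSecondOrder_box (lam := fun s => s * (s - 3) / 2) (by fun_prop)
      (fun s => ?_) s
    have h := spinSystem_termwise_box_of_low (d := 4) (parity := 1) (κ := -3) (fun p hp hpar => by
        obtain rfl | rfl : p = 1 ∨ p = 3 := by omega
        all_goals norm_num) s
    convert h using 1
    push_cast
    ring
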